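/- Let $(M,g)$ be a smooth Hausdorff $n$-dimensional manifold with a smooth pseudo-Riemannian metric (of any signature, e.g. Lorentzian), with Levi-Civita connection $\nabla$ and curvature $R(X,Y)Z=\nabla_X\nabla_YZ-\nabla_Y\nabla_XZ-\nabla_{[X,Y]}Z$, $R(\partial_\gamma,\partial_\delta)\partial_\beta=R^\alpha{}_{\beta\gamma\delta}\partial_\alpha$, Ricci tensor $R_{\alpha\beta}=R^\lambda{}_{\alpha\lambda\beta}$ and scalar curvature $R$. Let $\ell$ be a smooth, nowhere zero, null 1-form that is geodesic: $D\ell=\kappa\,\ell$, where $D=\ell^\lambda\nabla_\lambda$ and $\kappa$ is a smooth function. Put $\theta=\tfrac12\nabla_\lambda\ell^\lambda$ and $$\Delta=-2D\theta+4\theta^2-3R_{\sigma\lambda}\ell^\sigma\ell^\lambda+2\ell^\mu\nabla_\sigma\nabla^\sigma\ell_\mu+D\kappa-2\kappa\theta ,$$ and assume that $\Delta$ vanishes nowhere. Put $\gamma=g+T$ with $$T_{\alpha\beta}=\frac{2\left(R_{\alpha\sigma\beta\mu}\ell^\sigma\ell^\mu+R_{\alpha\mu}\ell^\mu\ell_\beta+R_{\beta\mu}\ell^\mu\ell_\alpha\right)-R\,\ell_\alpha\ell_\beta}{\Delta}.$$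 A smooth vector field $\xi$ is a Kerr-Schild vector field (with respect to $\ell$) if $\mathcal L_\xi g=2h\,\ell\otimes\ell$ and $\mathcal L_\xi\ell=m\,\ell$ for some smooth functions $h,m$. Then $\Delta$ is a smooth function, $T$ is a smooth symmetric tensor field, and: 1. For every Kerr-Schild vector field $\xi$ with functions $h,m$: $\mathcal L_\xi\Delta=2m\Delta$, $\;2h\,\ell\otimes\ell=\mathcal L_\xi(-T)$, and hence $\mathcal L_\xi\gamma=0$. 2. Consequently, every Kerr-Schild vector field leaves $\gamma$ invariant and satisfies $\mathcal L_\xi\ell=m\ell$. More precisely, a smooth vector field $\xi$ is a Kerr-Schild vector field if and only if $\mathcal L_\xi\gamma=0$, $\mathcal L_\xi\ell=m\,\ell$ for some smooth $m$, and $\mathcal L_\xi T=f\,\ell\otimes\ell$ for some smooth $f$. If $T$ itself is a smooth multiple of $\ell\otimes\ell$, the last condition can be dropped: the Kerr-Schild vector fields are then exactly the smooth fields leaving $\gamma$ invariant and satisfying $\mathcal L_\xi\ell=m\,\ell$ for some smooth $m$. 3. If $\det\gamma\neq0$ everywhere, then $\gamma$ is a pseudo-Riemannian metric, and every smooth vector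 field leaving $\gamma$ invariant, in particular every Kerr-Schild vector field, is a Killing vector field of $\gamma$. -/

import Mathlib

open scoped Manifold ContDiff Bundle

noncomputable section

namespace KerrSchild

/-- A (not necessarily smooth) vector field on an `n`-dimensional manifold `M`. -/
abbrev VField (n : ℕ) (M : Type*) [TopologicalSpace M]
    [ChartedSpace (EuclideanSpace ℝ (Fin n)) M] :=
  (x : M) → TangentSpace (𝓡 n) x

/-- A (not necessarily smooth) field of 1-forms. -/
abbrev OneForm (n : ℕ) (M : Type*) [TopologicalSpace M]
    [ChartedSpace (EuclideanSpace ℝ (Fin n)) M] :=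
  (x : M) → TangentSpace (𝓡 n) x →L[ℝ] ℝ

/-- A (not necessarily smooth) field of bilinear forms, i.e. a 2-covariant tensor field. -/
abbrev BilinField (n : ℕ) (M : Type*) [TopologicalSpace M]
    [ChartedSpace (EuclideanSpace ℝ (Fin n)) M] :=
  (x : M) → TangentSpace (𝓡 n) x →L[ℝ] TangentSpace (𝓡 n) x →L[ℝ] ℝ

variable {n : ℕ} {M : Type*} [TopologicalSpace M] [ChartedSpace (EuclideanSpace ℝ (Fin n)) M]
  [IsManifold (𝓡 n) ∞ M]

/-! ### Smoothness -/

/-- `X` is a `C^∞` vector field. -/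
def SmoothField (X : VField n M) : Prop :=
  ContMDiff (𝓡 n) ((𝓡 n).prod 𝓘(ℝ, EuclideanSpace ℝ (Fin n))) ∞
    (fun x => Bundle.TotalSpace.mk' (EuclideanSpace ℝ (Fin n))
      (E := fun x : M => TangentSpace (𝓡 n) x) x (X x))

/-- `α` is a `C^∞` field of 1-forms. -/
def SmoothForm (α : OneForm n M) : Prop :=
  ContMDiff (𝓡 n) ((𝓡 n).prod 𝓘(ℝ, EuclideanSpace ℝ (Fin n) →L[ℝ] ℝ)) ∞
    (fun x => Bundle.TotalSpace.mk' (EuclideanSpace ℝ (Fin n) →L[ℝ] ℝ)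
      (E := fun x : M => TangentSpace (𝓡 n) x →L[ℝ] ℝ) x (α x))

/-- `B` is a `C^∞` 2-covariant tensor field. -/
def SmoothBilin (B : BilinField n M) : Prop :=
  ContMDiff (𝓡 n)
    ((𝓡 n).prod 𝓘(ℝ, EuclideanSpace ℝ (Fin n) →L[ℝ] EuclideanSpace ℝ (Fin n) →L[ℝ] ℝ)) ∞
    (fun x => Bundle.TotalSpace.mk'
      (EuclideanSpace ℝ (Fin n) →L[ℝ] EuclideanSpace ℝ (Fin n) →L[ℝ] ℝ)
      (E := fun x : M => TangentSpace (𝓡 n) x →L[ℝ] TangentSpace (𝓡 n) x →L[ℝ] ℝ) x (B x))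

/-- A smooth pseudo-Riemannian metric, of arbitrary signature (for instance Lorentzian). -/
structure IsMetric (g : BilinField n M) : Prop where
  smooth : SmoothBilin g
  symm : ∀ (x : M) (u v : TangentSpace (𝓡 n) x), g x u v = g x v u
  nondegenerate : ∀ (x : M) (u : TangentSpace (𝓡 n) x), (∀ v, g x u v = 0) → u = 0

/-! ### Coordinate frames -/

/-- The coordinate vector field `∂ᵢ` of the preferred chart around `x`
(smooth near `x`, and extended by `0` outside the domain of that chart). -/
def frame (x : M) (i : Fin n) : VField n M :=
  (trivializationAt (EuclideanSpace ℝ (Fin n))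
    (TangentSpace (𝓡 n) : M → Type _) x).localFrame
      (EuclideanSpace.basisFun (Fin n) ℝ).toBasis i

/-- The coordinate 1-form `dxⁱ` of the preferred chart around `x`, at the point `x`. -/
def coframe (x : M) (i : Fin n) : TangentSpace (𝓡 n) x →L[ℝ] ℝ :=
  (EuclideanSpace.proj i : EuclideanSpace ℝ (Fin n) →L[ℝ] ℝ).comp
    ((trivializationAt (EuclideanSpace ℝ (Fin n))
      (TangentSpace (𝓡 n) : M → Type _) x).continuousLinearMapAt ℝ x)

/-- The coordinate 1-forms are dual to the coordinate vector fields. -/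
theorem coframe_frame (x : M) (i j : Fin n) :
    coframe x i (frame x j x) = if i = j then 1 else 0 := by
  have hx := FiberBundle.mem_baseSet_trivializationAt (EuclideanSpace ℝ (Fin n))
    (TangentSpace (𝓡 n) : M → Type _) x
  rw [coframe, frame, Bundle.Trivialization.localFrame_apply_of_mem_baseSet _ _ hx]
  simp only [ContinuousLinearMap.comp_apply]
  rw [Bundle.Trivialization.basisAt]
  simp [Bundle.Trivialization.coe_linearMapAt_of_mem _ hx, Bundle.Trivialization.apply_mk_symm _ hx]

/-- The covector at `x` with components `Φ(∂ᵢ)`. -/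
def covectorAt (x : M) (Φ : VField n M → ℝ) : TangentSpace (𝓡 n) x →L[ℝ] ℝ :=
  ∑ i, Φ (frame x i) • coframe x i

/-- The bilinear form at `x` with components `Φ(∂ᵢ, ∂ⱼ)`. -/
def bilinAt (x : M) (Φ : VField n M → VField n M → ℝ) :
    TangentSpace (𝓡 n) x →L[ℝ] TangentSpace (𝓡 n) x →L[ℝ] ℝ :=
  ∑ i, ∑ j, Φ (frame x i) (frame x j) • (coframe x i).smulRight (coframe x j)

/-- The tensor square `α ⊗ α`. -/
def sq (α : OneForm n M) : BilinField n M := fun x => (α x).smulRight (α x)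

/-! ### Lie derivatives -/

/-- Lie derivative of a function, `ξ(f)`. -/
def lieFun (ξ : VField n M) (f : M → ℝ) (x : M) : ℝ := mvfderiv (𝓡 n) f x (ξ x)

/-- Lie derivative of a 1-form: `(L_ξ α)(X) = ξ(α(X)) - α([ξ, X])`. -/
def lieForm (ξ : VField n M) (α : OneForm n M) : OneForm n M := fun x =>
  covectorAt x fun X =>
    lieFun ξ (fun y => α y (X y)) x - α x (VectorField.mlieBracket (𝓡 n) ξ X x)

/-- Lie derivative of a 2-covariant tensor:
`(L_ξ B)(X, Y) = ξ(B(X, Y)) - B([ξ, X], Y) - B(X, [ξ, Y])`. -/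
def lieBilin (ξ : VField n M) (B : BilinField n M) : BilinField n M := fun x =>
  bilinAt x fun X Y =>
    lieFun ξ (fun y => B y (X y) (Y y)) x
      - B x (VectorField.mlieBracket (𝓡 n) ξ X x) (Y x)
      - B x (X x) (VectorField.mlieBracket (𝓡 n) ξ Y x)

/-- `ξ` is a Killing vector field of the metric `g`. -/
structure IsKilling (g : BilinField n M) (ξ : VField n M) : Prop where
  metric : IsMetric g
  smooth : SmoothField ξ
  lie_eq_zero : ∀ x, lieBilin ξ g x = 0

/-! ### Levi-Civita connection and curvature -/

/-- The vector field obtained from a 1-form by raising the index with `g`. -/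
def sharp (g : BilinField n M) (α : OneForm n M) : VField n M := fun x => (g x).inverse (α x)

/-- Components `g^{ij}` of the inverse metric at `x`. -/
def invMetric (g : BilinField n M) (x : M) (i j : Fin n) : ℝ :=
  coframe x i ((g x).inverse (coframe x j))

/-- Right-hand side of Koszul's formula for `g(∇_X Y, Z)`. -/
def koszul (g : BilinField n M) (X Y Z : VField n M) (x : M) : ℝ :=
  (1 / 2) *
    (lieFun X (fun y => g y (Y y) (Z y)) x + lieFun Y (fun y => g y (X y) (Z y)) x
      - lieFun Z (fun y => g y (X y) (Y y)) x
      + g x (VectorField.mlieBracket (𝓡 n) X Y x) (Z x)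
      - g x (VectorField.mlieBracket (𝓡 n) X Z x) (Y x)
      - g x (VectorField.mlieBracket (𝓡 n) Y Z x) (X x))

/-- The Levi-Civita connection: `∇_X Y` is the vector field with `g(∇_X Y, Z)` given by
Koszul's formula. -/
def nabla (g : BilinField n M) (X Y : VField n M) : VField n M :=
  sharp g fun x => covectorAt x fun Z => koszul g X Y Z x

/-- The curvature `R(X, Y)Z = ∇_X ∇_Y Z - ∇_Y ∇_X Z - ∇_{[X, Y]} Z`.
In components, `R(∂_c, ∂_d) ∂_b = R^a_{bcd} ∂_a`. -/
def curvature (g : BilinField n M) (X Y Z : VField n M) : VField n M := fun x =>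
  nabla g X (nabla g Y Z) x - nabla g Y (nabla g X Z) x
    - nabla g (VectorField.mlieBracket (𝓡 n) X Y) Z x

/-- The Ricci tensor `R_{ab} = R^c_{acb}`, i.e. `Ric(Y, Z) = tr (X ↦ R(X, Z)Y)`. -/
def ricci (g : BilinField n M) (Y Z : VField n M) (x : M) : ℝ :=
  ∑ k, coframe x k (curvature g (frame x k) Z Y x)

/-- The scalar curvature `R = g^{ab} R_{ab}`. -/
def scalarCurvature (g : BilinField n M) (x : M) : ℝ :=
  ∑ i, ∑ j, invMetric g x i j * ricci g (frame x i) (frame x j) x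

/-- The divergence `∇_a X^a`. -/
def divergence (g : BilinField n M) (X : VField n M) (x : M) : ℝ :=
  ∑ k, coframe x k (nabla g (frame x k) X x)

/-- The vector field `∇_a ∇^a X = g^{ab} ∇²_{a,b} X`,
with `∇²_{U,V} X = ∇_U ∇_V X - ∇_{∇_U V} X`. -/
def boxField (g : BilinField n M) (X : VField n M) : VField n M := fun x =>
  ∑ i, ∑ j, invMetric g x i j •
    (nabla g (frame x i) (nabla g (frame x j) X) x
      - nabla g (nabla g (frame x i) (frame x j)) X x)

/-! ### Null geodesic 1-forms and the scalar `Δ` -/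

/-- `ℓ` is a smooth null 1-form field (null covectors are nonzero by convention). -/
structure IsNull (g : BilinField n M) (l : OneForm n M) : Prop where
  smooth : SmoothForm l
  ne_zero : ∀ x, l x ≠ 0
  null : ∀ x, l x (sharp g l x) = 0

/-- `ℓ` is geodesic with `Dℓ = κ ℓ`, where `D = ∇_ℓ` and `κ` is a smooth function. -/
structure IsGeodesic (g : BilinField n M) (l : OneForm n M) (κ : M → ℝ) : Prop where
  smooth : ContMDiff (𝓡 n) 𝓘(ℝ, ℝ) ∞ κ
  eq : ∀ x, nabla g (sharp g l) (sharp g l) x = κ x • sharp g l x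

/-- The expansion `θ = (1/2) ∇_a ℓ^a`. -/
def expansion (g : BilinField n M) (l : OneForm n M) (x : M) : ℝ :=
  (1 / 2) * divergence g (sharp g l) x

/-- The derivative `Df = ℓ^a ∇_a f`. -/
def dirD (g : BilinField n M) (l : OneForm n M) (f : M → ℝ) (x : M) : ℝ :=
  lieFun (sharp g l) f x

/-- `Δ = -2 Dθ + 4 θ² - 3 R_{ab} ℓ^a ℓ^b + 2 ℓ_b ∇_a ∇^a ℓ^b + Dκ - 2 κ θ`. -/
def Delta (g : BilinField n M) (l : OneForm n M) (κ : M → ℝ) (x : M) : ℝ :=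
  -2 * dirD g l (expansion g l) x + 4 * expansion g l x ^ 2
    - 3 * ricci g (sharp g l) (sharp g l) x
    + 2 * l x (boxField g (sharp g l) x)
    + dirD g l κ x - 2 * κ x * expansion g l x

/-- The tensor
`T_{ab} = [2 (R_{acbd} ℓ^c ℓ^d + R_{ac} ℓ^c ℓ_b + R_{bc} ℓ^c ℓ_a) - R ℓ_a ℓ_b] / Δ`. -/
def tensorT (g : BilinField n M) (l : OneForm n M) (κ : M → ℝ) : BilinField n M := fun x =>
  (Delta g l κ x)⁻¹ • bilinAt x fun X Y =>
    2 * (g x (X x) (curvature g Y (sharp g l) (sharp g l) x)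
        + ricci g X (sharp g l) x * l x (Y x)
        + ricci g Y (sharp g l) x * l x (X x))
      - scalarCurvature g x * (l x (X x) * l x (Y x))

/-- The tensor `γ = g + T`. -/
def gammaT (g : BilinField n M) (l : OneForm n M) (κ : M → ℝ) : BilinField n M :=
  fun x => g x + tensorT g l κ x

/-- The determinant of the components of a 2-covariant tensor at `x` in the coordinate frame. -/
def detAt (B : BilinField n M) (x : M) : ℝ :=
  (Matrix.of fun i j : Fin n => B x (frame x i x) (frame x j x)).det

/-! ### Kerr-Schild vector fields -/

/-- `ξ` preserves the direction of `ℓ` with gauge `m`: `L_ξ ℓ = m ℓ`, `m` smooth. -/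
structure PreservesDirection (l : OneForm n M) (ξ : VField n M) (m : M → ℝ) : Prop where
  smooth : ContMDiff (𝓡 n) 𝓘(ℝ, ℝ) ∞ m
  eq : ∀ x, lieForm ξ l x = m x • l x

/-- `ξ` solves the Kerr-Schild equations `L_ξ g = 2 h ℓ ⊗ ℓ`, `L_ξ ℓ = m ℓ`
with smooth gauges `h` and `m`. -/
structure IsKerrSchildWith (g : BilinField n M) (l : OneForm n M) (ξ : VField n M)
    (h m : M → ℝ) : Prop where
  smooth : SmoothField ξ
  smooth_h : ContMDiff (𝓡 n) 𝓘(ℝ, ℝ) ∞ h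
  lie_metric : ∀ x, lieBilin ξ g x = (2 * h x) • sq l x
  lie_form : PreservesDirection l ξ m

/-- `ξ` is a Kerr-Schild vector field with respect to `ℓ`. -/
def IsKerrSchild (g : BilinField n M) (l : OneForm n M) (ξ : VField n M) : Prop :=
  ∃ h m : M → ℝ, IsKerrSchildWith g l ξ h m

end KerrSchild

end

noncomputable section

namespace KerrSchild

set_option linter.unusedSectionVars false

/-! ### Algebra: the Levi-Civita connection of a Lie-Rinehart ring and its curvature symmetries. -/

namespace Algebraic

variable {A V ι : Type*} [CommRing A] [LieRing V] [Module A V] [LieRingModule V A]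
  [LieRinehartRing A V]

/-! Write L for the vector field metrically dual to ℓ, B = ∇L, D = ∇_L, and C = L_ξ∇ for the Lie
derivative of the connection. For a Kerr-Schild field ξ, the equation L_ξ g = 2h ℓ⊗ℓ determines C by
a Koszul-type formula (`IsKS.metric_dl`). Since L is null and geodesic and B takes values orthogonal
to L, this gives C(X, L) = (Dh + 2κh) ℓ(X) L, and the trace of C vanishes (`IsKS.dl_self`,
`IsKS.mtr_dl`).

The Lie derivative of the curvature is the antisymmetrized ∇C (`lie_Rm`). Hence the ingredients of
the numerator N of T, namely R(·, L)L, Ric(·, L)ℓ and Rℓ⊗ℓ, change, besides the rescaling by m, only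
by multiples of ℓ⊗ℓ built from D²h, Dh and h. In N the coefficients of D²h add up to -2 + 4 - 2 = 0
and those of Dh cancel too. Once Raychaudhuri's equation has eliminated tr B², the coefficient of h
is exactly -2Δ, so L_ξ N = 2mN - 2hΔ ℓ⊗ℓ (`IsKS.lie_num`). Also L_ξ Δ = 2mΔ (`IsKS.lie_del`).
Therefore T = N/Δ satisfies L_ξ T = -2h ℓ⊗ℓ = -L_ξ g, that is, L_ξ γ = 0. Conversely, L_ξ γ = 0 and
L_ξ T = f ℓ⊗ℓ force h = -f/2.

All of this is an identity in a Lie-Rinehart ring with a metric and a frame, and it is proved in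
that generality. The analytic half shows that smooth functions and vector fields on an open subset U
of a chart domain form such a ring. It then rewrites the quantities of the statement, which at each
point use the chart centred there, in one fixed frame so that they can be differentiated. -/

/-- `nab` is the Levi-Civita connection of the nondegenerate symmetric form `G`
on a Lie-Rinehart ring. -/
structure IsLeviCivita (G : V →ₗ[A] V →ₗ[A] A) (nab : V → V → V) : Prop where
  two_cancel : ∀ a b : A, 2 * a = 2 * b → a = b
  symm : ∀ X Y, G X Y = G Y X
  nondeg : ∀ X, (∀ Z, G X Z = 0) → X = 0
  koszul : ∀ X Y Z, 2 * G (nab X Y) Z = ⁅X, G Y Z⁆ + ⁅Y, G X Z⁆ - ⁅Z, G X Y⁆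
    + G ⁅X, Y⁆ Z - G ⁅X, Z⁆ Y - G ⁅Y, Z⁆ X

/-- The curvature of a connection. -/
def Rm (nab : V → V → V) (X Y Z : V) : V :=
  nab X (nab Y Z) - nab Y (nab X Z) - nab ⁅X, Y⁆ Z

theorem smul_lie' (a : A) (X Y : V) : ⁅a • X, Y⁆ = a • ⁅X, Y⁆ - ⁅Y, a⁆ • X := by
  rw [← lie_skew, LieRinehartRing.leibniz_smul_right, ← lie_skew X Y]
  module

namespace IsLeviCivita

variable {G : V →ₗ[A] V →ₗ[A] A} {nab : V → V → V} (H : IsLeviCivita G nab)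
include H

theorem ext {X Y : V} (h : ∀ Z, G X Z = G Y Z) : X = Y := by
  rw [← sub_eq_zero]
  exact H.nondeg _ fun Z => by simp [h]

theorem ext_two {X Y : V} (h : ∀ Z, 2 * G X Z = 2 * G Y Z) : X = Y :=
  H.ext fun Z => H.two_cancel _ _ (h Z)

theorem nab_add_left (X X' Y : V) : nab (X + X') Y = nab X Y + nab X' Y := by
  refine H.ext_two fun Z => ?_
  simp only [map_add, LinearMap.add_apply, mul_add, H.koszul, add_lie, lie_add]
  ring

theorem nab_add_right (X Y Y' : V) : nab X (Y + Y') = nab X Y + nab X Y' := by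
  refine H.ext_two fun Z => ?_
  simp only [map_add, LinearMap.add_apply, mul_add, H.koszul, add_lie, lie_add]
  ring

theorem nab_smul_left (a : A) (X Y : V) : nab (a • X) Y = a • nab X Y := by
  refine H.ext_two fun Z => ?_
  have h := H.koszul X Y Z
  rw [map_smul, LinearMap.smul_apply, H.koszul]
  simp only [map_smul, LinearMap.smul_apply, smul_eq_mul, smul_lie', map_sub, LinearMap.sub_apply,
    LieRinehartRing.leibniz_mul_right, LieRinehartRing.lie_smul_eq_mul]
  linear_combination -a * h

theorem nab_smul_right (a : A) (X Y : V) : nab X (a • Y) = a • nab X Y + ⁅X, a⁆ • Y := by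
  refine H.ext_two fun Z => ?_
  have h := H.koszul X Y Z
  rw [map_add, LinearMap.add_apply, map_smul, LinearMap.smul_apply, mul_add, H.koszul]
  simp only [map_smul, LinearMap.smul_apply, smul_eq_mul, smul_lie', map_sub, LinearMap.sub_apply,
    LieRinehartRing.leibniz_mul_right, LieRinehartRing.leibniz_smul_right,
    LieRinehartRing.lie_smul_eq_mul, map_add, LinearMap.add_apply]
  linear_combination -a * h - ⁅Z, a⁆ * H.symm X Y

theorem torsion (X Y : V) : ⁅X, Y⁆ = nab X Y - nab Y X := by
  refine H.ext_two fun Z => ?_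
  have h := H.koszul X Y Z
  have h' := H.koszul Y X Z
  have h1 : G ⁅Y, X⁆ Z = - G ⁅X, Y⁆ Z := by rw [← lie_skew Y X, map_neg, LinearMap.neg_apply]
  rw [map_sub, LinearMap.sub_apply]
  rw [H.symm Y X] at h'
  linear_combination h' - h + h1

theorem metric (X Y Z : V) : ⁅X, G Y Z⁆ = G (nab X Y) Z + G Y (nab X Z) := by
  refine H.two_cancel _ _ ?_
  have h := H.koszul X Y Z
  have h' := H.koszul X Z Y
  have h1 : G ⁅Z, Y⁆ X = - G ⁅Y, Z⁆ X := by rw [← lie_skew Z Y, map_neg, LinearMap.neg_apply]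
  rw [H.symm Z Y] at h'
  linear_combination - h - h' + 2 * H.symm (nab X Z) Y + h1

theorem nab_zero_left (Y : V) : nab 0 Y = 0 := by
  simpa using H.nab_smul_left 0 0 Y

theorem nab_zero_right (X : V) : nab X 0 = 0 := by
  simpa using H.nab_smul_right 0 X 0

theorem nab_neg_left (X Y : V) : nab (-X) Y = - nab X Y := by
  rw [eq_neg_iff_add_eq_zero, ← H.nab_add_left, neg_add_cancel, H.nab_zero_left]

theorem nab_neg_right (X Y : V) : nab X (-Y) = - nab X Y := by
  rw [eq_neg_iff_add_eq_zero, ← H.nab_add_right, neg_add_cancel, H.nab_zero_right]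

theorem nab_sub_left (X X' Y : V) : nab (X - X') Y = nab X Y - nab X' Y := by
  rw [sub_eq_add_neg, H.nab_add_left, H.nab_neg_left, sub_eq_add_neg]

theorem nab_sub_right (X Y Y' : V) : nab X (Y - Y') = nab X Y - nab X Y' := by
  rw [sub_eq_add_neg, H.nab_add_right, H.nab_neg_right, sub_eq_add_neg]

/-! ### Symmetries of the curvature -/

theorem Rm_add₁ (X X' Y Z : V) : Rm nab (X + X') Y Z = Rm nab X Y Z + Rm nab X' Y Z := by
  simp only [Rm, H.nab_add_left, H.nab_add_right, add_lie]
  abel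

theorem Rm_smul₁ (a : A) (X Y Z : V) : Rm nab (a • X) Y Z = a • Rm nab X Y Z := by
  simp only [Rm, H.nab_smul_left, H.nab_smul_right, smul_lie', H.nab_sub_left]
  module

theorem Rm_swap (X Y Z : V) : Rm nab X Y Z = - Rm nab Y X Z := by
  simp only [Rm]
  rw [← lie_skew X Y, H.nab_neg_left]
  abel

theorem Rm_add₂ (X Y Y' Z : V) : Rm nab X (Y + Y') Z = Rm nab X Y Z + Rm nab X Y' Z := by
  rw [H.Rm_swap, H.Rm_add₁, H.Rm_swap Y, H.Rm_swap Y']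
  abel

theorem Rm_smul₂ (a : A) (X Y Z : V) : Rm nab X (a • Y) Z = a • Rm nab X Y Z := by
  rw [H.Rm_swap, H.Rm_smul₁, H.Rm_swap Y]
  module

theorem Rm_add₃ (X Y Z Z' : V) : Rm nab X Y (Z + Z') = Rm nab X Y Z + Rm nab X Y Z' := by
  simp only [Rm, H.nab_add_right]
  abel

/-- The second derivatives of `a` cancel because brackets act on functions as commutators
(`lie_lie`). -/
theorem Rm_smul₃ (a : A) (X Y Z : V) : Rm nab X Y (a • Z) = a • Rm nab X Y Z := by
  simp only [Rm, H.nab_smul_right, H.nab_add_right, lie_lie, sub_smul]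
  module

theorem Rm_skew (X Y Z W : V) : G (Rm nab X Y Z) W = - G Z (Rm nab X Y W) := by
  have h := lie_lie X Y (G Z W)
  simp only [H.metric, lie_add] at h
  simp only [Rm, map_sub, LinearMap.sub_apply]
  linear_combination -h

/-- The Jacobi identity, with every bracket rewritten through vanishing torsion. -/
theorem bianchi (X Y Z : V) : Rm nab X Y Z + Rm nab Y Z X + Rm nab Z X Y = 0 := by
  have h := lie_jacobi X Y Z
  have e1 := H.torsion X ⁅Y, Z⁆
  have e2 := H.torsion Y ⁅Z, X⁆
  have e3 := H.torsion Z ⁅X, Y⁆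
  rw [H.torsion Y Z, H.nab_sub_right] at e1
  rw [H.torsion Z X, H.nab_sub_right] at e2
  rw [H.torsion X Y, H.nab_sub_right] at e3
  rw [H.torsion Y Z, e1, H.torsion Z X, e2, H.torsion X Y, e3] at h
  simp only [Rm]
  rw [H.torsion X Y, H.torsion Y Z, H.torsion Z X]
  rw [← h]
  abel

/-- The octahedron argument: a signed sum of four Bianchi identities, simplified by the two
antisymmetries, gives twice the claim. -/
theorem Rm_pair (X Y Z W : V) : G (Rm nab X Y Z) W = G (Rm nab Z W X) Y := by
  refine H.two_cancel _ _ ?_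
  have b (X Y Z W : V) :
      G (Rm nab X Y Z) W + G (Rm nab Y Z X) W + G (Rm nab Z X Y) W = 0 := by
    have := congrArg (fun U => G U W) (H.bianchi X Y Z)
    simpa using this
  have s (X Y Z W : V) : G (Rm nab X Y Z) W = - G (Rm nab X Y W) Z := by
    rw [H.Rm_skew, H.symm]
  have k (X Y Z W : V) : G (Rm nab X Y Z) W = - G (Rm nab Y X Z) W := by
    rw [H.Rm_swap]; simp
  linear_combination b Z X Y W - b X Y W Z - b Y W Z X + b W Z X Y + s X Y Z W - 2 * k Z W X Y
    + s W Z X Y - s Z X Y W + s Y W X Z - k Y Z X W + s Z Y X W + k W X Y Z - s X W Y Z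

/-- Follows from pair symmetry; this is what makes the curvature term of T, and hence T, symmetric.
-/
theorem Rm_lie_symm (L X Y : V) : G X (Rm nab Y L L) = G Y (Rm nab X L L) := by
  rw [H.symm X, H.Rm_pair, H.Rm_swap L X, H.symm Y, map_neg, LinearMap.neg_apply, H.Rm_skew,
    H.symm, neg_neg]

end IsLeviCivita

end Algebraic

/-! ### Metric traces over a frame and their derivatives. -/

namespace Algebraic

variable {A V ι : Type*} [CommRing A] [LieRing V] [Module A V] [LieRingModule V A]
  [LieRinehartRing A V]

/-! ### Metric traces -/

/-- `β` is a bilinear form. -/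
structure Bilin (β : V → V → A) : Prop where
  add_left : ∀ X X' Y, β (X + X') Y = β X Y + β X' Y
  smul_left : ∀ (a : A) X Y, β (a • X) Y = a * β X Y
  add_right : ∀ X Y Y', β X (Y + Y') = β X Y + β X Y'
  smul_right : ∀ (a : A) X Y, β X (a • Y) = a * β X Y

namespace Bilin

variable {β : V → V → A} (hβ : Bilin β)
include hβ

theorem sum_left {ι : Type*} (s : Finset ι) (a : ι → A) (X : ι → V) (Y : V) :
    β (∑ i ∈ s, a i • X i) Y = ∑ i ∈ s, a i * β (X i) Y := by
  classical
  induction s using Finset.induction_on with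
  | empty => simpa using hβ.smul_left 0 0 Y
  | insert i s hi ih => simp [Finset.sum_insert hi, hβ.add_left, hβ.smul_left, ih]

theorem flip : Bilin fun X Y => β Y X :=
  ⟨fun _ _ _ => hβ.add_right _ _ _, fun _ _ _ => hβ.smul_right _ _ _,
    fun _ _ _ => hβ.add_left _ _ _, fun _ _ _ => hβ.smul_left _ _ _⟩

theorem sum_right {ι : Type*} (s : Finset ι) (a : ι → A) (X : ι → V) (Y : V) :
    β Y (∑ i ∈ s, a i • X i) = ∑ i ∈ s, a i * β Y (X i) :=
  hβ.flip.sum_left s a X Y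

end Bilin

variable [Fintype ι] [DecidableEq ι]

/-- `e` is a frame and `f` is the reciprocal frame with respect to the metric `G`. -/
structure IsFrame (G : V →ₗ[A] V →ₗ[A] A) (e f : ι → V) : Prop where
  dual : ∀ j k, G (f j) (e k) = if j = k then 1 else 0
  expand : ∀ X, ∑ k, G (f k) X • e k = X

/-- The metric trace of a bilinear form. -/
def mtr (e f : ι → V) (β : V → V → A) : A := ∑ k, β (f k) (e k)

theorem mtr_add (e f : ι → V) (β β' : V → V → A) :
    mtr e f (fun X Y => β X Y + β' X Y) = mtr e f β + mtr e f β' := Finset.sum_add_distrib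

theorem mtr_sub (e f : ι → V) (β β' : V → V → A) :
    mtr e f (fun X Y => β X Y - β' X Y) = mtr e f β - mtr e f β' :=
  Finset.sum_sub_distrib (fun k => β (f k) (e k)) fun k => β' (f k) (e k)

theorem mtr_neg (e f : ι → V) (β : V → V → A) :
    mtr e f (fun X Y => - β X Y) = - mtr e f β :=
  Finset.sum_neg_distrib fun k => β (f k) (e k)

theorem mtr_mul (e f : ι → V) (a : A) (β : V → V → A) :
    mtr e f (fun X Y => a * β X Y) = a * mtr e f β :=
  (Finset.mul_sum ..).symm

theorem mtr_congr {e f : ι → V} {β β' : V → V → A} (h : ∀ X Y, β X Y = β' X Y) :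
    mtr e f β = mtr e f β' := Finset.sum_congr rfl fun _ _ => h _ _

namespace IsFrame

variable {G : V →ₗ[A] V →ₗ[A] A} {nab : V → V → V} {e f : ι → V}
  (F : IsFrame G e f) (H : IsLeviCivita G nab)
include F H

theorem expand' (X : V) : ∑ k, G (e k) X • f k = X := by
  refine H.ext fun Z => ?_
  conv_rhs => rw [← F.expand Z]
  simp only [map_sum, LinearMap.sum_apply, map_smul, LinearMap.smul_apply, smul_eq_mul]
  refine Finset.sum_congr rfl fun k _ => ?_
  rw [H.symm X, mul_comm]

omit H in
theorem apply_eq_sum {φ : V → A} (h1 : ∀ X Y, φ (X + Y) = φ X + φ Y)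
    (h2 : ∀ (a : A) X, φ (a • X) = a * φ X) (X : V) : ∑ k, G (f k) X * φ (e k) = φ X := by
  let φ' : V →ₗ[A] A := { toFun := φ, map_add' := h1, map_smul' := h2 }
  have : φ' (∑ k, G (f k) X • e k) = φ' X := by rw [F.expand]
  rw [map_sum] at this
  simpa only [map_smul, smul_eq_mul] using! this

theorem apply_eq_sum' {φ : V → A} (h1 : ∀ X Y, φ (X + Y) = φ X + φ Y)
    (h2 : ∀ (a : A) X, φ (a • X) = a * φ X) (X : V) : ∑ k, G (e k) X * φ (f k) = φ X := by
  let φ' : V →ₗ[A] A := { toFun := φ, map_add' := h1, map_smul' := h2 }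
  have : φ' (∑ k, G (e k) X • f k) = φ' X := by rw [F.expand' H]
  rw [map_sum] at this
  simpa only [map_smul, smul_eq_mul] using! this

/-- A factor `G W` in a trace merely evaluates the other factor at W. Almost every trace below
splits into such terms with W = L, which is why so few genuine sums survive. -/
theorem mtr_left_mul {φ : V → A} (h1 : ∀ X Y, φ (X + Y) = φ X + φ Y)
    (h2 : ∀ (a : A) X, φ (a • X) = a * φ X) (W : V) :
    mtr e f (fun X Y => G W X * φ Y) = φ W := by
  rw [← F.apply_eq_sum h1 h2 W]
  exact Finset.sum_congr rfl fun k _ => by simp only [H.symm W]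

theorem mtr_right_mul {φ : V → A} (h1 : ∀ X Y, φ (X + Y) = φ X + φ Y)
    (h2 : ∀ (a : A) X, φ (a • X) = a * φ X) (W : V) :
    mtr e f (fun X Y => φ X * G W Y) = φ W := by
  rw [← F.apply_eq_sum' H h1 h2 W]
  exact Finset.sum_congr rfl fun k _ => by simp only [H.symm W, mul_comm]

/-- Frame independence of the trace, by expanding one frame in the other. It later allows a change
of chart. -/
theorem mtr_eq_mtr {κ : Type*} [Fintype κ] [DecidableEq κ] {e' f' : κ → V} (F' : IsFrame G e' f')
    {β : V → V → A} (hβ : Bilin β) : mtr e f β = mtr e' f' β := by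
  calc mtr e f β = ∑ k, ∑ j, G (e' j) (f k) * β (f' j) (e k) := by
        refine Finset.sum_congr rfl fun k _ => ?_
        conv_lhs => rw [← F'.expand' H (f k), hβ.sum_left]
    _ = ∑ j, ∑ k, G (f k) (e' j) * β (f' j) (e k) := by
        rw [Finset.sum_comm]
        simp only [H.symm (e' _)]
    _ = mtr e' f' β := by
        refine Finset.sum_congr rfl fun j _ => ?_
        conv_rhs => rw [← F.expand (e' j), hβ.sum_right]

/-- Exchanging the frame with its reciprocal gives another reciprocal pair, so frame independence
applies. -/
theorem mtr_flip {β : V → V → A} (hβ : Bilin β) : mtr e f (fun X Y => β Y X) = mtr e f β := by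
  have F' : IsFrame G f e := ⟨fun j k => by rw [H.symm, F.dual]; simp [eq_comm], F.expand' H⟩
  exact F'.mtr_eq_mtr H F hβ

/-- The derivative of a metric trace along an operation whose defect of compatibility with the
metric is `h`. -/
theorem lie_mtr {β : V → V → A} (hβ : Bilin β) (X : V) (d : V → V) {h : V → V → A}
    (hd : ∀ Y Z, ⁅X, G Y Z⁆ = G (d Y) Z + G Y (d Z) + h Y Z) :
    ⁅X, mtr e f β⁆ = mtr e f (fun Y Z => ⁅X, β Y Z⁆ - β (d Y) Z - β Y (d Z))
      - ∑ k, ∑ j, h (f j) (e k) * β (f k) (e j) := by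
  -- The sums in which `d` hits the frame are re-expanded in the frame. They balance the defect
  -- because G(f j, e k) is 0 or 1, so its derivative vanishes.
  have key : mtr e f (fun Y Z => β (d Y) Z) + mtr e f (fun Y Z => β Y (d Z))
      + ∑ k, ∑ j, h (f j) (e k) * β (f k) (e j) = 0 := by
    have e1 : mtr e f (fun Y Z => β (d Y) Z)
        = ∑ k, ∑ j, G (e k) (d (f j)) * β (f k) (e j) := by
      rw [Finset.sum_comm]
      refine Finset.sum_congr rfl fun k _ => ?_
      dsimp only
      conv_lhs => rw [← F.expand' H (d (f k)), hβ.sum_left]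
    have e2 : mtr e f (fun Y Z => β Y (d Z))
        = ∑ k, ∑ j, G (f j) (d (e k)) * β (f k) (e j) := by
      refine Finset.sum_congr rfl fun k _ => ?_
      dsimp only
      conv_lhs => rw [← F.expand (d (e k)), hβ.sum_right]
    rw [e1, e2, ← Finset.sum_add_distrib, ← Finset.sum_add_distrib]
    refine Finset.sum_eq_zero fun k _ => ?_
    rw [← Finset.sum_add_distrib, ← Finset.sum_add_distrib]
    refine Finset.sum_eq_zero fun j _ => ?_
    have h0 : ⁅X, G (f j) (e k)⁆ = 0 := by
      have h1 : ⁅X, (1 : A)⁆ = 0 := by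
        simpa using LieRinehartRing.leibniz_mul_right X (1 : A) 1
      rw [F.dual]
      split_ifs <;> simp [h1]
    have := hd (f j) (e k)
    rw [h0, H.symm (d (f j))] at this
    linear_combination -β (f k) (e j) * this
  rw [mtr_sub, mtr_sub]
  have : ⁅X, mtr e f β⁆ = mtr e f (fun Y Z => ⁅X, β Y Z⁆) := by
    simp only [mtr, lie_sum]
  rw [this]
  linear_combination key

theorem lie_mtr_nab {β : V → V → A} (hβ : Bilin β) (X : V) :
    ⁅X, mtr e f β⁆ = mtr e f (fun Y Z => ⁅X, β Y Z⁆ - β (nab X Y) Z - β Y (nab X Z)) := by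
  rw [F.lie_mtr H hβ X (nab X) (h := fun _ _ => 0) (by simp [H.metric])]
  simp

end IsFrame

end Algebraic

/-! ### Curvature scalars, Raychaudhuri's equation, and the Lie derivative of the connection. -/

namespace Algebraic

variable {A V ι : Type*} [CommRing A] [LieRing V] [Module A V] [LieRingModule V A]
  [LieRinehartRing A V] [Fintype ι] [DecidableEq ι]

/-- The Ricci form `Ric(Y, Z) = tr (X ↦ R(X, Z)Y)`. -/
def ric (G : V →ₗ[A] V →ₗ[A] A) (nab : V → V → V) (e f : ι → V) (Y Z : V) : A :=
  mtr e f fun U X => G U (Rm nab X Z Y)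

/-- The scalar curvature. -/
def scal (G : V →ₗ[A] V →ₗ[A] A) (nab : V → V → V) (e f : ι → V) : A :=
  mtr e f (ric G nab e f)

/-- The divergence of a vector field. -/
def dvg (G : V →ₗ[A] V →ₗ[A] A) (nab : V → V → V) (e f : ι → V) (L : V) : A :=
  mtr e f fun Y Z => G Y (nab Z L)

/-- The trace `tr(Bᵀ B)` of `B = ∇L`. -/
def gradSq (G : V →ₗ[A] V →ₗ[A] A) (nab : V → V → V) (e f : ι → V) (L : V) : A :=
  mtr e f fun Y Z => G (nab Y L) (nab Z L)

/-- The scalar `Δ` of a null geodesic field `L`. -/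
def del (G : V →ₗ[A] V →ₗ[A] A) (nab : V → V → V) (e f : ι → V) (L : V) (κ : A) : A :=
  -⁅L, dvg G nab e f L⁆ + dvg G nab e f L ^ 2 - 3 * ric G nab e f L L
    - 2 * gradSq G nab e f L + ⁅L, κ⁆ - κ * dvg G nab e f L

/-- The numerator of the tensor `T`. -/
def num (G : V →ₗ[A] V →ₗ[A] A) (nab : V → V → V) (e f : ι → V) (L X Y : V) : A :=
  2 * (G X (Rm nab Y L L) + ric G nab e f X L * G L Y + ric G nab e f Y L * G L X)
    - scal G nab e f * (G L X * G L Y)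

/-- `L` is a null geodesic field. -/
structure IsNullGeodesic (G : V →ₗ[A] V →ₗ[A] A) (nab : V → V → V) (L : V) (κ : A) : Prop where
  null : G L L = 0
  geodesic : nab L L = κ • L
  faithful : ∀ a : A, a • L = 0 → a = 0

/-- `ξ` is a Kerr-Schild field with respect to `L`, with gauges `h` and `m`. -/
structure IsKS (G : V →ₗ[A] V →ₗ[A] A) (L ξ : V) (h m : A) : Prop where
  lie_metric : ∀ X Y, ⁅ξ, G X Y⁆ = G ⁅ξ, X⁆ Y + G X ⁅ξ, Y⁆ + 2 * h * (G L X * G L Y)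
  lie_form : ∀ X, ⁅ξ, G L X⁆ = G L ⁅ξ, X⁆ + m * G L X

/-- The Lie derivative of a connection. -/
def dl (nab : V → V → V) (ξ X Y : V) : V := ⁅ξ, nab X Y⁆ - nab ⁅ξ, X⁆ Y - nab X ⁅ξ, Y⁆

/-- The covariant derivative of the Lie derivative of a connection. -/
def nd (nab : V → V → V) (ξ X Y Z : V) : V :=
  nab X (dl nab ξ Y Z) - dl nab ξ (nab X Y) Z - dl nab ξ Y (nab X Z)

variable {G : V →ₗ[A] V →ₗ[A] A} {nab : V → V → V} {e f : ι → V}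

namespace IsLeviCivita

variable (H : IsLeviCivita G nab)
include H

theorem bilin_ric (Y Z : V) : Bilin fun U X => G U (Rm nab X Z Y) :=
  ⟨by simp, by simp, by simp [H.Rm_add₁], by simp [H.Rm_smul₁]⟩

theorem ric_bilin : Bilin (ric G nab e f) := by
  refine ⟨fun _ _ _ => ?_, fun _ _ _ => ?_, fun _ _ _ => ?_, fun _ _ _ => ?_⟩ <;> unfold ric
  · simp only [H.Rm_add₃, map_add, mtr_add]
  · simp only [H.Rm_smul₃, map_smul, smul_eq_mul, mtr_mul]
  · simp only [H.Rm_add₂, map_add, mtr_add]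
  · simp only [H.Rm_smul₂, map_smul, smul_eq_mul, mtr_mul]

theorem bilin_dvg (L : V) : Bilin fun Y Z => G Y (nab Z L) :=
  ⟨by simp, by simp, by simp [H.nab_add_left], by simp [H.nab_smul_left]⟩

theorem bilin_gradSq (L : V) : Bilin fun Y Z => G (nab Y L) (nab Z L) :=
  ⟨by simp [H.nab_add_left], by simp [H.nab_smul_left], by simp [H.nab_add_left],
    by simp [H.nab_smul_left]⟩

/-! ### The Lie derivative of the connection -/

/-- Vanishing torsion together with the Jacobi identity. -/
theorem dl_symm (ξ X Y : V) : dl nab ξ X Y = dl nab ξ Y X := by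
  have h := leibniz_lie ξ X Y
  rw [H.torsion X Y, lie_sub, H.torsion ⁅ξ, X⁆ Y, H.torsion X ⁅ξ, Y⁆] at h
  simp only [dl]
  rw [← sub_eq_zero] at h ⊢
  rw [← h]
  abel

theorem dl_add_left (ξ X X' Y : V) : dl nab ξ (X + X') Y = dl nab ξ X Y + dl nab ξ X' Y := by
  simp only [dl, H.nab_add_left, lie_add]
  abel

theorem dl_smul_left (ξ : V) (a : A) (X Y : V) : dl nab ξ (a • X) Y = a • dl nab ξ X Y := by
  simp only [dl, H.nab_smul_left, H.nab_add_left, LieRinehartRing.leibniz_smul_right]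
  module

theorem dl_add_right (ξ X Y Y' : V) : dl nab ξ X (Y + Y') = dl nab ξ X Y + dl nab ξ X Y' := by
  rw [H.dl_symm, H.dl_add_left, H.dl_symm ξ X, H.dl_symm ξ X]

theorem dl_smul_right (ξ : V) (a : A) (X Y : V) : dl nab ξ X (a • Y) = a • dl nab ξ X Y := by
  rw [H.dl_symm, H.dl_smul_left, H.dl_symm ξ X]

theorem dl_neg_left (ξ X Y : V) : dl nab ξ (-X) Y = - dl nab ξ X Y := by
  simpa using H.dl_smul_left ξ (-1) X Y

theorem dl_sub_left (ξ X X' Y : V) : dl nab ξ (X - X') Y = dl nab ξ X Y - dl nab ξ X' Y := by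
  rw [sub_eq_add_neg, H.dl_add_left, H.dl_neg_left, sub_eq_add_neg]

theorem nd_symm (ξ X Y Z : V) : nd nab ξ X Y Z = nd nab ξ X Z Y := by
  simp only [nd, H.dl_symm ξ Z Y, H.dl_symm ξ (nab X Z), H.dl_symm ξ Z]
  abel

/-- Leibniz on each term of `Rm`: the contribution of `dl` at ⁅X, Y⁆ is split by torsion-freeness,
and the remaining terms assemble into covariant derivatives of `dl`. Every variation of curvature is
thereby reduced to `dl`. -/
theorem lie_Rm (ξ X Y Z : V) : ⁅ξ, Rm nab X Y Z⁆ = Rm nab ⁅ξ, X⁆ Y Z + Rm nab X ⁅ξ, Y⁆ Z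
    + Rm nab X Y ⁅ξ, Z⁆ + nd nab ξ X Y Z - nd nab ξ Y X Z := by
  have hb (X Y : V) : ⁅ξ, nab X Y⁆ = dl nab ξ X Y + nab ⁅ξ, X⁆ Y + nab X ⁅ξ, Y⁆ := by
    simp only [dl]; abel
  have h1 : dl nab ξ ⁅X, Y⁆ Z = dl nab ξ (nab X Y) Z - dl nab ξ (nab Y X) Z := by
    rw [H.torsion, H.dl_sub_left]
  simp only [Rm, nd, lie_sub, hb, H.nab_add_right, leibniz_lie ξ X Y, H.nab_add_left, h1]
  abel

end IsLeviCivita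

namespace IsNullGeodesic

variable {L : V} {κ : A} (N : IsNullGeodesic G nab L κ) (H : IsLeviCivita G nab)
include N H

theorem metric_nab_self (X : V) : G (nab X L) L = 0 := by
  refine H.two_cancel _ _ ?_
  have h := H.metric X L L
  rw [N.null, lie_zero, H.symm L] at h
  linear_combination -h

theorem metric_self_nab (X : V) : G L (nab X L) = 0 := by
  rw [H.symm, N.metric_nab_self H]

theorem lie_metric_self (Y : V) : ⁅L, G L Y⁆ = κ * G L Y + G L (nab L Y) := by
  rw [H.metric, N.geodesic, map_smul, LinearMap.smul_apply, smul_eq_mul]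

theorem metric_Rm_self (Y : V) : G L (Rm nab Y L L) = 0 := by
  rw [H.symm]
  refine H.two_cancel _ _ ?_
  have := H.Rm_skew Y L L L
  rw [H.symm L] at this
  linear_combination this

/-- Raychaudhuri's equation. -/
theorem raychaudhuri (F : IsFrame G e f) : ⁅L, dvg G nab e f L⁆ = - ric G nab e f L L + ⁅L, κ⁆
    + κ * dvg G nab e f L - mtr e f (fun Y Z => G Y (nab (nab Z L) L)) := by
  -- The curvature contains ∇_Z ∇_L L = ∇_Z (κL), the source of both κ-terms; the bracket ⁅Z, L⁆ is
  -- replaced by ∇_Z L - ∇_L Z.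
  have key (Y Z : V) : ⁅L, G Y (nab Z L)⁆ - G (nab L Y) (nab Z L) - G Y (nab (nab L Z) L)
      = -G Y (Rm nab Z L L) + G L Y * ⁅Z, κ⁆ + κ * G Y (nab Z L) - G Y (nab (nab Z L) L) := by
    rw [H.metric, Rm, N.geodesic, H.nab_smul_right, H.torsion, H.nab_sub_left]
    simp only [map_sub, map_add, map_smul, smul_eq_mul, H.symm L Y]
    ring
  rw [dvg, F.lie_mtr_nab H (H.bilin_dvg L), mtr_congr key, mtr_sub, mtr_add, mtr_add, mtr_neg,
    mtr_mul, F.mtr_left_mul H (fun X Y => add_lie X Y κ) (fun a X =>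
      LieRinehartRing.lie_smul_eq_mul a κ X), ric]

end IsNullGeodesic

namespace IsKS

variable {L ξ : V} {κ h m : A} (K : IsKS G L ξ h m) (H : IsLeviCivita G nab)
  (N : IsNullGeodesic G nab L κ) (F : IsFrame G e f)
include K H

/-- The bracket with ξ is applied to metric compatibility ∇G = 0; the right-hand side is the
covariant derivative of 2h ℓ⊗ℓ. -/
theorem metric_dl_add (X Y Z : V) : G (dl nab ξ X Y) Z + G Y (dl nab ξ X Z)
    = 2 * (⁅X, h⁆ * (G L Y * G L Z)
      + h * (G (nab X L) Y * G L Z + G L Y * G (nab X L) Z)) := by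
  have h1 := leibniz_lie ξ X (G Y Z)
  have h2 : ⁅X, (2 : A)⁆ = 0 := by
    have h0 : ⁅X, (1 : A)⁆ = 0 := by
      simpa using LieRinehartRing.leibniz_mul_right X (1 : A) 1
    rw [← one_add_one_eq_two, lie_add, h0, add_zero]
  have h3 := H.metric ⁅ξ, X⁆ Y Z
  have h4 := H.metric X ⁅ξ, Y⁆ Z
  have h5 := H.metric X Y ⁅ξ, Z⁆
  have h6 := H.metric X L Y
  have h7 := H.metric X L Z
  rw [H.metric X Y Z, K.lie_metric Y Z, lie_add, lie_add, lie_add, K.lie_metric, K.lie_metric,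
    LieRinehartRing.leibniz_mul_right, LieRinehartRing.leibniz_mul_right,
    LieRinehartRing.leibniz_mul_right, h2] at h1
  simp only [smul_eq_mul] at h1
  simp only [dl, map_sub, LinearMap.sub_apply]
  linear_combination h1 + h3 + h4 + h5 + 2 * h * (G L Z * h6 + G L Y * h7)

/-- `dl` is symmetric, so the cyclic permutation that yields Koszul's formula solves `metric_dl_add`
for it. -/
theorem metric_dl (X Y Z : V) : G (dl nab ξ X Y) Z
    = ⁅X, h⁆ * (G L Y * G L Z) + ⁅Y, h⁆ * (G L X * G L Z) - ⁅Z, h⁆ * (G L X * G L Y)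
      + h * ((G (nab X L) Y + G (nab Y L) X) * G L Z + (G (nab X L) Z - G (nab Z L) X) * G L Y
        + (G (nab Y L) Z - G (nab Z L) Y) * G L X) := by
  refine H.two_cancel _ _ ?_
  have h1 := K.metric_dl_add H X Y Z
  have h2 := K.metric_dl_add H Y Z X
  have h3 := K.metric_dl_add H Z X Y
  rw [H.symm Y, H.dl_symm ξ X Z] at h1
  rw [H.symm Z, H.dl_symm ξ Y X, H.dl_symm ξ Y Z] at h2
  rw [H.symm X] at h3
  linear_combination h1 + h2 - h3

include N

/-- Raising the index in L_ξ ℓ = mℓ costs a term 2h ℓ(L)ℓ, which is zero because L is null. -/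
theorem lie_field : ⁅ξ, L⁆ = m • L := by
  refine H.ext fun Z => ?_
  have h1 := K.lie_metric L Z
  rw [K.lie_form, N.null] at h1
  rw [map_smul, LinearMap.smul_apply, smul_eq_mul]
  linear_combination -h1

/-- With L in one slot, nullity and the orthogonality of ∇L to L leave only terms along L. The
coefficient Dh + 2κh recurs below as `w`. -/
theorem dl_self (X : V) : dl nab ξ X L = ((⁅L, h⁆ + 2 * κ * h) * G L X) • L := by
  refine H.ext fun Z => ?_
  rw [K.metric_dl H, N.null, N.metric_nab_self H X, N.metric_nab_self H Z, N.geodesic]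
  simp only [map_smul, LinearMap.smul_apply, smul_eq_mul]
  ring

theorem dl_self_self : dl nab ξ L L = 0 := by
  rw [K.dl_self H N, N.null, mul_zero, zero_smul]

/-- The bracket with ξ is applied to ∇_L L = κL, where `dl` contributes nothing; `faithful` then
cancels L. -/
theorem lie_geodesic : ⁅ξ, κ⁆ = m * κ + ⁅L, m⁆ := by
  have h1 : ⁅ξ, nab L L⁆ = dl nab ξ L L + nab ⁅ξ, L⁆ L + nab L ⁅ξ, L⁆ := by
    simp only [dl]; abel
  rw [K.dl_self_self H N, K.lie_field H N, H.nab_smul_left, H.nab_smul_right, N.geodesic,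
    LieRinehartRing.leibniz_smul_right, K.lie_field H N] at h1
  rw [← sub_eq_zero]
  refine N.faithful _ ?_
  rw [← sub_eq_zero] at h1
  rw [← h1]
  module

/-- The Lie derivative of the endomorphism `∇L`. -/
theorem lie_nab (X : V) : ⁅ξ, nab X L⁆ = nab ⁅ξ, X⁆ L + m • nab X L
    + (⁅X, m⁆ + (⁅L, h⁆ + 2 * κ * h) * G L X) • L := by
  have h1 : ⁅ξ, nab X L⁆ = dl nab ξ X L + nab ⁅ξ, X⁆ L + nab X ⁅ξ, L⁆ := by
    simp only [dl]; abel
  rw [h1, K.dl_self H N, K.lie_field H N, H.nab_smul_right]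
  module

include F

/-- The bracket with ξ fails to preserve the metric by 2h ℓ⊗ℓ, so the correction term contracts β
with L twice. -/
theorem lie_mtr {β : V → V → A} (hβ : Bilin β) :
    ⁅ξ, mtr e f β⁆ = mtr e f (fun Y Z => ⁅ξ, β Y Z⁆ - β ⁅ξ, Y⁆ Z - β Y ⁅ξ, Z⁆)
      - 2 * h * β L L := by
  rw [F.lie_mtr H hβ ξ (fun X => ⁅ξ, X⁆) (h := fun Y Z => 2 * h * (G L Y * G L Z)) K.lie_metric]
  congr 1
  have h1 (k : ι) : ∑ j, 2 * h * (G L (f j) * G L (e k)) * β (f k) (e j)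
      = 2 * h * (G L (e k) * β (f k) L) := by
    rw [← F.apply_eq_sum (hβ.add_right (f k)) (fun a X => hβ.smul_right a (f k) X) L,
      Finset.mul_sum, Finset.mul_sum]
    exact Finset.sum_congr rfl fun j _ => by rw [H.symm L (f j)]; ring
  simp only [h1]
  rw [← Finset.mul_sum, ← F.apply_eq_sum' H (φ := fun X => β X L) (fun X Y => hβ.add_left X Y L)
    (fun a X => hβ.smul_left a X L) L]
  simp only [H.symm L]

theorem lie_dvg : ⁅ξ, dvg G nab e f L⁆ = m * dvg G nab e f L + ⁅L, m⁆ := by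
  have key (Y Z : V) : ⁅ξ, G Y (nab Z L)⁆ - G ⁅ξ, Y⁆ (nab Z L) - G Y (nab ⁅ξ, Z⁆ L)
      = m * G Y (nab Z L) + G L Y * ⁅Z, m⁆ + (⁅L, h⁆ + 2 * κ * h) * (G L Y * G L Z) := by
    rw [K.lie_metric, K.lie_nab H N, N.metric_self_nab H]
    simp only [map_add, map_smul, smul_eq_mul, H.symm Y L]
    ring
  rw [dvg, K.lie_mtr H N F (H.bilin_dvg L), mtr_congr key, mtr_add, mtr_add, mtr_mul, mtr_mul,
    F.mtr_left_mul H (fun X Y => add_lie X Y m) (fun a X =>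
      LieRinehartRing.lie_smul_eq_mul a m X), F.mtr_left_mul H (fun X Y => map_add (G L) X Y)
      (fun a X => map_smul (G L) a X), N.null, N.metric_self_nab H]
  ring

/-- The inhomogeneous terms of L_ξ(∇L) point along L and are orthogonal to ∇L; the trace correction
is a multiple of G(∇_L L, ∇_L L) = κ²G(L, L) = 0. -/
theorem lie_gradSq : ⁅ξ, gradSq G nab e f L⁆ = 2 * m * gradSq G nab e f L := by
  have key (Y Z : V) : ⁅ξ, G (nab Y L) (nab Z L)⁆ - G (nab ⁅ξ, Y⁆ L) (nab Z L)
      - G (nab Y L) (nab ⁅ξ, Z⁆ L) = 2 * m * G (nab Y L) (nab Z L) := by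
    rw [K.lie_metric, K.lie_nab H N, K.lie_nab H N, N.metric_self_nab H]
    simp only [map_add, map_smul, smul_eq_mul, LinearMap.add_apply, LinearMap.smul_apply,
      N.metric_self_nab H, N.metric_nab_self H]
    ring
  rw [gradSq, K.lie_mtr H N F (H.bilin_gradSq L), mtr_congr key, mtr_mul, N.geodesic]
  simp only [map_smul, LinearMap.smul_apply, N.null]
  simp

/-- The trace of the Lie derivative of the connection vanishes. -/
theorem mtr_dl (Y : V) : mtr e f (fun U X => G U (dl nab ξ X Y)) = 0 := by
  -- The vanishing reflects that ξ preserves volume, since tr(L_ξ g) = 2h ℓ(L) = 0. Each summand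
  -- either traces to 0 or cancels against another.
  have key (U X : V) : G U (dl nab ξ X Y) = G L Y * (G L U * ⁅X, h⁆)
      + ⁅Y, h⁆ * (G L U * G L X) - G L Y * (⁅U, h⁆ * G L X)
      + h * (G L U * G (nab X L) Y + G L U * G (nab Y L) X
        + G L Y * (G U (nab X L) - G X (nab U L)) + (G (nab Y L) U - G (nab U L) Y) * G L X) := by
    rw [H.symm, K.metric_dl H, H.symm U, H.symm X]
    ring
  have a1 (X Y : V) : ⁅X + Y, h⁆ = ⁅X, h⁆ + ⁅Y, h⁆ := add_lie X Y h
  have a2 (a : A) (X : V) : ⁅a • X, h⁆ = a * ⁅X, h⁆ := LieRinehartRing.lie_smul_eq_mul a h X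
  rw [mtr_congr key, mtr_add, mtr_sub, mtr_add, mtr_mul, mtr_mul, mtr_mul, mtr_mul, mtr_add,
    mtr_add, mtr_add, mtr_mul, mtr_sub, F.mtr_left_mul H a1 a2, F.mtr_right_mul H (φ := fun X => ⁅X, h⁆) a1 a2,
    F.mtr_left_mul H (fun X Y => map_add (G L) X Y) (fun a X => map_smul (G L) a X),
    F.mtr_left_mul H (fun X X' => by simp [H.nab_add_left]) (fun a X => by
      simp [H.nab_smul_left]), F.mtr_left_mul H (fun X X' => map_add (G (nab Y L)) X X')
      (fun a X => map_smul (G (nab Y L)) a X),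
    F.mtr_right_mul H (φ := fun U => G (nab Y L) U - G (nab U L) Y)
      (fun X X' => by simp only [H.nab_add_left, map_add, LinearMap.add_apply]; ring)
      (fun a X => by
        simp only [H.nab_smul_left, map_smul, LinearMap.smul_apply, smul_eq_mul]; ring),
    F.mtr_flip H (H.bilin_dvg L), N.null, N.metric_nab_self H]
  ring

end IsKS

end Algebraic

/-! ### Lie derivatives of Ricci, scalar curvature, Δ and the numerator of T along a Kerr-Schild
field. -/

namespace Algebraic

variable {A V ι : Type*} [CommRing A] [LieRing V] [Module A V] [LieRingModule V A]
  [LieRinehartRing A V] [Fintype ι] [DecidableEq ι]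

variable {G : V →ₗ[A] V →ₗ[A] A} {nab : V → V → V} {e f : ι → V}

namespace IsKS

variable {L ξ : V} {κ h m : A} (K : IsKS G L ξ h m) (H : IsLeviCivita G nab)
  (N : IsNullGeodesic G nab L κ) (F : IsFrame G e f)
include K H N F

/-- This is the traced `lie_Rm`. The 2h-correction of the trace cancels the one from the metric in
the integrand, and one half of the antisymmetrization drops out. -/
theorem lie_ric (Y Z : V) : ⁅ξ, ric G nab e f Y Z⁆ = ric G nab e f ⁅ξ, Y⁆ Z
    + ric G nab e f Y ⁅ξ, Z⁆ + mtr e f (fun U X => G U (nd nab ξ X Z Y)) := by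
  -- This contraction is the covariant derivative along Z of the trace of `dl`, which vanishes
  -- identically.
  have hnd : mtr e f (fun U X => G U (nd nab ξ Z X Y)) = 0 := by
    have hβ : Bilin fun U X => G U (dl nab ξ X Y) :=
      ⟨by simp, by simp, by simp [H.dl_add_left], by simp [H.dl_smul_left]⟩
    have h1 := F.lie_mtr_nab H hβ Z
    have key (U X : V) : ⁅Z, G U (dl nab ξ X Y)⁆ - G (nab Z U) (dl nab ξ X Y)
        - G U (dl nab ξ (nab Z X) Y) = G U (nd nab ξ Z X Y) + G U (dl nab ξ X (nab Z Y)) := by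
      rw [H.metric, nd]
      simp only [map_sub]
      ring
    rw [mtr_congr key, mtr_add, K.mtr_dl H N F, K.mtr_dl H N F, lie_zero, add_zero] at h1
    exact h1.symm
  have key (U X : V) : ⁅ξ, G U (Rm nab X Z Y)⁆ - G ⁅ξ, U⁆ (Rm nab X Z Y) - G U (Rm nab ⁅ξ, X⁆ Z Y)
      = G U (Rm nab X Z ⁅ξ, Y⁆) + G U (Rm nab X ⁅ξ, Z⁆ Y) + 2 * h * (G L U * G L (Rm nab X Z Y))
        + G U (nd nab ξ X Z Y) - G U (nd nab ξ Z X Y) := by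
    rw [K.lie_metric, H.lie_Rm]
    simp only [map_sub, map_add]
    ring
  rw [ric, K.lie_mtr H N F (H.bilin_ric Y Z), mtr_congr key, mtr_sub, mtr_add, mtr_add, mtr_add,
    mtr_mul, hnd, F.mtr_left_mul H (fun X X' => by simp [H.Rm_add₁])
      (fun a X => by simp [H.Rm_smul₁]), ric, ric]
  ring

/-- This is the variation of Ric(·, L). Only the term `dl` at (Z, ∇_X L) needs the full formula
`metric_dl`; in the others L occupies a slot. The last bracket is h(tr B² - tr BᵀB) for B = ∇L. -/
theorem mtr_nd_self (Z : V) : mtr e f (fun U X => G U (nd nab ξ X Z L))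
    = (⁅L, ⁅L, h⁆ + 2 * κ * h⁆ + (κ + dvg G nab e f L) * (⁅L, h⁆ + 2 * κ * h) - κ * ⁅L, h⁆
      - h * κ ^ 2 - h * (mtr e f (fun Y Z => G Y (nab (nab Z L) L)) - gradSq G nab e f L))
      * G L Z := by
  set w := ⁅L, h⁆ + 2 * κ * h with hw
  have key (U X : V) : G U (nd nab ξ X Z L) = w * G L Z * G U (nab X L)
      + G L U * ⁅X, w * G L Z⁆ - w * (G L U * G L (nab X Z)) - G L Z * (G L U * ⁅nab X L, h⁆)
      - h * (G L U * G (nab Z L) (nab X L) + G L U * G (nab (nab X L) L) Z)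
      - h * G L Z * (G U (nab (nab X L) L) - G (nab U L) (nab X L)) := by
    have h1 := K.metric_dl H Z (nab X L) U
    rw [N.metric_self_nab H] at h1
    rw [nd, K.dl_self H N, K.dl_self H N, H.nab_smul_right, map_sub, map_sub, H.symm U (dl _ _ _ _),
      h1, ← hw, H.symm U (nab (nab X L) L)]
    simp only [map_add, map_smul, smul_eq_mul, H.symm U L]
    ring
  have hl := N.lie_metric_self H Z
  rw [mtr_congr key, mtr_sub, mtr_sub, mtr_sub, mtr_sub, mtr_add, mtr_mul, mtr_mul, mtr_mul,
    mtr_mul, mtr_mul, mtr_add, mtr_sub,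
    F.mtr_left_mul H (φ := fun X => ⁅X, w * G L Z⁆) (fun X Y => add_lie X Y _) (fun a X =>
      LieRinehartRing.lie_smul_eq_mul a _ X),
    F.mtr_left_mul H (φ := fun X => G L (nab X Z)) (fun X X' => by simp [H.nab_add_left])
      (fun a X => by simp [H.nab_smul_left]),
    F.mtr_left_mul H (φ := fun X => ⁅nab X L, h⁆) (fun X X' => by simp [H.nab_add_left])
      (fun a X => by simp [H.nab_smul_left]),
    F.mtr_left_mul H (φ := fun X => G (nab Z L) (nab X L))
      (fun X X' => by simp [H.nab_add_left]) (fun a X => by simp [H.nab_smul_left]),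
    F.mtr_left_mul H (φ := fun X => G (nab (nab X L) L) Z)
      (fun X X' => by simp [H.nab_add_left]) (fun a X => by simp [H.nab_smul_left]),
    LieRinehartRing.leibniz_mul_right, hl, N.geodesic, H.nab_smul_left, N.geodesic]
  simp only [map_smul, LinearMap.smul_apply, smul_eq_mul, LieRinehartRing.lie_smul_eq_mul,
    N.metric_nab_self H]
  rw [dvg, gradSq]
  ring

/-- The other contraction of `dl`, over its two lower slots, is also a multiple of L; its divergence
governs the scalar curvature. -/
theorem mtr_metric_dl (W : V) : mtr e f (fun Y Z => G W (dl nab ξ Z Y))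
    = 2 * (⁅L, h⁆ + h * dvg G nab e f L + h * κ) * G L W := by
  have key (Y Z : V) : G W (dl nab ξ Z Y) = G L W * (G L Y * ⁅Z, h⁆) + G L W * (⁅Y, h⁆ * G L Z)
      - ⁅W, h⁆ * (G L Y * G L Z) + h * (G L W * (G Y (nab Z L) + G Z (nab Y L))
        + G L Y * (G (nab Z L) W - G (nab W L) Z)
        + (G (nab Y L) W - G (nab W L) Y) * G L Z) := by
    rw [H.symm, K.metric_dl H, H.symm Y, H.symm Z]
    ring
  have a1 (X Y : V) : ⁅X + Y, h⁆ = ⁅X, h⁆ + ⁅Y, h⁆ := add_lie X Y h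
  have a2 (a : A) (X : V) : ⁅a • X, h⁆ = a * ⁅X, h⁆ := LieRinehartRing.lie_smul_eq_mul a h X
  have b1 (X Y : V) : G (nab (X + Y) L) W - G (nab W L) (X + Y)
      = G (nab X L) W - G (nab W L) X + (G (nab Y L) W - G (nab W L) Y) := by
    simp only [H.nab_add_left, map_add, LinearMap.add_apply]; ring
  have b2 (a : A) (X : V) : G (nab (a • X) L) W - G (nab W L) (a • X)
      = a * (G (nab X L) W - G (nab W L) X) := by
    simp only [H.nab_smul_left, map_smul, LinearMap.smul_apply, smul_eq_mul]; ring
  rw [mtr_congr key, mtr_add, mtr_sub, mtr_add, mtr_mul, mtr_mul, mtr_mul, mtr_mul, mtr_add,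
    mtr_add, mtr_mul, mtr_add, F.mtr_left_mul H (φ := fun X => ⁅X, h⁆) a1 a2,
    F.mtr_right_mul H (φ := fun X => ⁅X, h⁆) a1 a2,
    F.mtr_left_mul H (fun X Y => map_add (G L) X Y) (fun a X => map_smul (G L) a X),
    F.mtr_left_mul H (φ := fun X => G (nab X L) W - G (nab W L) X) b1 b2,
    F.mtr_right_mul H (φ := fun X => G (nab X L) W - G (nab W L) X) b1 b2,
    F.mtr_flip H (H.bilin_dvg L), N.null, N.metric_nab_self H, N.geodesic, dvg]
  simp only [map_smul, LinearMap.smul_apply, smul_eq_mul]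
  ring

theorem mtr_metric_nd (X W : V) : mtr e f (fun Y Z => G W (nd nab ξ X Z Y))
    = ⁅X, 2 * (⁅L, h⁆ + h * dvg G nab e f L + h * κ)⁆ * G L W
      + 2 * (⁅L, h⁆ + h * dvg G nab e f L + h * κ) * G (nab X L) W := by
  have hβ : Bilin fun Y Z => G W (dl nab ξ Z Y) :=
    ⟨by simp [H.dl_add_right], by simp [H.dl_smul_right], by simp [H.dl_add_left],
      by simp [H.dl_smul_left]⟩
  have h1 := F.lie_mtr_nab H hβ X
  have key (Y Z : V) : ⁅X, G W (dl nab ξ Z Y)⁆ - G W (dl nab ξ Z (nab X Y))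
      - G W (dl nab ξ (nab X Z) Y) = G W (nd nab ξ X Z Y) + G (nab X W) (dl nab ξ Z Y) := by
    rw [H.metric, nd]
    simp only [map_sub]
    ring
  rw [mtr_congr key, mtr_add, K.mtr_metric_dl H N F, K.mtr_metric_dl H N F,
    LieRinehartRing.leibniz_mul_right, H.metric] at h1
  simp only [smul_eq_mul] at h1
  linear_combination -h1

/-- Exchanging the two traces turns the contracted Ricci variation into the divergence of vL, where
vL is the contraction from `mtr_metric_dl`. The Ricci term is the trace correction. -/
theorem lie_scal : ⁅ξ, scal G nab e f⁆ = ⁅L, 2 * (⁅L, h⁆ + h * dvg G nab e f L + h * κ)⁆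
    + 2 * (⁅L, h⁆ + h * dvg G nab e f L + h * κ) * dvg G nab e f L
    - 2 * h * ric G nab e f L L := by
  set v := 2 * (⁅L, h⁆ + h * dvg G nab e f L + h * κ) with hv
  have key (Y Z : V) : ⁅ξ, ric G nab e f Y Z⁆ - ric G nab e f ⁅ξ, Y⁆ Z - ric G nab e f Y ⁅ξ, Z⁆
      = mtr e f (fun U X => G U (nd nab ξ X Z Y)) := by
    rw [K.lie_ric H N F]
    ring
  rw [scal, K.lie_mtr H N F H.ric_bilin, mtr_congr key]
  congr 1
  have key' (W X : V) : mtr e f (fun Y Z => G W (nd nab ξ X Z Y))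
      = G L W * ⁅X, v⁆ + v * G W (nab X L) := by
    rw [K.mtr_metric_nd H N F, ← hv, H.symm W]
    ring
  have hs : mtr e f (fun Y Z => mtr e f fun U X => G U (nd nab ξ X Z Y))
      = mtr e f (fun W X => mtr e f fun Y Z => G W (nd nab ξ X Z Y)) := Finset.sum_comm
  rw [hs, mtr_congr key', mtr_add, mtr_mul, F.mtr_left_mul H (φ := fun X => ⁅X, v⁆)
    (fun X Y => add_lie X Y v) (fun a X => LieRinehartRing.lie_smul_eq_mul a v X), dvg]

/-- Each summand has weight 2m up to terms in Dm and D²m, and the κ-terms of Δ are what makes these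
cancel. -/
theorem lie_del : ⁅ξ, del G nab e f L κ⁆ = 2 * m * del G nab e f L κ := by
  have hl (a : A) : ⁅ξ, ⁅L, a⁆⁆ = m * ⁅L, a⁆ + ⁅L, ⁅ξ, a⁆⁆ := by
    rw [leibniz_lie, K.lie_field H N, LieRinehartRing.lie_smul_eq_mul]
  have hc : ∀ X : V, ⁅X, (1 : A)⁆ = 0 := fun X => by
    simpa using LieRinehartRing.leibniz_mul_right X (1 : A) 1
  have h2 (X : V) : ⁅X, (2 : A)⁆ = 0 := by
    rw [← one_add_one_eq_two, lie_add, hc, add_zero]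
  have h3 (X : V) : ⁅X, (3 : A)⁆ = 0 := by
    rw [← two_add_one_eq_three, lie_add, hc, h2, add_zero]
  -- The inhomogeneous part of the variation of Ric(·, L) is proportional to ℓ, hence vanishes on L.
  have hr : ⁅ξ, ric G nab e f L L⁆ = 2 * m * ric G nab e f L L := by
    rw [K.lie_ric H N F, K.mtr_nd_self H N F, K.lie_field H N, H.ric_bilin.smul_left,
      H.ric_bilin.smul_right, N.null]
    ring
  simp only [del, lie_add, lie_sub, lie_neg, pow_two, LieRinehartRing.leibniz_mul_right, hl, h2, h3,
    K.lie_dvg H N F, K.lie_gradSq H N F, K.lie_geodesic H N, hr, smul_eq_mul]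
  ring

/-- In the combination defining `num`, all derivatives of h cancel and only h itself is left. Its
coefficient contains tr B², which Δ does not, so Raychaudhuri's equation is needed. -/
theorem lie_num (X Y : V) : ⁅ξ, num G nab e f L X Y⁆ = num G nab e f L ⁅ξ, X⁆ Y
    + num G nab e f L X ⁅ξ, Y⁆ + 2 * m * num G nab e f L X Y
    - 2 * h * del G nab e f L κ * (G L X * G L Y) := by
  set w := ⁅L, h⁆ + 2 * κ * h with hw
  have hc : ∀ X : V, ⁅X, (1 : A)⁆ = 0 := fun X => by
    simpa using LieRinehartRing.leibniz_mul_right X (1 : A) 1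
  have h2 (X : V) : ⁅X, (2 : A)⁆ = 0 := by
    rw [← one_add_one_eq_two, lie_add, hc, add_zero]
  have hn1 : nd nab ξ Y L L = 0 := by
    rw [nd, K.dl_self_self H N, H.dl_symm ξ L, K.dl_self H N, H.nab_zero_right,
      N.metric_self_nab H]
    simp
  have hn2 : nd nab ξ L Y L = ((⁅L, w⁆ + κ * w) * G L Y) • L := by
    rw [nd, K.dl_self H N, K.dl_self H N, N.geodesic, H.dl_smul_right, K.dl_self H N,
      H.nab_smul_right, N.geodesic, LieRinehartRing.leibniz_mul_right, N.lie_metric_self H, ← hw]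
    simp only [smul_eq_mul]
    module
  have hR : ⁅ξ, G X (Rm nab Y L L)⁆ = G ⁅ξ, X⁆ (Rm nab Y L L) + G X (Rm nab ⁅ξ, Y⁆ L L)
      + 2 * m * G X (Rm nab Y L L) - (⁅L, w⁆ + κ * w) * (G L X * G L Y) := by
    rw [K.lie_metric, N.metric_Rm_self H, H.lie_Rm, K.lie_field H N, hn1, hn2, H.Rm_smul₂,
      H.Rm_smul₃]
    simp only [map_add, map_sub, map_smul, smul_eq_mul, map_zero, H.symm X L]
    ring
  have hric (X : V) := K.lie_ric H N F X L
  have hnd (X : V) : mtr e f (fun U W => G U (nd nab ξ W L X))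
      = mtr e f (fun U W => G U (nd nab ξ W X L)) := mtr_congr fun U W => by rw [H.nd_symm]
  simp only [hnd, K.mtr_nd_self H N F, K.lie_field H N, H.ric_bilin.smul_right] at hric
  have hlw (X : V) := K.lie_form X
  have hray := N.raychaudhuri H F
  have hS := K.lie_scal H N F
  simp only [LieRinehartRing.leibniz_mul_right, lie_add, h2, smul_eq_mul] at hS
  have hLw : ⁅L, w⁆ = ⁅L, ⁅L, h⁆⁆ + 2 * ⁅L, κ⁆ * h + 2 * κ * ⁅L, h⁆ := by
    simp only [hw, lie_add, LieRinehartRing.leibniz_mul_right, h2, smul_eq_mul]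
    ring
  simp only [num, lie_sub, lie_add, LieRinehartRing.leibniz_mul_right, h2, smul_eq_mul, hR, hric,
    hlw, hS, del]
  simp only [← hw, hLw]
  rw [hw]
  -- The trace tr B² occurs with factor -h in each of the two Ricci terms, and these carry the
  -- factor 2.
  linear_combination (-4 * h * G L X * G L Y) * hray

end IsKS

end Algebraic

/-! ### Analysis: pointwise smoothness, coordinate frames and directional derivatives. -/

section

open Filter Topology Bundle VectorField

variable {n : ℕ} {M : Type*} [TopologicalSpace M] [ChartedSpace (EuclideanSpace ℝ (Fin n)) M]
  [IsManifold (𝓡 n) ∞ M]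

/-- The regularity required by the calculus of `mlieBracket`, such as the Jacobi identity; over ℝ it
is just C³. -/
instance instIsManifoldMinSmoothness : IsManifold (𝓡 n) (minSmoothness ℝ 3) M := by
  rw [minSmoothness_of_isRCLikeNormedField]
  exact IsManifold.of_le (n := ∞) ENat.LEInfty.out

/-! ### Smoothness at a point -/

variable (n) in
/-- Smoothness of a function at a point. -/
abbrev FunAt (f : M → ℝ) (x : M) : Prop := ContMDiffAt (𝓡 n) 𝓘(ℝ, ℝ) ∞ f x

/-- Smoothness of a vector field at a point. -/
abbrev VecAt (X : VField n M) (x : M) : Prop :=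
  ContMDiffAt (𝓡 n) ((𝓡 n).prod 𝓘(ℝ, EuclideanSpace ℝ (Fin n))) ∞
    (fun x => TotalSpace.mk' (EuclideanSpace ℝ (Fin n))
      (E := fun x : M => TangentSpace (𝓡 n) x) x (X x)) x

/-- Smoothness of a 1-form at a point. -/
abbrev FormAt (α : OneForm n M) (x : M) : Prop :=
  ContMDiffAt (𝓡 n) ((𝓡 n).prod 𝓘(ℝ, EuclideanSpace ℝ (Fin n) →L[ℝ] ℝ)) ∞
    (fun x => TotalSpace.mk' (EuclideanSpace ℝ (Fin n) →L[ℝ] ℝ)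
      (E := fun x : M => TangentSpace (𝓡 n) x →L[ℝ] ℝ) x (α x)) x

/-- Smoothness of a 2-covariant tensor field at a point. -/
abbrev BilinAt (B : BilinField n M) (x : M) : Prop :=
  ContMDiffAt (𝓡 n)
    ((𝓡 n).prod 𝓘(ℝ, EuclideanSpace ℝ (Fin n) →L[ℝ] EuclideanSpace ℝ (Fin n) →L[ℝ] ℝ)) ∞
    (fun x => TotalSpace.mk'
      (EuclideanSpace ℝ (Fin n) →L[ℝ] EuclideanSpace ℝ (Fin n) →L[ℝ] ℝ)
      (E := fun x : M => TangentSpace (𝓡 n) x →L[ℝ] TangentSpace (𝓡 n) x →L[ℝ] ℝ) x (B x)) x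

theorem FunAt.mdiff {f : M → ℝ} {x : M} (hf : FunAt n f x) : MDifferentiableAt (𝓡 n) 𝓘(ℝ, ℝ) f x :=
  hf.mdifferentiableAt (by simp)

theorem VecAt.mdiff {X : VField n M} {x : M} (hX : VecAt X x) :
    MDifferentiableAt (𝓡 n) ((𝓡 n).prod 𝓘(ℝ, EuclideanSpace ℝ (Fin n)))
    (fun x => TotalSpace.mk' (EuclideanSpace ℝ (Fin n))
      (E := fun x : M => TangentSpace (𝓡 n) x) x (X x)) x :=
  hX.mdifferentiableAt (by simp)

theorem FormAt.apply {α : OneForm n M} {X : VField n M} {x : M} (hα : FormAt α x)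
    (hX : VecAt X x) : FunAt n (fun y => α y (X y)) x := by
  have h := ContMDiffAt.clm_bundle_apply (F₁ := EuclideanSpace ℝ (Fin n)) (F₂ := ℝ)
    (E₁ := fun x : M => TangentSpace (𝓡 n) x) (E₂ := Trivial M ℝ) (b := fun x : M => x)
    (ϕ := α) (v := X) hα hX
  exact (contMDiffAt_totalSpace.1 h).2

theorem BilinAt.apply {B : BilinField n M} {X Y : VField n M} {x : M} (hB : BilinAt B x)
    (hX : VecAt X x) (hY : VecAt Y x) : FunAt n (fun y => B y (X y) (Y y)) x := by
  have h := ContMDiffAt.clm_bundle_apply (F₁ := EuclideanSpace ℝ (Fin n))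
    (F₂ := EuclideanSpace ℝ (Fin n) →L[ℝ] ℝ)
    (E₁ := fun x : M => TangentSpace (𝓡 n) x)
    (E₂ := fun x : M => TangentSpace (𝓡 n) x →L[ℝ] Trivial M ℝ x) (b := fun x : M => x)
    (ϕ := B) (v := X) hB hX
  exact FormAt.apply h hY

theorem VecAt.add {X Y : VField n M} {x : M} (hX : VecAt X x) (hY : VecAt Y x) :
    VecAt (X + Y) x := ContMDiffAt.add_section hX hY

theorem VecAt.neg {X : VField n M} {x : M} (hX : VecAt X x) : VecAt (-X) x :=
  ContMDiffAt.neg_section hX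

theorem VecAt.zero (x : M) : VecAt (0 : VField n M) x :=
  (contMDiff_zeroSection ℝ (fun x : M => TangentSpace (𝓡 n) x)) x

theorem VecAt.smul {f : M → ℝ} {X : VField n M} {x : M} (hf : FunAt n f x) (hX : VecAt X x) :
    VecAt (f • X) x := ContMDiffAt.smul_section hf hX

theorem VecAt.bracket {X Y : VField n M} {x : M} (hX : VecAt X x) (hY : VecAt Y x) :
    VecAt (mlieBracket (𝓡 n) X Y) x := by
  have : IsManifold (𝓡 n) (((⊤ : ℕ∞) : WithTop ℕ∞) + 1) M := by
    change IsManifold (𝓡 n) ∞ M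
    infer_instance
  exact ContMDiffAt.mlieBracket_vectorField (m := ⊤) (n := ⊤) hX hY (by
    rw [minSmoothness_of_isRCLikeNormedField]; exact le_rfl)

/-! ### Coordinate frames -/

/-- The domain of the preferred chart around `c`. -/
def dom (c : M) : Set M := (trivializationAt (EuclideanSpace ℝ (Fin n))
    (TangentSpace (𝓡 n) : M → Type _) c).baseSet

/-- The coordinate 1-form `dxⁱ` of the preferred chart around `c`. -/
def cof (c : M) (i : Fin n) (y : M) : TangentSpace (𝓡 n) y →ₗ[ℝ] ℝ :=
  (trivializationAt (EuclideanSpace ℝ (Fin n))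
    (TangentSpace (𝓡 n) : M → Type _) c).localFrameCoeff (𝓡 n)
      (EuclideanSpace.basisFun (Fin n) ℝ).toBasis i y

theorem isOpen_dom (c : M) : IsOpen (dom (n := n) c) := Trivialization.open_baseSet _

theorem mem_dom (c : M) : c ∈ dom (n := n) c :=
  FiberBundle.mem_baseSet_trivializationAt (EuclideanSpace ℝ (Fin n))
    (TangentSpace (𝓡 n) : M → Type _) c

theorem VecAt.frame (c : M) (i : Fin n) {y : M} (hy : y ∈ dom (n := n) c) :
    VecAt (frame c i) y :=
  contMDiffAt_localFrame_of_mem ∞ _ _ i hy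

theorem VecAt.cof {X : VField n M} {c y : M} (hX : VecAt X y) (i : Fin n)
    (hy : y ∈ dom (n := n) c) : FunAt n (fun z => cof c i z (X z)) y :=
  contMDiffAt_localFrameCoeff (EuclideanSpace.basisFun (Fin n) ℝ).toBasis hy hX i

theorem sum_cof {c y : M} (hy : y ∈ dom (n := n) c) (v : TangentSpace (𝓡 n) y) :
    ∑ i, cof c i y v • frame c i y = v := by
  classical
  -- The expansion is stated for sections, so the single vector v becomes the value at y of a
  -- section that is zero elsewhere.
  have h := Trivialization.eq_sum_localFrameCoeff_smul (I := 𝓡 n)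
    (b := (EuclideanSpace.basisFun (Fin n) ℝ).toBasis) hy
    (s := Function.update (0 : VField n M) y v)
  simp only [Function.update_self] at h
  exact h.symm

theorem cof_frame {c y : M} (hy : y ∈ dom (n := n) c) (i j : Fin n) :
    cof c i y (frame c j y) = if i = j then 1 else 0 := by
  have h := Trivialization.localFrameCoeff_apply_of_mem_baseSet (I := 𝓡 n) _
    (EuclideanSpace.basisFun (Fin n) ℝ).toBasis hy (frame c j) i
  rw [cof, h, KerrSchild.frame, Trivialization.localFrame_apply_of_mem_baseSet _ _ hy,
    Module.Basis.repr_self, Finsupp.single_apply]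
  simp [eq_comm]

theorem coframe_eq_cof (x : M) (i : Fin n) (v : TangentSpace (𝓡 n) x) :
    coframe x i v = cof x i x v := by
  conv_lhs => rw [← sum_cof (mem_dom x) v]
  simp [coframe_frame]

theorem ext_cof {c y : M} (hy : y ∈ dom (n := n) c) {v w : TangentSpace (𝓡 n) y}
    (h : ∀ i, cof c i y v = cof c i y w) : v = w := by
  rw [← sum_cof hy v, ← sum_cof hy w]
  simp [h]

theorem VecAt.of_cof {X : VField n M} {c y : M} (hy : y ∈ dom (n := n) c)
    (h : ∀ i, FunAt n (fun z => KerrSchild.cof c i z (X z)) y) : VecAt X y :=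
  (contMDiffAt_iff_localFrameCoeff (EuclideanSpace.basisFun (Fin n) ℝ).toBasis hy).2 h

/-! ### Directional derivatives -/

theorem lieFun_congr {X X' : VField n M} {f f' : M → ℝ} {x : M} (hX : X x = X' x)
    (hf : f =ᶠ[𝓝 x] f') : lieFun X f x = lieFun X' f' x := by
  rw [lieFun, lieFun, hX, mvfderiv, mvfderiv, hf.mfderiv_eq]
  rfl

/-- Since [∂ᵢ, f∂ᵢ] = (∂ᵢf)∂ᵢ, smoothness of ∂ᵢf is inherited from smoothness of brackets; a general
X is then expanded in the frame. -/
theorem FunAt.lieFun {X : VField n M} {f : M → ℝ} {x : M} (hX : VecAt X x) (hf : FunAt n f x) :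
    FunAt n (lieFun X f) x := by
  have key (i : Fin n) : FunAt n (KerrSchild.lieFun (KerrSchild.frame x i) f) x := by
    have hb := VecAt.cof ((VecAt.frame x i (mem_dom x)).bracket
      (VecAt.smul hf (VecAt.frame x i (mem_dom x)))) i (mem_dom x)
    refine hb.congr_of_eventuallyEq ?_
    have h1 : ∀ᶠ y in 𝓝 x, ContMDiffAt (𝓡 n) 𝓘(ℝ, ℝ) 1 f y :=
      (contMDiffAt_iff_contMDiffAt_nhds (by simp)).1 (hf.of_le ENat.LEInfty.out)
    filter_upwards [h1, (isOpen_dom (n := n) x).mem_nhds (mem_dom x)] with y hy hy'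
    rw [mlieBracket_smul_right (hy.mdifferentiableAt (by simp)) (VecAt.frame x i hy').mdiff]
    simp [cof_frame hy', KerrSchild.lieFun]
  have : FunAt n (fun y => ∑ i, KerrSchild.cof x i y (X y) *
      KerrSchild.lieFun (KerrSchild.frame x i) f y) x :=
    ContMDiffAt.sum fun i _ => (hX.cof i (mem_dom x)).mul (key i)
  refine this.congr_of_eventuallyEq ?_
  filter_upwards [(isOpen_dom (n := n) x).mem_nhds (mem_dom x)] with y hy
  rw [KerrSchild.lieFun]
  conv_lhs => rw [← sum_cof hy (X y)]
  simp [KerrSchild.lieFun]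

end

/-! ### Smooth functions and vector fields on an open set as a Lie-Rinehart ring. -/

section

open Filter Topology Bundle VectorField TopologicalSpace

variable {n : ℕ} {M : Type*} [TopologicalSpace M] [ChartedSpace (EuclideanSpace ℝ (Fin n)) M]
  [IsManifold (𝓡 n) ∞ M]

theorem lieFun_mul (X : VField n M) {f f' : M → ℝ} {x : M} (hf : FunAt n f x)
    (hf' : FunAt n f' x) : lieFun X (f * f') x = f x * lieFun X f' x + f' x * lieFun X f x := by
  rw [lieFun, mvfderiv_mul hf.mdiff hf'.mdiff]
  simp [lieFun]

theorem lieFun_add (X : VField n M) {f f' : M → ℝ} {x : M} (hf : FunAt n f x)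
    (hf' : FunAt n f' x) : lieFun X (f + f') x = lieFun X f x + lieFun X f' x := by
  rw [lieFun, mvfderiv_add hf.mdiff hf'.mdiff]
  simp [lieFun]

theorem eventually_mdiff_fun {f : M → ℝ} {x : M} (hf : FunAt n f x) :
    ∀ᶠ y in 𝓝 x, MDifferentiableAt (𝓡 n) 𝓘(ℝ, ℝ) f y := by
  have h1 : ∀ᶠ y in 𝓝 x, ContMDiffAt (𝓡 n) 𝓘(ℝ, ℝ) 1 f y :=
    (contMDiffAt_iff_contMDiffAt_nhds (by simp)).1 (hf.of_le ENat.LEInfty.out)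
  exact h1.mono fun y hy => hy.mdifferentiableAt (by simp)

theorem mlieBracket_smul_frame {f : M → ℝ} {x : M} (hf : FunAt n f x) (X : VField n M)
    (i : Fin n) : mlieBracket (𝓡 n) X (f • frame x i) =ᶠ[𝓝 x]
      lieFun X f • frame x i + f • mlieBracket (𝓡 n) X (frame x i) := by
  filter_upwards [eventually_mdiff_fun hf, (isOpen_dom (n := n) x).mem_nhds (mem_dom x)]
    with y hy hy'
  rw [mlieBracket_smul_right hy (VecAt.frame x i hy').mdiff]
  rfl

/-- Obtained from the Jacobi identity for X, Y and fZ, with Z a coordinate field: after subtracting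
f times the identity for X, Y, Z, the coefficient of Z is the claim. In dimension 0 no such Z
exists, but all vectors vanish. -/
theorem lieFun_mlieBracket {X Y : VField n M} {f : M → ℝ} {x : M} (hX : VecAt X x)
    (hY : VecAt Y x) (hf : FunAt n f x) : lieFun (mlieBracket (𝓡 n) X Y) f x
      = lieFun X (lieFun Y f) x - lieFun Y (lieFun X f) x := by
  rcases Nat.eq_zero_or_pos n with hn | hn
  · subst hn
    have : ∀ v : TangentSpace (𝓡 0) x, v = 0 := fun v => by
      rw [← sum_cof (mem_dom x) v]
      simp
    simp [lieFun, this]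
  · set Z : VField n M := frame x ⟨0, hn⟩ with hZdef
    have hZ : VecAt Z x := VecAt.frame x _ (mem_dom x)
    have two (W : VField n M) (hW : VecAt W x) := hW.of_le
      (show minSmoothness ℝ 2 ≤ ∞ by
        rw [minSmoothness_of_isRCLikeNormedField]; exact ENat.LEInfty.out)
    have iter {X Y : VField n M} (hX : VecAt X x) (hY : VecAt Y x) :
        mlieBracket (𝓡 n) X (mlieBracket (𝓡 n) Y (f • Z)) x
          = lieFun X (lieFun Y f) x • Z x + lieFun Y f x • mlieBracket (𝓡 n) X Z x
            + (lieFun X f x • mlieBracket (𝓡 n) Y Z x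
              + f x • mlieBracket (𝓡 n) X (mlieBracket (𝓡 n) Y Z) x) := by
      have h1 := Filter.EventuallyEq.mlieBracket_vectorField_eq (V := X) (V₁ := X)
        EventuallyEq.rfl (mlieBracket_smul_frame hf Y ⟨0, hn⟩)
      rw [← hZdef] at h1
      rw [h1, mlieBracket_add_right
          (VecAt.smul (FunAt.lieFun hY hf) hZ).mdiff (VecAt.smul hf (hY.bracket hZ)).mdiff,
        mlieBracket_smul_right (FunAt.lieFun hY hf).mdiff hZ.mdiff,
        mlieBracket_smul_right hf.mdiff (hY.bracket hZ).mdiff]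
      rfl
    have jac := leibniz_identity_mlieBracket_apply (two X hX) (two Y hY)
      (two _ (VecAt.smul hf hZ))
    have jac' := leibniz_identity_mlieBracket_apply (two X hX) (two Y hY) (two _ hZ)
    rw [iter hX hY, iter hY hX, mlieBracket_smul_right hf.mdiff hZ.mdiff, jac'] at jac
    have key : (lieFun X (lieFun Y f) x - lieFun (mlieBracket (𝓡 n) X Y) f x
        - lieFun Y (lieFun X f) x) • Z x = 0 := by
      rw [← sub_eq_zero] at jac
      rw [← jac, lieFun]
      simp only [lieFun]
      module
    have := congrArg (cof x ⟨0, hn⟩ x) key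
    rw [map_smul, hZdef, cof_frame (mem_dom x)] at this
    simp at this
    linarith

/-! ### Smooth functions and vector fields on an open set -/

variable (n) in
/-- The algebra of smooth functions on the open set `U`. -/
def funAlg (U : Opens M) : Subalgebra ℝ (U → ℝ) where
  -- F is arbitrary off U, so this is all of C^∞(U). An extension is kept because derivatives and
  -- brackets are defined for objects on M.
  carrier := {f | ∃ F : M → ℝ, (∀ y ∈ U, FunAt n F y) ∧ ∀ y : U, F y = f y}
  mul_mem' := by
    rintro f f' ⟨F, hF, h⟩ ⟨F', hF', h'⟩
    exact ⟨F * F', fun y hy => (hF y hy).mul (hF' y hy), fun y => by simp [h, h']⟩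
  add_mem' := by
    rintro f f' ⟨F, hF, h⟩ ⟨F', hF', h'⟩
    exact ⟨F + F', fun y hy => (hF y hy).add (hF' y hy), fun y => by simp [h, h']⟩
  algebraMap_mem' r := ⟨fun _ => r, fun y _ => contMDiffAt_const, fun _ => rfl⟩

variable (n) in
/-- The group of smooth vector fields on the open set `U`. -/
def vecGroup (U : Opens M) : AddSubgroup ((y : U) → TangentSpace (𝓡 n) (y : M)) where
  carrier := {X | ∃ F : VField n M, (∀ y ∈ U, VecAt F y) ∧ ∀ y : U, F y = X y}
  add_mem' := by
    rintro f f' ⟨F, hF, h⟩ ⟨F', hF', h'⟩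
    exact ⟨F + F', fun y hy => (hF y hy).add (hF' y hy), fun y => by simp [h, h']⟩
  zero_mem' := ⟨0, fun y _ => VecAt.zero y, fun _ => rfl⟩
  neg_mem' := by
    rintro f ⟨F, hF, h⟩
    exact ⟨-F, fun y hy => (hF y hy).neg, fun y => by simp [h]⟩

variable (n) in
/-- Smooth functions on the open set `U`. -/
def Fun (U : Opens M) : Type _ := funAlg n U

variable (n) in
/-- Smooth vector fields on the open set `U`. -/
def Vec (U : Opens M) : Type _ := vecGroup n U

variable {U : Opens M}

instance : CommRing (Fun n U) := inferInstanceAs (CommRing (funAlg n U))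

instance : AddCommGroup (Vec n U) := inferInstanceAs (AddCommGroup (vecGroup n U))

namespace Fun

/-- An extension of `f` to `M`. -/
def rep (f : Fun n U) : M → ℝ := f.2.choose

theorem smooth (f : Fun n U) {y : M} (hy : y ∈ U) : FunAt n f.rep y := f.2.choose_spec.1 y hy

theorem rep_eq (f : Fun n U) (y : U) : f.rep y = f.1 y := f.2.choose_spec.2 y

/-- The restriction of `F` to `U`. -/
def of (F : M → ℝ) (hF : ∀ y ∈ U, FunAt n F y) : Fun n U := ⟨fun y => F y, F, hF, fun _ => rfl⟩

theorem rep_of {F : M → ℝ} (hF : ∀ y ∈ U, FunAt n F y) {y : M} (hy : y ∈ U) :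
    (of F hF).rep y = F y := (of F hF).rep_eq ⟨y, hy⟩

@[ext]
theorem ext {f f' : Fun n U} (h : ∀ y ∈ U, f.rep y = f'.rep y) : f = f' := by
  refine Subtype.ext (funext fun y => ?_)
  rw [← rep_eq, ← rep_eq, h y y.2]

variable {y : M} (hy : y ∈ U)
include hy

theorem rep_add (f f' : Fun n U) : (f + f').rep y = f.rep y + f'.rep y := by
  rw [rep_eq _ ⟨y, hy⟩, rep_eq f ⟨y, hy⟩, rep_eq f' ⟨y, hy⟩]; rfl

theorem rep_mul (f f' : Fun n U) : (f * f').rep y = f.rep y * f'.rep y := by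
  rw [rep_eq _ ⟨y, hy⟩, rep_eq f ⟨y, hy⟩, rep_eq f' ⟨y, hy⟩]; rfl

theorem rep_neg (f : Fun n U) : (-f).rep y = -f.rep y := by
  rw [rep_eq _ ⟨y, hy⟩, rep_eq f ⟨y, hy⟩]; rfl

theorem rep_sub (f f' : Fun n U) : (f - f').rep y = f.rep y - f'.rep y := by
  rw [rep_eq _ ⟨y, hy⟩, rep_eq f ⟨y, hy⟩, rep_eq f' ⟨y, hy⟩]; rfl

theorem rep_zero : (0 : Fun n U).rep y = 0 := by
  rw [rep_eq _ ⟨y, hy⟩]; rfl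

theorem rep_one : (1 : Fun n U).rep y = 1 := by
  rw [rep_eq _ ⟨y, hy⟩]; rfl

theorem rep_ofNat (k : ℕ) [k.AtLeastTwo] :
    (OfNat.ofNat k : Fun n U).rep y = OfNat.ofNat k := by
  rw [rep_eq _ ⟨y, hy⟩]; rfl

theorem rep_sum {ι : Type*} (s : Finset ι) (f : ι → Fun n U) :
    (∑ i ∈ s, f i).rep y = ∑ i ∈ s, (f i).rep y := by
  classical
  induction s using Finset.induction_on with
  | empty => simp [rep_zero hy]
  | insert i s hi ih => rw [Finset.sum_insert hi, Finset.sum_insert hi, rep_add hy, ih]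

end Fun

theorem eventuallyEq_of_open {Y : Type*} {f f' : M → Y} (h : ∀ y ∈ U, f y = f' y) {y : M}
    (hy : y ∈ U) : f =ᶠ[𝓝 y] f' :=
  Filter.eventually_of_mem (U.2.mem_nhds hy) h

theorem eventuallyEq_of_open' {X X' : VField n M} (h : ∀ y ∈ U, X y = X' y) {y : M}
    (hy : y ∈ U) : X =ᶠ[𝓝 y] X' :=
  Filter.eventually_of_mem (U.2.mem_nhds hy) h

namespace Vec

/-- An extension of `X` to `M`. -/
def rep (X : Vec n U) : VField n M := X.2.choose

theorem smooth (X : Vec n U) {y : M} (hy : y ∈ U) : VecAt X.rep y := X.2.choose_spec.1 y hy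

theorem rep_eq (X : Vec n U) (y : U) : X.rep y = X.1 y := X.2.choose_spec.2 y

/-- The restriction of `F` to `U`. -/
def of (F : VField n M) (hF : ∀ y ∈ U, VecAt F y) : Vec n U := ⟨fun y => F y, F, hF, fun _ => rfl⟩

theorem rep_of {F : VField n M} (hF : ∀ y ∈ U, VecAt F y) {y : M} (hy : y ∈ U) :
    (of F hF).rep y = F y := (of F hF).rep_eq ⟨y, hy⟩

@[ext]
theorem ext {X X' : Vec n U} (h : ∀ y ∈ U, X.rep y = X'.rep y) : X = X' := by
  refine Subtype.ext (funext fun y => ?_)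
  rw [← rep_eq, ← rep_eq, h y y.2]

theorem rep_add (X X' : Vec n U) {y : M} (hy : y ∈ U) :
    (X + X').rep y = X.rep y + X'.rep y := by
  rw [rep_eq _ ⟨y, hy⟩, rep_eq X ⟨y, hy⟩, rep_eq X' ⟨y, hy⟩]; rfl

theorem rep_sub (X X' : Vec n U) {y : M} (hy : y ∈ U) :
    (X - X').rep y = X.rep y - X'.rep y := by
  rw [rep_eq _ ⟨y, hy⟩, rep_eq X ⟨y, hy⟩, rep_eq X' ⟨y, hy⟩]; rfl

theorem rep_zero {y : M} (hy : y ∈ U) : (0 : Vec n U).rep y = 0 := by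
  rw [rep_eq _ ⟨y, hy⟩]; rfl

instance : SMul (Fun n U) (Vec n U) :=
  ⟨fun f X => of (f.rep • X.rep) fun _ hy => VecAt.smul (f.smooth hy) (X.smooth hy)⟩

theorem rep_smul (f : Fun n U) (X : Vec n U) {y : M} (hy : y ∈ U) :
    (f • X).rep y = f.rep y • X.rep y := rep_of _ hy

instance : Module (Fun n U) (Vec n U) where
  one_smul X := ext fun y hy => by rw [rep_smul _ _ hy, Fun.rep_one hy, one_smul]
  mul_smul f f' X := ext fun y hy => by
    rw [rep_smul _ _ hy, rep_smul _ _ hy, rep_smul _ _ hy, Fun.rep_mul hy, mul_smul]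
  smul_zero f := ext fun y hy => by rw [rep_smul _ _ hy, rep_zero hy, smul_zero]
  smul_add f X Y := ext fun y hy => by
    rw [rep_smul _ _ hy, rep_add _ _ hy, rep_add _ _ hy, rep_smul _ _ hy, rep_smul _ _ hy, smul_add]
  add_smul f f' X := ext fun y hy => by
    rw [rep_smul _ _ hy, rep_add _ _ hy, Fun.rep_add hy, rep_smul _ _ hy, rep_smul _ _ hy, add_smul]
  zero_smul X := ext fun y hy => by rw [rep_smul _ _ hy, Fun.rep_zero hy, zero_smul, rep_zero hy]

theorem rep_sum {ι : Type*} (s : Finset ι) (X : ι → Vec n U) {y : M} (hy : y ∈ U) :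
    (∑ i ∈ s, X i).rep y = ∑ i ∈ s, (X i).rep y := by
  classical
  induction s using Finset.induction_on with
  | empty => simp [rep_zero hy]
  | insert i s hi ih => rw [Finset.sum_insert hi, Finset.sum_insert hi, rep_add _ _ hy, ih]

/-- Computed on chosen extensions; on the open set U the result depends only on germs, hence not on
the choice (`mlieBracket_congr`). -/
instance : Bracket (Vec n U) (Vec n U) :=
  ⟨fun X Y => of (mlieBracket (𝓡 n) X.rep Y.rep) fun _ hy => (X.smooth hy).bracket (Y.smooth hy)⟩

theorem rep_lie (X Y : Vec n U) {y : M} (hy : y ∈ U) :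
    ⁅X, Y⁆.rep y = mlieBracket (𝓡 n) X.rep Y.rep y := rep_of _ hy

instance : Bracket (Vec n U) (Fun n U) :=
  ⟨fun X f => Fun.of (lieFun X.rep f.rep) fun _ hy => FunAt.lieFun (X.smooth hy) (f.smooth hy)⟩

theorem rep_lie_fun (X : Vec n U) (f : Fun n U) {y : M} (hy : y ∈ U) :
    ⁅X, f⁆.rep y = lieFun X.rep f.rep y := Fun.rep_of _ hy

theorem mlieBracket_congr {X X' Y Y' : VField n M} (hX : ∀ y ∈ U, X y = X' y)
    (hY : ∀ y ∈ U, Y y = Y' y) {y : M} (hy : y ∈ U) :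
    mlieBracket (𝓡 n) X Y y = mlieBracket (𝓡 n) X' Y' y :=
  Filter.EventuallyEq.mlieBracket_vectorField_eq (eventuallyEq_of_open' hX hy)
    (eventuallyEq_of_open' hY hy)

instance : LieRing (Vec n U) where
  add_lie X Y Z := ext fun y hy => by
    rw [rep_add _ _ hy, rep_lie _ _ hy, rep_lie _ _ hy, rep_lie _ _ hy,
      mlieBracket_congr (X' := X.rep + Y.rep) (fun z hz => rep_add _ _ hz) (fun _ _ => rfl) hy,
      mlieBracket_add_left (X.smooth hy).mdiff (Y.smooth hy).mdiff]
  lie_add X Y Z := ext fun y hy => by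
    rw [rep_add _ _ hy, rep_lie _ _ hy, rep_lie _ _ hy, rep_lie _ _ hy,
      mlieBracket_congr (Y' := Y.rep + Z.rep) (fun _ _ => rfl) (fun z hz => rep_add _ _ hz) hy,
      mlieBracket_add_right (Y.smooth hy).mdiff (Z.smooth hy).mdiff]
  lie_self X := ext fun y hy => by
    rw [rep_lie _ _ hy, mlieBracket_self, rep_zero hy]; rfl
  leibniz_lie X Y Z := ext fun y hy => by
    have two (W : Vec n U) := (W.smooth hy).of_le
      (show minSmoothness ℝ 2 ≤ ∞ by
        rw [minSmoothness_of_isRCLikeNormedField]; exact ENat.LEInfty.out)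
    rw [rep_add _ _ hy, rep_lie _ _ hy, rep_lie _ _ hy, rep_lie _ _ hy,
      mlieBracket_congr (fun _ _ => rfl) (fun z hz => rep_lie Y Z hz) hy,
      mlieBracket_congr (fun z hz => rep_lie X Y hz) (fun _ _ => rfl) hy,
      mlieBracket_congr (fun _ _ => rfl) (fun z hz => rep_lie X Z hz) hy]
    exact leibniz_identity_mlieBracket_apply (two X) (two Y) (two Z)

instance : LieRingModule (Vec n U) (Fun n U) where
  add_lie X Y f := Fun.ext fun y hy => by
    rw [Fun.rep_add hy, rep_lie_fun _ _ hy, rep_lie_fun _ _ hy, rep_lie_fun _ _ hy]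
    simp [lieFun, rep_add _ _ hy]
  lie_add X f f' := Fun.ext fun y hy => by
    rw [Fun.rep_add hy, rep_lie_fun _ _ hy, rep_lie_fun _ _ hy, rep_lie_fun _ _ hy,
      lieFun_congr (f' := f.rep + f'.rep) rfl
        (eventuallyEq_of_open (fun z hz => Fun.rep_add hz f f') hy),
      lieFun_add _ (f.smooth hy) (f'.smooth hy)]
  leibniz_lie X Y f := Fun.ext fun y hy => by
    rw [Fun.rep_add hy, rep_lie_fun _ _ hy, rep_lie_fun _ _ hy, rep_lie_fun _ _ hy,
      lieFun_congr rfl (eventuallyEq_of_open (fun z hz => rep_lie_fun Y f hz) hy),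
      lieFun_congr rfl (eventuallyEq_of_open (fun z hz => rep_lie_fun X f hz) hy),
      lieFun_congr (rep_lie X Y hy) EventuallyEq.rfl,
      lieFun_mlieBracket (X.smooth hy) (Y.smooth hy) (f.smooth hy)]
    ring

/-- From here on the results of the namespace `Algebraic` apply to functions and vector fields on U.
-/
instance : LieRinehartRing (Fun n U) (Vec n U) where
  lie_smul_eq_mul' f f' X := Fun.ext fun y hy => by
    rw [Fun.rep_mul hy, rep_lie_fun _ _ hy, rep_lie_fun _ _ hy]
    simp [lieFun, rep_smul _ _ hy]
  leibniz_mul_right' X f f' := Fun.ext fun y hy => by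
    rw [Fun.rep_add hy, smul_eq_mul, Fun.rep_mul hy, Fun.rep_mul hy, rep_lie_fun _ _ hy,
      rep_lie_fun _ _ hy, rep_lie_fun _ _ hy, lieFun_congr (f' := f.rep * f'.rep) rfl
        (eventuallyEq_of_open (fun z hz => Fun.rep_mul hz f f') hy),
      lieFun_mul _ (f.smooth hy) (f'.smooth hy)]
    ring
  leibniz_smul_right' X Y f := ext fun y hy => by
    rw [rep_add _ _ hy, rep_smul _ _ hy, rep_smul _ _ hy, rep_lie _ _ hy, rep_lie _ _ hy,
      rep_lie_fun _ _ hy, mlieBracket_congr (Y' := f.rep • Y.rep) (fun _ _ => rfl)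
        (fun z hz => rep_smul f Y hz) hy,
      mlieBracket_smul_right (f.smooth hy).mdiff (Y.smooth hy).mdiff, add_comm]
    rfl

end Vec

end

/-! ### Index raising, smoothness of inverses, and tensoriality of Lie derivatives. -/

section

open Filter Topology Bundle VectorField TopologicalSpace

/-! ### Matrices and finite-dimensional bilinear forms -/

/-- `ContinuousLinearMap.inverse` is zero by default on non-invertible maps; here nondegeneracy and
equality of dimensions make B invertible. -/
theorem apply_inverse_of_nondegenerate {E : Type*} [NormedAddCommGroup E] [NormedSpace ℝ E]
    [FiniteDimensional ℝ E] (B : E →L[ℝ] E →L[ℝ] ℝ) (hB : ∀ u, (∀ v, B u v = 0) → u = 0)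
    (α : E →L[ℝ] ℝ) : B (B.inverse α) = α := by
  have hinj : Function.Injective (B : E →ₗ[ℝ] (E →L[ℝ] ℝ)) := by
    rw [← LinearMap.ker_eq_bot, LinearMap.ker_eq_bot']
    exact fun u hu => hB u fun v => by
      have := congrArg (fun f : E →L[ℝ] ℝ => f v) hu
      simpa using this
  have hdim : Module.finrank ℝ E = Module.finrank ℝ (E →L[ℝ] ℝ) := by
    rw [← (LinearMap.toContinuousLinearMap (𝕜 := ℝ) (E := E) (F' := ℝ)).finrank_eq]
    exact (Subspace.dual_finrank_eq (K := ℝ) (V := E)).symm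
  let e := (LinearEquiv.ofInjectiveOfFinrankEq (B : E →ₗ[ℝ] (E →L[ℝ] ℝ)) hinj
    hdim).toContinuousLinearEquiv
  have he : B = (e : E →L[ℝ] (E →L[ℝ] ℝ)) := by
    ext; rfl
  rw [he, ContinuousLinearMap.inverse_equiv]
  simp

variable {n : ℕ} {M : Type*} [TopologicalSpace M] [ChartedSpace (EuclideanSpace ℝ (Fin n)) M]

theorem FunAt.det {ι : Type*} [Fintype ι] [DecidableEq ι] {A : M → Matrix ι ι ℝ} {x : M}
    (hA : ∀ i j, FunAt n (fun y => A y i j) x) : FunAt n (fun y => (A y).det) x := by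
  simp only [Matrix.det_apply']
  exact ContMDiffAt.sum fun σ _ => contMDiffAt_const.mul (contMDiffAt_finsetProd fun i _ => hA _ _)

theorem FunAt.matrix_inv {ι : Type*} [Fintype ι] [DecidableEq ι] {A : M → Matrix ι ι ℝ} {x : M}
    (hA : ∀ i j, FunAt n (fun y => A y i j) x) (h : (A x).det ≠ 0) (i j : ι) :
    FunAt n (fun y => (A y)⁻¹ i j) x := by
  simp only [Matrix.inv_def, Matrix.smul_apply, Ring.inverse_eq_inv', smul_eq_mul,
    Matrix.adjugate_apply]
  refine ((FunAt.det hA).inv₀ h).mul (FunAt.det fun k l => ?_)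
  by_cases hk : k = j
  · subst hk
    simpa using contMDiffAt_const
  · simpa [Matrix.updateRow_ne hk] using hA k l

variable [IsManifold (𝓡 n) ∞ M]

/-! ### The metric -/

theorem IsMetric.at {g : BilinField n M} (hg : IsMetric g) (x : M) : BilinAt g x := hg.smooth x

theorem IsMetric.apply_inverse {g : BilinField n M} (hg : IsMetric g) (x : M)
    (α : TangentSpace (𝓡 n) x →L[ℝ] ℝ) : g x ((g x).inverse α) = α :=
  apply_inverse_of_nondegenerate (E := EuclideanSpace ℝ (Fin n)) (g x) (hg.nondegenerate x) α

theorem IsMetric.apply_sharp {g : BilinField n M} (hg : IsMetric g) (α : OneForm n M) (x : M)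
    (v : TangentSpace (𝓡 n) x) : g x (sharp g α x) v = α x v := by
  rw [sharp, hg.apply_inverse]

/-- The matrix of components of `B` in the coordinate frame of the chart around `c`. -/
def comps (B : BilinField n M) (c y : M) : Matrix (Fin n) (Fin n) ℝ :=
  Matrix.of fun i j => B y (frame c i y) (frame c j y)

theorem det_comps_ne_zero_iff {B : BilinField n M} {c y : M} (hy : y ∈ dom (n := n) c) :
    (comps B c y).det ≠ 0 ↔ ∀ u, (∀ v, B y v u = 0) → u = 0 := by
  constructor
  · intro h u hu
    by_contra hne
    refine h (Matrix.exists_mulVec_eq_zero_iff.1 ⟨fun j => cof c j y u, fun h0 => hne ?_, ?_⟩)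
    · exact ext_cof hy fun i => by simpa using congrFun h0 i
    · funext i
      have := hu (frame c i y)
      conv at this => lhs; rw [← sum_cof hy u]
      simpa [Matrix.mulVec, dotProduct, comps, mul_comm] using this
  · intro h h0
    obtain ⟨w, hw, h1⟩ := Matrix.exists_mulVec_eq_zero_iff.2 h0
    refine hw (funext fun j => ?_)
    have h2 := h (∑ j, w j • frame c j y) fun v => by
      rw [← sum_cof hy v]
      have h3 (i : Fin n) : ∑ j, w j * B y (frame c i y) (frame c j y) = 0 := by
        simpa [Matrix.mulVec, dotProduct, comps, mul_comm] using congrFun h1 i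
      simp only [map_sum, map_smul, smul_eq_mul, sum_apply,
        smul_apply, Finset.mul_sum]
      rw [Finset.sum_comm]
      refine Finset.sum_eq_zero fun i _ => ?_
      rw [← mul_zero (cof c i y v), ← h3 i, Finset.mul_sum]
      exact Finset.sum_congr rfl fun j _ => by ring
    have := congrArg (cof c j y) h2
    simpa [cof_frame hy] using this

theorem IsMetric.det_comps {g : BilinField n M} (hg : IsMetric g) {c y : M}
    (hy : y ∈ dom (n := n) c) : (comps g c y).det ≠ 0 :=
  (det_comps_ne_zero_iff hy).2 fun u hu => hg.nondegenerate y u fun v => by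
    rw [hg.symm, hu]

/-- The components of the raised form solve a linear system whose matrix has a smooth inverse. Only
smoothness of the components of α is required, which suits covectors built by `covectorAt`. -/
theorem IsMetric.vecAt_sharp {g : BilinField n M} (hg : IsMetric g) {α : OneForm n M} {c y : M}
    (hy : y ∈ dom (n := n) c) (hα : ∀ i, FunAt n (fun z => α z (frame c i z)) y) :
    VecAt (sharp g α) y := by
  refine VecAt.of_cof hy fun i => ?_
  have h1 : FunAt n (fun z => ∑ j, (comps g c z)⁻¹ i j * α z (frame c j z)) y :=
    ContMDiffAt.sum fun j _ => (FunAt.matrix_inv (fun i j => (hg.at y).apply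
      (VecAt.frame c i hy) (VecAt.frame c j hy)) (hg.det_comps hy) i j).mul (hα j)
  refine h1.congr_of_eventuallyEq ?_
  filter_upwards [(isOpen_dom (n := n) c).mem_nhds hy] with z hz
  have h2 : (comps g c z).mulVec (fun j => cof c j z (sharp g α z))
      = fun j => α z (frame c j z) := by
    funext j
    rw [← hg.apply_sharp α z, hg.symm]
    conv_rhs => rw [← sum_cof hz (sharp g α z)]
    simp [Matrix.mulVec, dotProduct, comps, mul_comm]
  have h3 := congrArg (comps g c z)⁻¹.mulVec h2
  rw [Matrix.mulVec_mulVec, Matrix.nonsing_inv_mul _ (isUnit_iff_ne_zero.2 (hg.det_comps hz)),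
    Matrix.one_mulVec] at h3
  exact congrFun h3 i

/-! ### Tensoriality -/

/-- An additive and homogeneous operation on germs of vector fields is computed from its values on
a frame. -/
theorem tensorial_expand {Φ : VField n M → ℝ} {x c : M} (hx : x ∈ dom (n := n) c)
    (hcongr : ∀ Z Z' : VField n M, VecAt Z' x → Z =ᶠ[𝓝 x] Z' → Φ Z = Φ Z')
    (hadd : ∀ Z Z', VecAt Z x → VecAt Z' x → Φ (Z + Z') = Φ Z + Φ Z')
    (hsmul : ∀ (f : M → ℝ) (Z : VField n M), FunAt n f x → VecAt Z x → Φ (f • Z) = f x * Φ Z)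
    {Z : VField n M} (hZ : VecAt Z x) :
    Φ Z = ∑ i, cof c i x (Z x) * Φ (frame c i) := by
  classical
  have hs (i : Fin n) : VecAt ((fun y => cof c i y (Z y)) • frame c i) x :=
    VecAt.smul (hZ.cof i hx) (VecAt.frame c i hx)
  have hsum (s : Finset (Fin n)) : VecAt (∑ i ∈ s, (fun y => cof c i y (Z y)) • frame c i) x ∧
      Φ (∑ i ∈ s, (fun y => cof c i y (Z y)) • frame c i)
        = ∑ i ∈ s, cof c i x (Z x) * Φ (frame c i) := by
    induction s using Finset.induction_on with
    | empty =>
      refine ⟨by simpa using VecAt.zero x, ?_⟩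
      have := hsmul 0 0 contMDiffAt_const (VecAt.zero x)
      simpa using this
    | insert i s hi ih =>
      rw [Finset.sum_insert hi, Finset.sum_insert hi]
      exact ⟨(hs i).add ih.1, by
        rw [hadd _ _ (hs i) ih.1, ih.2, hsmul _ _ (hZ.cof i hx) (VecAt.frame c i hx)]⟩
  rw [← (hsum Finset.univ).2]
  refine hcongr _ _ (hsum Finset.univ).1 ?_
  filter_upwards [(isOpen_dom (n := n) c).mem_nhds hx] with y hy
  simp only [Finset.sum_apply, Pi.smul_apply']
  exact (sum_cof hy (Z y)).symm

/-- `covectorAt` samples Φ on the frame centred at x only; tensoriality extends the formula to every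
smooth field. -/
theorem covectorAt_apply {Φ : VField n M → ℝ} {x : M}
    (hcongr : ∀ Z Z' : VField n M, VecAt Z' x → Z =ᶠ[𝓝 x] Z' → Φ Z = Φ Z')
    (hadd : ∀ Z Z', VecAt Z x → VecAt Z' x → Φ (Z + Z') = Φ Z + Φ Z')
    (hsmul : ∀ (f : M → ℝ) (Z : VField n M), FunAt n f x → VecAt Z x → Φ (f • Z) = f x * Φ Z)
    {Z : VField n M} (hZ : VecAt Z x) : covectorAt x Φ (Z x) = Φ Z := by
  rw [tensorial_expand (mem_dom x) hcongr hadd hsmul hZ]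
  simp [covectorAt, coframe_eq_cof, mul_comm]

theorem bilinAt_apply (Φ : VField n M → VField n M → ℝ) (x : M) (u v : TangentSpace (𝓡 n) x) :
    bilinAt x Φ u v = ∑ i, ∑ j, Φ (frame x i) (frame x j) * (cof x i x u * cof x j x v) := by
  simp [bilinAt, coframe_eq_cof]

theorem mlieBracket_congr_right (X : VField n M) {Z Z' : VField n M} {x : M} (h : Z =ᶠ[𝓝 x] Z') :
    mlieBracket (𝓡 n) X Z x = mlieBracket (𝓡 n) X Z' x :=
  Filter.EventuallyEq.mlieBracket_vectorField_eq EventuallyEq.rfl h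

theorem lieForm_apply {ξ X : VField n M} {α : OneForm n M} {x : M}
    (hα : FormAt α x) (hX : VecAt X x) : lieForm ξ α x (X x)
      = lieFun ξ (fun y => α y (X y)) x - α x (mlieBracket (𝓡 n) ξ X x) := by
  refine covectorAt_apply (Φ := fun X => lieFun ξ (fun y => α y (X y)) x
    - α x (mlieBracket (𝓡 n) ξ X x)) (fun Z Z' _ h => ?_) (fun Z Z' hZ hZ' => ?_)
    (fun f Z hf hZ => ?_) hX
  · rw [lieFun_congr rfl (h.mono fun y hy => by rw [hy]),
      mlieBracket_congr_right ξ h]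
  · have := lieFun_add ξ (hα.apply hZ) (hα.apply hZ')
    rw [mlieBracket_add_right hZ.mdiff hZ'.mdiff, map_add]
    have h2 : (fun y => α y ((Z + Z') y)) = (fun y => α y (Z y)) + fun y => α y (Z' y) := by
      ext; simp
    rw [h2, this]
    ring
  · have := lieFun_mul ξ hf (hα.apply hZ)
    rw [mlieBracket_smul_right hf.mdiff hZ.mdiff, map_add]
    have h2 : (fun y => α y ((f • Z) y)) = f * fun y => α y (Z y) := by
      ext; simp
    rw [h2, this]
    simp [lieFun]
    ring

/-- The derivative of a factor f in X or Y cancels against the bracket term, so the expression is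
tensorial in each slot and is determined by the frame values used in the definition. -/
theorem lieBilin_apply {ξ X Y : VField n M} {B : BilinField n M} {x : M}
    (hB : BilinAt B x) (hX : VecAt X x) (hY : VecAt Y x) : lieBilin ξ B x (X x) (Y x)
      = lieFun ξ (fun y => B y (X y) (Y y)) x - B x (mlieBracket (𝓡 n) ξ X x) (Y x)
        - B x (X x) (mlieBracket (𝓡 n) ξ Y x) := by
  set Φ : VField n M → VField n M → ℝ := fun X Y => lieFun ξ (fun y => B y (X y) (Y y)) x
    - B x (mlieBracket (𝓡 n) ξ X x) (Y x) - B x (X x) (mlieBracket (𝓡 n) ξ Y x) with hΦ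
  have e1 {Y : VField n M} (hY : VecAt Y x) {X : VField n M} (hX : VecAt X x) :
      Φ X Y = ∑ i, cof x i x (X x) * Φ (frame x i) Y := by
    refine tensorial_expand (Φ := fun X => Φ X Y) (mem_dom x) (fun Z Z' _ h => ?_)
      (fun Z Z' hZ hZ' => ?_) (fun f Z hf hZ => ?_) hX
    · simp only [hΦ]
      rw [lieFun_congr rfl (h.mono fun y hy => by rw [hy]),
        mlieBracket_congr_right ξ h, h.self_of_nhds]
    · have := lieFun_add ξ (hB.apply hZ hY) (hB.apply hZ' hY)
      simp only [hΦ]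
      rw [mlieBracket_add_right hZ.mdiff hZ'.mdiff, map_add]
      have h2 : (fun y => B y ((Z + Z') y) (Y y))
          = (fun y => B y (Z y) (Y y)) + fun y => B y (Z' y) (Y y) := by
        ext; simp
      rw [h2, this]
      simp
      ring
    · have := lieFun_mul ξ hf (hB.apply hZ hY)
      simp only [hΦ]
      rw [mlieBracket_smul_right hf.mdiff hZ.mdiff, map_add]
      have h2 : (fun y => B y ((f • Z) y) (Y y)) = f * fun y => B y (Z y) (Y y) := by
        ext; simp
      rw [h2, this]
      simp [lieFun]
      ring
  have e2 {X : VField n M} (hX : VecAt X x) {Y : VField n M} (hY : VecAt Y x) :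
      Φ X Y = ∑ i, cof x i x (Y x) * Φ X (frame x i) := by
    refine tensorial_expand (Φ := fun Y => Φ X Y) (mem_dom x) (fun Z Z' _ h => ?_)
      (fun Z Z' hZ hZ' => ?_) (fun f Z hf hZ => ?_) hY
    · simp only [hΦ]
      rw [lieFun_congr rfl (h.mono fun y hy => by rw [hy]),
        mlieBracket_congr_right ξ h, h.self_of_nhds]
    · have := lieFun_add ξ (hB.apply hX hZ) (hB.apply hX hZ')
      simp only [hΦ]
      rw [mlieBracket_add_right hZ.mdiff hZ'.mdiff, map_add]
      have h2 : (fun y => B y (X y) ((Z + Z') y))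
          = (fun y => B y (X y) (Z y)) + fun y => B y (X y) (Z' y) := by
        ext; simp
      rw [h2, this]
      simp
      ring
    · have := lieFun_mul ξ hf (hB.apply hX hZ)
      simp only [hΦ]
      rw [mlieBracket_smul_right hf.mdiff hZ.mdiff, map_add]
      have h2 : (fun y => B y (X y) ((f • Z) y)) = f * fun y => B y (X y) (Z y) := by
        ext; simp
      rw [h2, this]
      simp [lieFun]
      ring
  change bilinAt x Φ (X x) (Y x) = Φ X Y
  rw [bilinAt_apply, e1 hY hX]
  refine Finset.sum_congr rfl fun i _ => ?_
  rw [e2 (VecAt.frame x i (mem_dom x)) hY, Finset.mul_sum]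
  refine Finset.sum_congr rfl fun j _ => ?_
  ring

end

/-! ### The Levi-Civita connection of a metric as an instance of the algebraic one. -/

section

open Filter Topology Bundle VectorField TopologicalSpace

variable {n : ℕ} {M : Type*} [TopologicalSpace M] [ChartedSpace (EuclideanSpace ℝ (Fin n)) M]
  [IsManifold (𝓡 n) ∞ M]

/-! ### The Levi-Civita connection -/

theorem koszul_congr (g : BilinField n M) {X X' Y Y' Z Z' : VField n M} {x : M}
    (hX : X =ᶠ[𝓝 x] X') (hY : Y =ᶠ[𝓝 x] Y') (hZ : Z =ᶠ[𝓝 x] Z') :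
    koszul g X Y Z x = koszul g X' Y' Z' x := by
  have h1 {A A' B B' : VField n M} (hA : A =ᶠ[𝓝 x] A') (hB : B =ᶠ[𝓝 x] B') :
      (fun y => g y (A y) (B y)) =ᶠ[𝓝 x] fun y => g y (A' y) (B' y) := by
    filter_upwards [hA, hB] with y h h'
    rw [h, h']
  have h2 {A A' B B' : VField n M} (hA : A =ᶠ[𝓝 x] A') (hB : B =ᶠ[𝓝 x] B') :
      mlieBracket (𝓡 n) A B x = mlieBracket (𝓡 n) A' B' x :=
    Filter.EventuallyEq.mlieBracket_vectorField_eq hA hB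
  rw [koszul, koszul, lieFun_congr hX.self_of_nhds (h1 hY hZ),
    lieFun_congr hY.self_of_nhds (h1 hX hZ), lieFun_congr hZ.self_of_nhds (h1 hX hY), h2 hX hY,
    h2 hX hZ, h2 hY hZ, hX.self_of_nhds, hY.self_of_nhds, hZ.self_of_nhds]

theorem FunAt.koszul {g : BilinField n M} {X Y Z : VField n M} {x : M} (hg : BilinAt g x)
    (hX : VecAt X x) (hY : VecAt Y x) (hZ : VecAt Z x) : FunAt n (koszul g X Y Z) x := by
  have h1 := FunAt.lieFun hX (hg.apply hY hZ)
  have h2 := FunAt.lieFun hY (hg.apply hX hZ)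
  have h3 := FunAt.lieFun hZ (hg.apply hX hY)
  have h4 := hg.apply (hX.bracket hY) hZ
  have h5 := hg.apply (hX.bracket hZ) hY
  have h6 := hg.apply (hY.bracket hZ) hX
  exact contMDiffAt_const.mul (((((h1.add h2).sub h3).add h4).sub h5).sub h6)

theorem lieFun_smul_left (f : M → ℝ) (X : VField n M) (F : M → ℝ) (x : M) :
    lieFun (f • X) F x = f x * lieFun X F x := by
  simp [lieFun]

theorem lieFun_add_left (X Y : VField n M) (F : M → ℝ) (x : M) :
    lieFun (X + Y) F x = lieFun X F x + lieFun Y F x := by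
  simp [lieFun]

theorem metric_covectorAt_koszul {g : BilinField n M} (hg : IsMetric g) {X Y Z : VField n M}
    {x : M} (hX : VecAt X x) (hY : VecAt Y x) (hZ : VecAt Z x) :
    covectorAt x (fun Z => koszul g X Y Z x) (Z x) = koszul g X Y Z x := by
  have hB := hg.at x
  refine covectorAt_apply (Φ := fun Z => koszul g X Y Z x)
    (fun Z Z' _ h => koszul_congr g EventuallyEq.rfl EventuallyEq.rfl h) (fun Z Z' hZ hZ' => ?_)
    (fun f Z hf hZ => ?_) hZ
  · have h1 (W : VField n M) : (fun y => g y (W y) ((Z + Z') y))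
        = (fun y => g y (W y) (Z y)) + fun y => g y (W y) (Z' y) := by
      ext; simp
    simp only [koszul, h1]
    rw [lieFun_add X (hB.apply hY hZ) (hB.apply hY hZ'),
      lieFun_add Y (hB.apply hX hZ) (hB.apply hX hZ'), lieFun_add_left,
      mlieBracket_add_right hZ.mdiff hZ'.mdiff, mlieBracket_add_right hZ.mdiff hZ'.mdiff]
    simp
    ring
  · have h1 (W : VField n M) : (fun y => g y (W y) ((f • Z) y))
        = f * fun y => g y (W y) (Z y) := by
      ext; simp
    have h2 (W : VField n M) : mvfderiv (𝓡 n) f x (W x) = lieFun W f x := rfl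
    simp only [koszul, h1]
    rw [lieFun_mul X hf (hB.apply hY hZ), lieFun_mul Y hf (hB.apply hX hZ), lieFun_smul_left,
      mlieBracket_smul_right hf.mdiff hZ.mdiff, mlieBracket_smul_right hf.mdiff hZ.mdiff, h2, h2]
    simp only [map_add, map_smul, add_apply, smul_apply, smul_eq_mul, Pi.smul_apply']
    rw [hg.symm x (Y x), hg.symm x (X x) (Z x)]
    ring

/-- Koszul's formula. -/
theorem metric_nabla {g : BilinField n M} (hg : IsMetric g) {X Y Z : VField n M}
    {x : M} (hX : VecAt X x) (hY : VecAt Y x) (hZ : VecAt Z x) :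
    g x (nabla g X Y x) (Z x) = koszul g X Y Z x := by
  rw [nabla, hg.apply_sharp, metric_covectorAt_koszul hg hX hY hZ]

variable {U : Opens M}

theorem nabla_congr (g : BilinField n M) {X X' Y Y' : VField n M} {x : M}
    (hX : X =ᶠ[𝓝 x] X') (hY : Y =ᶠ[𝓝 x] Y') : nabla g X Y x = nabla g X' Y' x := by
  have : (fun Z => koszul g X Y Z x) = fun Z => koszul g X' Y' Z x :=
    funext fun Z => koszul_congr g hX hY EventuallyEq.rfl
  rw [nabla, nabla, sharp, sharp, this]

/-- Smoothness of X and Y on an open set allows Koszul's formula to be used at all points near x,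
which identifies the components of ∇_X Y there. -/
theorem vecAt_nabla {g : BilinField n M} (hg : IsMetric g) {X Y : VField n M}
    (hX : ∀ y ∈ U, VecAt X y) (hY : ∀ y ∈ U, VecAt Y y) {x : M} (hx : x ∈ U) :
    VecAt (nabla g X Y) x := by
  refine hg.vecAt_sharp (mem_dom x) fun i => ?_
  refine (FunAt.koszul (hg.at x) (hX x hx) (hY x hx)
    (VecAt.frame x i (mem_dom x))).congr_of_eventuallyEq ?_
  filter_upwards [U.2.mem_nhds hx, (isOpen_dom (n := n) x).mem_nhds (mem_dom x)] with y hy hy'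
  exact metric_covectorAt_koszul hg (hX y hy) (hY y hy) (VecAt.frame x i hy')

/-! ### The metric, the connection and the frames as algebraic objects -/

/-- A smooth 2-covariant tensor field as a bilinear form on the smooth vector fields on `U`. -/
def toForm (U : Opens M) {B : BilinField n M} (hB : ∀ x, BilinAt B x) :
    Vec n U →ₗ[Fun n U] Vec n U →ₗ[Fun n U] Fun n U :=
  LinearMap.mk₂ _
    (fun X Y => Fun.of (fun y => B y (X.rep y) (Y.rep y)) fun y hy =>
      (hB y).apply (X.smooth hy) (Y.smooth hy))
    (fun X X' Y => Fun.ext fun y hy => by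
      simp only [Fun.rep_of _ hy, Fun.rep_add hy, Vec.rep_add _ _ hy, map_add, add_apply])
    (fun f X Y => Fun.ext fun y hy => by
      simp only [Fun.rep_of _ hy, smul_eq_mul, Fun.rep_mul hy, Vec.rep_smul _ _ hy, map_smul,
        smul_apply])
    (fun X X' Y => Fun.ext fun y hy => by
      simp only [Fun.rep_of _ hy, Fun.rep_add hy, Vec.rep_add _ _ hy, map_add])
    (fun f X Y => Fun.ext fun y hy => by
      simp only [Fun.rep_of _ hy, smul_eq_mul, Fun.rep_mul hy, Vec.rep_smul _ _ hy, map_smul])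

theorem rep_toForm {B : BilinField n M} (hB : ∀ x, BilinAt B x) (X Y : Vec n U) {y : M}
    (hy : y ∈ U) : (toForm U hB X Y).rep y = B y (X.rep y) (Y.rep y) := by
  rw [toForm, LinearMap.mk₂_apply, Fun.rep_of _ hy]

/-- The Levi-Civita connection on the smooth vector fields on `U`. -/
def toConn (U : Opens M) {g : BilinField n M} (hg : IsMetric g) (X Y : Vec n U) : Vec n U :=
  Vec.of (nabla g X.rep Y.rep) fun _ hy =>
    vecAt_nabla hg (fun _ h => X.smooth h) (fun _ h => Y.smooth h) hy

theorem rep_toConn {g : BilinField n M} (hg : IsMetric g) (X Y : Vec n U) {y : M}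
    (hy : y ∈ U) : (toConn U hg X Y).rep y = nabla g X.rep Y.rep y := Vec.rep_of _ hy

/-- The restriction of a coordinate vector field to `U`. -/
def frm {U : Opens M} {c : M} (hU : ∀ y ∈ U, y ∈ dom (n := n) c) (i : Fin n) : Vec n U :=
  Vec.of (frame c i) fun y hy => VecAt.frame c i (hU y hy)

theorem rep_frm {c : M} (hU : ∀ y ∈ U, y ∈ dom (n := n) c) (i : Fin n) {y : M} (hy : y ∈ U) :
    (frm hU i).rep y = frame c i y := Vec.rep_of _ hy

theorem continuous_of_linear {y : M} (φ : TangentSpace (𝓡 n) y →ₗ[ℝ] ℝ) : Continuous φ := by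
  have h (ψ : EuclideanSpace ℝ (Fin n) →ₗ[ℝ] ℝ) : Continuous ψ := ψ.continuous_of_finiteDimensional
  exact h φ

/-- The coordinate 1-form `dxⁱ` as a field of continuous linear forms. -/
def cofL (c : M) (i : Fin n) : OneForm n M := fun y =>
  ⟨cof c i y, continuous_of_linear _⟩

/-- The gradient of a coordinate. -/
def grad (g : BilinField n M) (c : M) (i : Fin n) : VField n M := sharp g (cofL c i)

theorem metric_grad {g : BilinField n M} (hg : IsMetric g) (c : M) (i : Fin n) (y : M)
    (v : TangentSpace (𝓡 n) y) : g y (grad g c i y) v = cof c i y v := by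
  rw [grad, hg.apply_sharp]
  rfl

theorem vecAt_grad {g : BilinField n M} (hg : IsMetric g) {c : M} (i : Fin n) {y : M}
    (hy : y ∈ dom (n := n) c) : VecAt (grad g c i) y :=
  hg.vecAt_sharp hy fun j => (VecAt.frame c j hy).cof i hy

/-- The restriction of the gradient of a coordinate to `U`. -/
def cofrm {U : Opens M} {g : BilinField n M} (hg : IsMetric g) {c : M}
    (hU : ∀ y ∈ U, y ∈ dom (n := n) c) (i : Fin n) : Vec n U :=
  Vec.of (grad g c i) fun y hy => vecAt_grad hg i (hU y hy)

theorem rep_cofrm {g : BilinField n M} (hg : IsMetric g) {c : M}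
    (hU : ∀ y ∈ U, y ∈ dom (n := n) c) (i : Fin n) {y : M} (hy : y ∈ U) :
    (cofrm hg hU i).rep y = grad g c i y := Vec.rep_of _ hy

theorem rep_toForm_cofrm {g : BilinField n M} (hg : IsMetric g) {c : M}
    (hU : ∀ y ∈ U, y ∈ dom (n := n) c) (i : Fin n) (X : Vec n U) {y : M} (hy : y ∈ U) :
    (toForm U hg.at (cofrm hg hU i) X).rep y = cof c i y (X.rep y) := by
  rw [rep_toForm _ _ _ hy, rep_cofrm _ _ _ hy, metric_grad hg]

theorem isFrame {g : BilinField n M} (hg : IsMetric g) {c : M}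
    (hU : ∀ y ∈ U, y ∈ dom (n := n) c) :
    Algebraic.IsFrame (toForm U hg.at) (frm hU) (cofrm hg hU) where
  dual j k := Fun.ext fun y hy => by
    rw [rep_toForm_cofrm hg hU j _ hy, rep_frm _ _ hy, cof_frame (hU y hy)]
    split_ifs
    · rw [Fun.rep_one hy]
    · rw [Fun.rep_zero hy]
  expand X := Vec.ext fun y hy => by
    rw [Vec.rep_sum _ _ hy]
    refine Eq.trans (Finset.sum_congr rfl fun i _ => ?_) (sum_cof (hU y hy) (X.rep y))
    rw [Vec.rep_smul _ _ hy, rep_toForm_cofrm hg hU i _ hy, rep_frm _ _ hy]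

/-- Nondegeneracy over the ring of functions is tested against coordinate gradients, available
because U lies in one chart domain. -/
theorem isLeviCivita {g : BilinField n M} (hg : IsMetric g) {c : M}
    (hU : ∀ y ∈ U, y ∈ dom (n := n) c) :
    Algebraic.IsLeviCivita (toForm U hg.at) (toConn U hg) where
  two_cancel a b h := Fun.ext fun y hy => by
    have := congrArg (fun f : Fun n U => f.rep y) h
    simp only [Fun.rep_mul hy, Fun.rep_ofNat hy] at this
    linarith
  symm X Y := Fun.ext fun y hy => by
    rw [rep_toForm _ _ _ hy, rep_toForm _ _ _ hy, hg.symm]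
  nondeg X h := Vec.ext fun y hy => by
    rw [Vec.rep_zero hy]
    refine ext_cof (hU y hy) fun i => ?_
    rw [← rep_toForm_cofrm hg hU i _ hy, rep_toForm _ _ _ hy, hg.symm, ← rep_toForm hg.at _ _ hy, h,
      Fun.rep_zero hy, map_zero]
  koszul X Y Z := Fun.ext fun y hy => by
    have key (A B : Vec n U) : (toForm U hg.at A B).rep =ᶠ[𝓝 y]
        fun z => g z (A.rep z) (B.rep z) :=
      eventuallyEq_of_open (fun z hz => rep_toForm hg.at A B hz) hy
    simp only [Fun.rep_add hy, Fun.rep_sub hy, Fun.rep_mul hy, Fun.rep_ofNat hy,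
      Vec.rep_lie_fun _ _ hy, lieFun_congr rfl (key _ _), rep_toForm _ _ _ hy, Vec.rep_lie _ _ hy,
      rep_toConn _ _ _ hy, metric_nabla hg (X.smooth hy) (Y.smooth hy) (Z.smooth hy)]
    rw [KerrSchild.koszul]
    ring

end

/-! ### Frame independence, and the curvature quantities in a fixed chart. -/

section

open Filter Topology Bundle VectorField TopologicalSpace

namespace Algebraic

variable {A V ι ι' : Type*} [CommRing A] [LieRing V] [Module A V] [LieRingModule V A]
  [LieRinehartRing A V] [Fintype ι] [DecidableEq ι] [Fintype ι'] [DecidableEq ι']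
  {G : V →ₗ[A] V →ₗ[A] A} {nab : V → V → V} {e f : ι → V} {e' f' : ι' → V}

/-- Puts traces in the form g^{ij} β(eᵢ, eⱼ), in which the statement writes the scalar curvature and
the box operator. -/
theorem IsFrame.mtr_expand (F : IsFrame G e f) {β : V → V → A} (hβ : Bilin β) :
    mtr e f β = ∑ i, ∑ j, G (f i) (f j) * β (e i) (e j) := by
  rw [Finset.sum_comm]
  refine Finset.sum_congr rfl fun j _ => ?_
  conv_lhs => rw [← F.expand (f j), hβ.sum_left]

variable (F : IsFrame G e f) (F' : IsFrame G e' f') (H : IsLeviCivita G nab)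
include F F' H

theorem dvg_eq (L : V) : dvg G nab e f L = dvg G nab e' f' L := F.mtr_eq_mtr H F' (H.bilin_dvg L)

theorem ric_eq : ric G nab e f = ric G nab e' f' :=
  funext fun Y => funext fun Z => F.mtr_eq_mtr H F' (H.bilin_ric Y Z)

theorem num_eq (L X Y : V) : num G nab e f L X Y = num G nab e' f' L X Y := by
  have : scal G nab e f = scal G nab e' f' := by
    rw [scal, scal, ric_eq F F' H]
    exact F.mtr_eq_mtr H F' H.ric_bilin
  rw [num, num, ric_eq F F' H, this]

theorem del_eq (L : V) (κ : A) : del G nab e f L κ = del G nab e' f' L κ := by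
  have : gradSq G nab e f L = gradSq G nab e' f' L := F.mtr_eq_mtr H F' (H.bilin_gradSq L)
  rw [del, del, dvg_eq F F' H, ric_eq F F' H, this]

omit F F' H in
theorem bilin_num (H : IsLeviCivita G nab) (L : V) : Bilin (num G nab e f L) := by
  have h := H.ric_bilin (e := e) (f := f)
  constructor <;> intros <;>
    simp only [num, map_add, map_smul, LinearMap.add_apply, LinearMap.smul_apply, h.add_left,
      h.smul_left, H.Rm_add₁, H.Rm_smul₁, smul_eq_mul] <;> ring

omit F F' in
theorem num_symm (L X Y : V) : num G nab e f L X Y = num G nab e f L Y X := by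
  rw [num, num, H.Rm_lie_symm L X Y]
  ring

-- Differentiating G(L, ∇_Y L) = 0; it converts the second-order term ℓ(□L) of Δ into a first-order
-- one.
omit F F' in
theorem IsNullGeodesic.metric_self_nab_nab {L : V} {κ : A} (N : IsNullGeodesic G nab L κ) (X Y : V) :
    G L (nab X (nab Y L)) = -G (nab X L) (nab Y L) := by
  have := H.metric X L (nab Y L)
  rw [N.metric_self_nab H, lie_zero] at this
  linear_combination -this

end Algebraic

variable {n : ℕ} {M : Type*} [TopologicalSpace M] [ChartedSpace (EuclideanSpace ℝ (Fin n)) M]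
  [IsManifold (𝓡 n) ∞ M] {U : Opens M}

/-! ### Representatives -/

/-- The function `F` restricts to `f`. -/
def Fun.Is (f : Fun n U) (F : M → ℝ) : Prop := ∀ y ∈ U, f.rep y = F y

/-- The vector field `F` restricts to `X`. -/
def Vec.Is (X : Vec n U) (F : VField n M) : Prop := ∀ y ∈ U, X.rep y = F y

namespace Fun.Is

variable {f f' : Fun n U} {F F' : M → ℝ}

theorem add (h : f.Is F) (h' : f'.Is F') : (f + f').Is (F + F') := fun y hy => by
  rw [Fun.rep_add hy, h y hy, h' y hy]; rfl

theorem sub (h : f.Is F) (h' : f'.Is F') : (f - f').Is (F - F') := fun y hy => by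
  rw [Fun.rep_sub hy, h y hy, h' y hy]; rfl

theorem neg (h : f.Is F) : (-f).Is (-F) := fun y hy => by
  rw [Fun.rep_neg hy, h y hy]; rfl

theorem mul (h : f.Is F) (h' : f'.Is F') : (f * f').Is (F * F') := fun y hy => by
  rw [Fun.rep_mul hy, h y hy, h' y hy]; rfl

theorem sum {ι : Type*} {s : Finset ι} {f : ι → Fun n U} {F : ι → M → ℝ}
    (h : ∀ i ∈ s, (f i).Is (F i)) : (∑ i ∈ s, f i).Is fun y => ∑ i ∈ s, F i y := fun y hy => by
  rw [Fun.rep_sum hy]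
  exact Finset.sum_congr rfl fun i hi => h i hi y hy

theorem ofNat (k : ℕ) [k.AtLeastTwo] : (OfNat.ofNat k : Fun n U).Is fun _ => OfNat.ofNat k :=
  fun _ hy => Fun.rep_ofNat hy k

theorem of {F : M → ℝ} (hF : ∀ y ∈ U, FunAt n F y) : (Fun.of F hF).Is F := fun _ hy =>
  Fun.rep_of hF hy

theorem lie {X : Vec n U} {Y : VField n M} (hX : X.Is Y) (h : f.Is F) : ⁅X, f⁆.Is (lieFun Y F) :=
  fun y hy => by
    rw [Vec.rep_lie_fun _ _ hy]
    exact lieFun_congr (hX y hy) (eventuallyEq_of_open h hy)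

theorem toForm {B : BilinField n M} (hB : ∀ x, BilinAt B x) {X Y : Vec n U} {X' Y' : VField n M}
    (hX : X.Is X') (hY : Y.Is Y') : (toForm U hB X Y).Is fun y => B y (X' y) (Y' y) :=
  fun y hy => by rw [rep_toForm _ _ _ hy, hX y hy, hY y hy]

theorem toForm_cofrm {g : BilinField n M} (hg : IsMetric g) {c : M}
    (hU : ∀ y ∈ U, y ∈ dom (n := n) c) (i : Fin n) {X : Vec n U} {X' : VField n M}
    (hX : X.Is X') : (KerrSchild.toForm U hg.at (cofrm hg hU i) X).Is
      fun y => cof c i y (X' y) := fun y hy => by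
  rw [rep_toForm_cofrm _ _ _ _ hy, hX y hy]

end Fun.Is

namespace Vec.Is

variable {X Y Z : Vec n U} {X' Y' Z' : VField n M}

theorem of {F : VField n M} (hF : ∀ y ∈ U, VecAt F y) : (Vec.of F hF).Is F := fun _ hy =>
  Vec.rep_of hF hy

theorem rep (X : Vec n U) : X.Is X.rep := fun _ _ => rfl

theorem frm {c : M} (hU : ∀ y ∈ U, y ∈ dom (n := n) c) (i : Fin n) : (frm hU i).Is (frame c i) :=
  fun _ hy => rep_frm hU i hy

theorem cofrm {g : BilinField n M} (hg : IsMetric g) {c : M}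
    (hU : ∀ y ∈ U, y ∈ dom (n := n) c) (i : Fin n) : (cofrm hg hU i).Is (grad g c i) :=
  fun _ hy => rep_cofrm hg hU i hy

theorem lie (hX : X.Is X') (hY : Y.Is Y') : ⁅X, Y⁆.Is (mlieBracket (𝓡 n) X' Y') := fun y hy => by
  rw [Vec.rep_lie _ _ hy]
  exact Vec.mlieBracket_congr hX hY hy

theorem sub (hX : X.Is X') (hY : Y.Is Y') : (X - Y).Is (X' - Y') := fun y hy => by
  rw [Vec.rep_sub _ _ hy, hX y hy, hY y hy]; rfl

theorem conn {g : BilinField n M} (hg : IsMetric g) (hX : X.Is X') (hY : Y.Is Y') :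
    (toConn U hg X Y).Is (nabla g X' Y') := fun y hy => by
  rw [rep_toConn _ _ _ hy]
  exact nabla_congr g (eventuallyEq_of_open' hX hy) (eventuallyEq_of_open' hY hy)

theorem curv {g : BilinField n M} (hg : IsMetric g) (hX : X.Is X') (hY : Y.Is Y') (hZ : Z.Is Z') :
    (Algebraic.Rm (toConn U hg) X Y Z).Is (curvature g X' Y' Z') :=
  ((hX.conn hg (hY.conn hg hZ)).sub (hY.conn hg (hX.conn hg hZ))).sub ((hX.lie hY).conn hg hZ)

end Vec.Is

/-! ### Traces in the frame of an arbitrary chart -/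

/-- The divergence, computed in the frame of the chart around `c`. -/
def dvgC (c : M) (g : BilinField n M) (X : VField n M) (y : M) : ℝ :=
  ∑ k, cof c k y (nabla g (frame c k) X y)

/-- The Ricci form, computed in the frame of the chart around `c`. -/
def ricC (c : M) (g : BilinField n M) (Y Z : VField n M) (y : M) : ℝ :=
  ∑ k, cof c k y (curvature g (frame c k) Z Y y)

/-- The scalar curvature, computed in the frame of the chart around `c`. -/
def scalC (c : M) (g : BilinField n M) (y : M) : ℝ :=
  ∑ i, ∑ j, g y (grad g c i y) (grad g c j y) * ricC c g (frame c i) (frame c j) y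

/-- The square of the covariant derivative, computed in the frame of the chart around `c`. -/
def gradSqC (c : M) (g : BilinField n M) (X : VField n M) (y : M) : ℝ :=
  ∑ i, ∑ j, g y (grad g c i y) (grad g c j y)
    * g y (nabla g (frame c i) X y) (nabla g (frame c j) X y)

/-- The scalar `Δ`, computed in the frame of the chart around `c`. -/
def delC (c : M) (g : BilinField n M) (L : VField n M) (κ : M → ℝ) (y : M) : ℝ :=
  -lieFun L (dvgC c g L) y + dvgC c g L y ^ 2 - 3 * ricC c g L L y - 2 * gradSqC c g L y
    + lieFun L κ y - κ y * dvgC c g L y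

/-- The numerator of `T`, computed in the frame of the chart around `c`. -/
def numC (c : M) (g : BilinField n M) (L X Y : VField n M) (y : M) : ℝ :=
  2 * (g y (X y) (curvature g Y L L y) + ricC c g X L y * g y (L y) (Y y)
    + ricC c g Y L y * g y (L y) (X y)) - scalC c g y * (g y (L y) (X y) * g y (L y) (Y y))

section

variable {g : BilinField n M} (hg : IsMetric g) {c : M} (hU : ∀ y ∈ U, y ∈ dom (n := n) c)
  {L X Y : Vec n U} {L' X' Y' : VField n M} {κ : Fun n U} {κ' : M → ℝ}

theorem is_dvg (hX : X.Is X') :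
    (Algebraic.dvg (toForm U hg.at) (toConn U hg) (frm hU) (cofrm hg hU) X).Is (dvgC c g X') :=
  Fun.Is.sum fun i _ => Fun.Is.toForm_cofrm hg hU i ((Vec.Is.frm hU i).conn hg hX)

theorem is_ric (hX : X.Is X') (hY : Y.Is Y') :
    (Algebraic.ric (toForm U hg.at) (toConn U hg) (frm hU) (cofrm hg hU) X Y).Is
      (ricC c g X' Y') :=
  Fun.Is.sum fun i _ => Fun.Is.toForm_cofrm hg hU i ((Vec.Is.frm hU i).curv hg hY hX)

theorem is_scal :
    (Algebraic.scal (toForm U hg.at) (toConn U hg) (frm hU) (cofrm hg hU)).Is (scalC c g) := by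
  rw [Algebraic.scal, (isFrame hg hU).mtr_expand (isLeviCivita hg hU).ric_bilin]
  exact Fun.Is.sum fun i _ => Fun.Is.sum fun j _ => (Fun.Is.toForm hg.at (Vec.Is.cofrm hg hU i)
    (Vec.Is.cofrm hg hU j)).mul (is_ric hg hU (Vec.Is.frm hU i) (Vec.Is.frm hU j))

theorem is_gradSq (hX : X.Is X') :
    (Algebraic.gradSq (toForm U hg.at) (toConn U hg) (frm hU) (cofrm hg hU) X).Is
      (gradSqC c g X') := by
  rw [Algebraic.gradSq, (isFrame hg hU).mtr_expand ((isLeviCivita hg hU).bilin_gradSq X)]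
  exact Fun.Is.sum fun i _ => Fun.Is.sum fun j _ => (Fun.Is.toForm hg.at (Vec.Is.cofrm hg hU i)
    (Vec.Is.cofrm hg hU j)).mul (Fun.Is.toForm hg.at ((Vec.Is.frm hU i).conn hg hX)
      ((Vec.Is.frm hU j).conn hg hX))

theorem is_del (hL : L.Is L') (hκ : κ.Is κ') :
    (Algebraic.del (toForm U hg.at) (toConn U hg) (frm hU) (cofrm hg hU) L κ).Is
      (delC c g L' κ') := by
  have hd := is_dvg hg hU hL
  have h2 := hd.mul hd
  rw [← pow_two] at h2
  intro y hy
  have := ((((((hd.lie hL).neg.add h2).sub ((Fun.Is.ofNat 3).mul (is_ric hg hU hL hL))).sub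
    ((Fun.Is.ofNat 2).mul (is_gradSq hg hU hL))).add (hκ.lie hL)).sub (hκ.mul hd)) y hy
  rw [Algebraic.del, this, delC, pow_two]
  rfl

theorem is_num (hL : L.Is L') (hX : X.Is X') (hY : Y.Is Y') :
    (Algebraic.num (toForm U hg.at) (toConn U hg) (frm hU) (cofrm hg hU) L X Y).Is
      (numC c g L' X' Y') :=
  ((Fun.Is.ofNat 2).mul (((Fun.Is.toForm hg.at hX (hY.curv hg hL hL)).add
    ((is_ric hg hU hX hL).mul (Fun.Is.toForm hg.at hL hY))).add
      ((is_ric hg hU hY hL).mul (Fun.Is.toForm hg.at hL hX)))).sub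
        ((is_scal hg hU).mul ((Fun.Is.toForm hg.at hL hX).mul (Fun.Is.toForm hg.at hL hY)))

end

end

/-! ### Smoothness of Δ and T, and their identification with the algebraic expressions. -/

section

open Filter Topology Bundle VectorField TopologicalSpace

variable {n : ℕ} {M : Type*} [TopologicalSpace M] [ChartedSpace (EuclideanSpace ℝ (Fin n)) M]
  [IsManifold (𝓡 n) ∞ M] {U : Opens M}

/-! ### Smoothness of a bilinear field from its components -/

theorem contMDiffAt_of_apply_basis {Ψ : M → EuclideanSpace ℝ (Fin n) →L[ℝ]
    EuclideanSpace ℝ (Fin n) →L[ℝ] ℝ} {x : M}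
    (h : ∀ i j, FunAt n (fun y => Ψ y (EuclideanSpace.basisFun (Fin n) ℝ i)
      (EuclideanSpace.basisFun (Fin n) ℝ j)) x) :
    ContMDiffAt (𝓡 n) 𝓘(ℝ, EuclideanSpace ℝ (Fin n) →L[ℝ]
      EuclideanSpace ℝ (Fin n) →L[ℝ] ℝ) ∞ Ψ x := by
  have key : Ψ = fun y => ∑ i, ∑ j, Ψ y (EuclideanSpace.basisFun (Fin n) ℝ i)
      (EuclideanSpace.basisFun (Fin n) ℝ j) •
        (EuclideanSpace.proj i : EuclideanSpace ℝ (Fin n) →L[ℝ] ℝ).smulRight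
          (EuclideanSpace.proj j : EuclideanSpace ℝ (Fin n) →L[ℝ] ℝ) := by
    funext y
    refine ContinuousLinearMap.ext fun u => ContinuousLinearMap.ext fun v => ?_
    have hu := (EuclideanSpace.basisFun (Fin n) ℝ).sum_repr u
    have hv := (EuclideanSpace.basisFun (Fin n) ℝ).sum_repr v
    conv_lhs => rw [← hu, ← hv]
    simp only [map_sum, map_smul, sum_apply, smul_apply, smul_eq_mul, Finset.mul_sum,
      ContinuousLinearMap.smulRight_apply]
    rw [Finset.sum_comm]
    refine Finset.sum_congr rfl fun i _ => Finset.sum_congr rfl fun j _ => ?_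
    have hp (k : Fin n) (w : EuclideanSpace ℝ (Fin n)) :
        (EuclideanSpace.proj k : EuclideanSpace ℝ (Fin n) →L[ℝ] ℝ) w = w k := rfl
    simp only [EuclideanSpace.basisFun_repr, hp]
    ring
  rw [key]
  exact ContMDiffAt.sum fun i _ => ContMDiffAt.sum fun j _ =>
    ContMDiffAt.smul (h i j) contMDiffAt_const

/-- In the trivialization, entries on the standard basis are the components on the coordinate frame,
and a form on ℝⁿ is smooth when its entries are. -/
theorem BilinAt.of_frame {B : BilinField n M} {x : M}
    (h : ∀ i j, FunAt n (fun y => B y (frame x i y) (frame x j y)) x) : BilinAt B x := by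
  rw [BilinAt, contMDiffAt_totalSpace]
  refine ⟨contMDiffAt_id, contMDiffAt_of_apply_basis fun i j => ?_⟩
  refine (h i j).congr_of_eventuallyEq ?_
  filter_upwards [(isOpen_dom (n := n) x).mem_nhds (mem_dom x)] with y hy
  have := inCoordinates_apply_eq₂ (𝕜 := ℝ) (F₁ := EuclideanSpace ℝ (Fin n))
    (E₁ := fun x : M => TangentSpace (𝓡 n) x) (F₂ := EuclideanSpace ℝ (Fin n))
    (E₂ := fun x : M => TangentSpace (𝓡 n) x) (F₃ := ℝ) (E₃ := Trivial M ℝ) (x₀ := x) (x := y)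
    (ϕ := B y) (v := EuclideanSpace.basisFun (Fin n) ℝ i)
    (w := EuclideanSpace.basisFun (Fin n) ℝ j) hy hy (Set.mem_univ y)
  refine this.trans ?_
  rw [frame, frame, Trivialization.localFrame_apply_of_mem_baseSet _ _ hy,
    Trivialization.localFrame_apply_of_mem_baseSet _ _ hy]
  simp [Trivialization.basisAt]
  rfl

theorem Fun.Is.funAt {f : Fun n U} {F : M → ℝ} (h : f.Is F) {y : M} (hy : y ∈ U) : FunAt n F y :=
  (f.smooth hy).congr_of_eventuallyEq (eventuallyEq_of_open (fun z hz => (h z hz).symm) hy)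

theorem rep_toForm_is {B : BilinField n M} (hB : ∀ x, BilinAt B x) {X Y : Vec n U}
    {X' Y' : VField n M} (hX : X.Is X') (hY : Y.Is Y') {y : M} (hy : y ∈ U) :
    (toForm U hB X Y).rep y = B y (X' y) (Y' y) := Fun.Is.toForm hB hX hY y hy

/-! ### The null field -/

theorem IsNull.vecAt {g : BilinField n M} (hg : IsMetric g) {l : OneForm n M} (hl : IsNull g l)
    (y : M) : VecAt (sharp g l) y :=
  hg.vecAt_sharp (mem_dom y) fun i => FormAt.apply (hl.smooth y) (VecAt.frame y i (mem_dom y))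

/-- The null field, restricted to `U`. -/
def nullVec (U : Opens M) {g : BilinField n M} (hg : IsMetric g) {l : OneForm n M}
    (hl : IsNull g l) : Vec n U := Vec.of (sharp g l) fun y _ => hl.vecAt hg y

/-- The function `κ`, restricted to `U`. -/
def kapFun (U : Opens M) {g : BilinField n M} {l : OneForm n M} {κ : M → ℝ}
    (hκ : IsGeodesic g l κ) : Fun n U := Fun.of κ fun y _ => hκ.smooth y

theorem is_nullVec {g : BilinField n M} (hg : IsMetric g) {l : OneForm n M}
    (hl : IsNull g l) : (nullVec U hg hl).Is (sharp g l) := Vec.Is.of _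

theorem is_kapFun {g : BilinField n M} {l : OneForm n M} {κ : M → ℝ}
    (hκ : IsGeodesic g l κ) : (kapFun U hκ).Is κ := Fun.Is.of _

section

variable {g : BilinField n M} (hg : IsMetric g) {l : OneForm n M} (hl : IsNull g l) {κ : M → ℝ}
  (hκ : IsGeodesic g l κ)

theorem isNullGeodesic : Algebraic.IsNullGeodesic (toForm U hg.at) (toConn U hg)
    (nullVec U hg hl) (kapFun U hκ) where
  null := Fun.ext fun y hy => by
    rw [rep_toForm_is hg.at (is_nullVec hg hl) (is_nullVec hg hl) hy, hg.apply_sharp, hl.null,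
      Fun.rep_zero hy]
  geodesic := Vec.ext fun y hy => by
    rw [(is_nullVec hg hl).conn hg (is_nullVec hg hl) y hy, Vec.rep_smul _ _ hy, hκ.eq,
      is_nullVec hg hl y hy, is_kapFun hκ y hy]
  faithful a h := Fun.ext fun y hy => by
    have h1 := congrArg (fun X : Vec n U => X.rep y) h
    simp only [Vec.rep_smul _ _ hy, Vec.rep_zero hy, is_nullVec hg hl y hy] at h1
    rw [Fun.rep_zero hy]
    refine (smul_eq_zero.1 h1).resolve_right fun h0 => hl.ne_zero y ?_
    ext v
    rw [← hg.apply_sharp, h0]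
    simp

/-- The domain of the preferred chart around `c`, as an open set. -/
def domO (c : M) : Opens M := ⟨dom (n := n) c, isOpen_dom c⟩

-- The two charts are compared on the intersection of their domains with U, where both coordinate
-- families are frames for the same metric.
include hg in
theorem dvgC_eq {X : VField n M} (hX : ∀ y ∈ U, VecAt X y) {c c' y : M} (hy : y ∈ U)
    (hc : y ∈ dom (n := n) c) (hc' : y ∈ dom (n := n) c') : dvgC c g X y = dvgC c' g X y := by
  have h1 : ∀ z ∈ U ⊓ domO (n := n) c ⊓ domO (n := n) c', z ∈ dom (n := n) c := fun z hz => hz.1.2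
  have h2 : ∀ z ∈ U ⊓ domO (n := n) c ⊓ domO (n := n) c', z ∈ dom (n := n) c' := fun z hz => hz.2
  have hX' := Vec.Is.of (U := U ⊓ domO (n := n) c ⊓ domO (n := n) c') fun z hz => hX z hz.1.1
  rw [← is_dvg hg h1 hX' y ⟨⟨hy, hc⟩, hc'⟩, ← is_dvg hg h2 hX' y ⟨⟨hy, hc⟩, hc'⟩,
    Algebraic.dvg_eq (isFrame hg h1) (isFrame hg h2) (isLeviCivita hg h1)]

include hg hl hκ in
theorem delC_eq {c c' y : M} (hc : y ∈ dom (n := n) c) (hc' : y ∈ dom (n := n) c') :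
    delC c g (sharp g l) κ y = delC c' g (sharp g l) κ y := by
  have h1 : ∀ z ∈ domO (n := n) c ⊓ domO (n := n) c', z ∈ dom (n := n) c := fun z hz => hz.1
  have h2 : ∀ z ∈ domO (n := n) c ⊓ domO (n := n) c', z ∈ dom (n := n) c' := fun z hz => hz.2
  rw [← is_del hg h1 (is_nullVec hg hl) (is_kapFun hκ) y ⟨hc, hc'⟩,
    ← is_del hg h2 (is_nullVec hg hl) (is_kapFun hκ) y ⟨hc, hc'⟩,
    Algebraic.del_eq (isFrame hg h1) (isFrame hg h2) (isLeviCivita hg h1)]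

include hg hl in
theorem numC_eq {X Y : VField n M} (hX : ∀ y ∈ U, VecAt X y) (hY : ∀ y ∈ U, VecAt Y y)
    {c c' y : M} (hy : y ∈ U) (hc : y ∈ dom (n := n) c) (hc' : y ∈ dom (n := n) c') :
    numC c g (sharp g l) X Y y = numC c' g (sharp g l) X Y y := by
  have h1 : ∀ z ∈ U ⊓ domO (n := n) c ⊓ domO (n := n) c', z ∈ dom (n := n) c := fun z hz => hz.1.2
  have h2 : ∀ z ∈ U ⊓ domO (n := n) c ⊓ domO (n := n) c', z ∈ dom (n := n) c' := fun z hz => hz.2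
  have hX' := Vec.Is.of (U := U ⊓ domO (n := n) c ⊓ domO (n := n) c') fun z hz => hX z hz.1.1
  have hY' := Vec.Is.of (U := U ⊓ domO (n := n) c ⊓ domO (n := n) c') fun z hz => hY z hz.1.1
  rw [← is_num hg h1 (is_nullVec hg hl) hX' hY' y ⟨⟨hy, hc⟩, hc'⟩,
    ← is_num hg h2 (is_nullVec hg hl) hX' hY' y ⟨⟨hy, hc⟩, hc'⟩,
    Algebraic.num_eq (isFrame hg h1) (isFrame hg h2) (isLeviCivita hg h1)]

/-! ### The concrete quantities at the centre of a chart -/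

theorem divergence_eq (g : BilinField n M) (X : VField n M) (y : M) :
    divergence g X y = dvgC y g X y := by
  simp only [divergence, dvgC, coframe_eq_cof]

theorem ricci_eq (g : BilinField n M) (Y Z : VField n M) (y : M) :
    ricci g Y Z y = ricC y g Y Z y := by
  simp only [ricci, ricC, coframe_eq_cof]

theorem invMetric_eq {g : BilinField n M} (hg : IsMetric g) (y : M) (i j : Fin n) :
    invMetric g y i j = g y (grad g y i y) (grad g y j y) := by
  have : coframe y j = cofL y j y := by
    ext v
    exact coframe_eq_cof y j v
  rw [metric_grad hg, invMetric, coframe_eq_cof, this]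
  rfl

include hg in
theorem scalarCurvature_eq (y : M) : scalarCurvature g y = scalC y g y := by
  simp only [scalarCurvature, scalC, invMetric_eq hg, ricci_eq]

-- The correction ∇_{∇_U V} L is orthogonal to L, and the iterated derivative is handled by
-- `metric_self_nab_nab`.
include hg hl hκ in
theorem apply_boxField (y : M) : l y (boxField g (sharp g l) y) = -gradSqC y g (sharp g l) y := by
  have hU : ∀ z ∈ domO (n := n) y, z ∈ dom (n := n) y := fun z hz => hz
  have hy : y ∈ domO (n := n) y := mem_dom y
  have hL := is_nullVec (U := domO (n := n) y) hg hl
  have N := isNullGeodesic (U := domO (n := n) y) hg hl hκ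
  have H := isLeviCivita hg hU
  have h1 (i j : Fin n) : l y (nabla g (frame y i) (nabla g (frame y j) (sharp g l)) y)
      = - g y (nabla g (frame y i) (sharp g l) y) (nabla g (frame y j) (sharp g l) y) := by
    have := congrArg (fun f : Fun n (domO (n := n) y) => f.rep y)
      (N.metric_self_nab_nab H (frm hU i) (frm hU j))
    simp only [Fun.rep_neg hy] at this
    rw [rep_toForm_is hg.at hL ((Vec.Is.frm hU i).conn hg ((Vec.Is.frm hU j).conn hg hL)) hy,
      rep_toForm_is hg.at ((Vec.Is.frm hU i).conn hg hL) ((Vec.Is.frm hU j).conn hg hL) hy,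
      hg.apply_sharp] at this
    exact this
  have h2 (i j : Fin n) : l y (nabla g (nabla g (frame y i) (frame y j)) (sharp g l) y) = 0 := by
    have := congrArg (fun f : Fun n (domO (n := n) y) => f.rep y)
      (N.metric_self_nab H (toConn _ hg (frm hU i) (frm hU j)))
    simp only [Fun.rep_zero hy] at this
    rw [rep_toForm_is hg.at hL (((Vec.Is.frm hU i).conn hg (Vec.Is.frm hU j)).conn hg hL) hy,
      hg.apply_sharp] at this
    exact this
  simp only [boxField, map_sum, map_smul, map_sub, h1, h2, smul_eq_mul, gradSqC, invMetric_eq hg,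
    sub_zero, mul_neg, Finset.sum_neg_distrib]

-- `Delta` uses a chart that changes with the point. The fixed-chart expression makes it a smooth
-- function to which `lie_del` applies.
include hg hl hκ in
theorem Delta_eq {c y : M} (hc : y ∈ dom (n := n) c) :
    Delta g l κ y = delC c g (sharp g l) κ y := by
  rw [delC_eq hg hl hκ hc (mem_dom y)]
  have hU : ∀ z ∈ domO (n := n) y, z ∈ dom (n := n) y := fun z hz => hz
  have hy : y ∈ domO (n := n) y := mem_dom y
  have hsm : FunAt n (dvgC y g (sharp g l)) y :=
    (is_dvg hg hU (is_nullVec (U := domO (n := n) y) hg hl)).funAt hy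
  -- The term Dθ needs equality near y and not only at y. With θ half the divergence, -2Dθ, 4θ² and
  -- -2κθ become the coefficients in `del`.
  have hev : expansion g l =ᶠ[𝓝 y] (fun _ => (1 / 2 : ℝ)) * dvgC y g (sharp g l) := by
    filter_upwards [(isOpen_dom (n := n) y).mem_nhds (mem_dom y)] with z hz
    rw [expansion, divergence_eq, dvgC_eq hg (U := ⊤) (fun x _ => hl.vecAt hg x) trivial
      (mem_dom z) hz]
    rfl
  have hc0 : lieFun (sharp g l) (fun _ : M => (1 / 2 : ℝ)) y = 0 := by
    simp [lieFun, mvfderiv_const]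
  have hD : dirD g l (expansion g l) y = 1 / 2 * lieFun (sharp g l) (dvgC y g (sharp g l)) y := by
    rw [dirD, lieFun_congr rfl hev, lieFun_mul _ contMDiffAt_const hsm, hc0]
    ring
  rw [Delta, hD, hev.self_of_nhds, apply_boxField hg hl hκ, ricci_eq, delC, dirD]
  simp only [Pi.mul_apply]
  ring

-- `tensorT` is assembled from frame components at y; bilinearity of `num` over functions extends
-- the formula to all smooth fields and all charts.
include hg hl in
theorem tensorT_eq {X Y : VField n M} (hX : ∀ y ∈ U, VecAt X y) (hY : ∀ y ∈ U, VecAt Y y)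
    {c y : M} (hy : y ∈ U) (hc : y ∈ dom (n := n) c) : tensorT g l κ y (X y) (Y y)
      = (Delta g l κ y)⁻¹ * numC c g (sharp g l) X Y y := by
  rw [numC_eq hg hl hX hY hy hc (mem_dom y)]
  set V := U ⊓ domO (n := n) y
  have hU : ∀ z ∈ V, z ∈ dom (n := n) y := fun z hz => hz.2
  have hy : y ∈ V := ⟨hy, mem_dom y⟩
  have hX' := Vec.Is.of (U := V) fun z hz => hX z hz.1
  have hY' := Vec.Is.of (U := V) fun z hz => hY z hz.1
  have F := isFrame hg hU
  have hL := is_nullVec (U := V) hg hl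
  have hB := Algebraic.bilin_num (e := frm hU) (f := cofrm hg hU) (isLeviCivita hg hU)
    (nullVec V hg hl)
  rw [tensorT, smul_apply, smul_apply, smul_eq_mul, bilinAt_apply,
    ← is_num hg hU hL hX' hY' y hy]
  congr 1
  rw [← F.apply_eq_sum (φ := fun X => Algebraic.num _ _ _ _ _ X _)
    (fun _ _ => hB.add_left _ _ _) (fun _ _ => hB.smul_left _ _ _), Fun.rep_sum hy]
  refine Finset.sum_congr rfl fun i _ => ?_
  rw [← F.apply_eq_sum (fun _ _ => hB.add_right _ _ _) (fun _ _ => hB.smul_right _ _ _),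
    Fun.rep_mul hy, Fun.rep_sum hy, Finset.mul_sum]
  refine Finset.sum_congr rfl fun j _ => ?_
  rw [Fun.rep_mul hy, is_num hg hU hL (Vec.Is.frm hU i) (Vec.Is.frm hU j) y hy,
    Fun.Is.toForm_cofrm hg hU i hX' y hy, Fun.Is.toForm_cofrm hg hU j hY' y hy, numC]
  simp only [hg.apply_sharp, ricci_eq, scalarCurvature_eq hg]
  ring

include hg hl hκ in
theorem funAt_Delta (y : M) : FunAt n (Delta g l κ) y := by
  have hU : ∀ z ∈ domO (n := n) y, z ∈ dom (n := n) y := fun z hz => hz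
  have hy : y ∈ domO (n := n) y := mem_dom y
  refine ((is_del hg hU (is_nullVec hg hl) (is_kapFun hκ)).funAt hy).congr_of_eventuallyEq ?_
  exact eventuallyEq_of_open (fun z hz => Delta_eq hg hl hκ hz) hy

include hg hl hκ in
theorem bilinAt_tensorT (hΔ : ∀ x, Delta g l κ x ≠ 0) (y : M) : BilinAt (tensorT g l κ) y := by
  have hU : ∀ z ∈ domO (n := n) y, z ∈ dom (n := n) y := fun z hz => hz
  have hy : y ∈ domO (n := n) y := mem_dom y
  refine BilinAt.of_frame fun i j => ?_
  refine (((funAt_Delta hg hl hκ y).inv₀ (hΔ y)).mul ((is_num hg hU (is_nullVec hg hl)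
    (Vec.Is.frm hU i) (Vec.Is.frm hU j)).funAt hy)).congr_of_eventuallyEq ?_
  exact eventuallyEq_of_open (fun z hz => tensorT_eq hg hl (fun z hz => VecAt.frame y i hz)
    (fun z hz => VecAt.frame y j hz) hz (hU z hz)) hy

include hg hl in
theorem tensorT_symm (y : M) (u v : TangentSpace (𝓡 n) y) :
    tensorT g l κ y u v = tensorT g l κ y v u := by
  have hU : ∀ z ∈ domO (n := n) y, z ∈ dom (n := n) y := fun z hz => hz
  have hy : y ∈ domO (n := n) y := mem_dom y
  have hL := is_nullVec (U := domO (n := n) y) hg hl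
  have key (i j : Fin n) : tensorT g l κ y (frame y i y) (frame y j y)
      = tensorT g l κ y (frame y j y) (frame y i y) := by
    rw [tensorT_eq hg hl (fun z hz => VecAt.frame y i hz) (fun z hz => VecAt.frame y j hz) hy hy,
      tensorT_eq hg hl (fun z hz => VecAt.frame y j hz) (fun z hz => VecAt.frame y i hz) hy hy,
      ← is_num hg hU hL (Vec.Is.frm hU i) (Vec.Is.frm hU j) y hy,
      ← is_num hg hU hL (Vec.Is.frm hU j) (Vec.Is.frm hU i) y hy, Algebraic.num_symm (isLeviCivita hg hU)]
  rw [← sum_cof (mem_dom y) u, ← sum_cof (mem_dom y) v]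
  simp only [map_sum, map_smul, sum_apply, smul_apply, smul_eq_mul, Finset.mul_sum]
  rw [Finset.sum_comm]
  refine Finset.sum_congr rfl fun i _ => Finset.sum_congr rfl fun j _ => ?_
  rw [key]
  ring

end

end

/-! ### Transfer of the Kerr-Schild identities, and the characterization by invariance of γ. -/

section

open Filter Topology Bundle VectorField TopologicalSpace

variable {n : ℕ} {M : Type*} [TopologicalSpace M] [ChartedSpace (EuclideanSpace ℝ (Fin n)) M]
  [IsManifold (𝓡 n) ∞ M] {U : Opens M}

/-! ### Lie derivatives of bilinear fields -/

theorem bilin_ext {x : M} {B B' : TangentSpace (𝓡 n) x →L[ℝ] TangentSpace (𝓡 n) x →L[ℝ] ℝ}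
    (h : ∀ i j, B (frame x i x) (frame x j x) = B' (frame x i x) (frame x j x)) : B = B' := by
  refine ContinuousLinearMap.ext fun u => ContinuousLinearMap.ext fun v => ?_
  rw [← sum_cof (mem_dom x) u, ← sum_cof (mem_dom x) v]
  simp only [map_sum, map_smul, sum_apply, smul_apply, h]

theorem sq_apply (l : OneForm n M) (x : M) (u v : TangentSpace (𝓡 n) x) :
    sq l x u v = l x u * l x v := rfl

theorem neg_bilin_apply {x : M} (B : TangentSpace (𝓡 n) x →L[ℝ] TangentSpace (𝓡 n) x →L[ℝ] ℝ)
    (u v : TangentSpace (𝓡 n) x) : (-B) u v = -B u v := rfl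

theorem lieBilin_add (ξ : VField n M) {B B' : BilinField n M} {x : M} (hB : BilinAt B x)
    (hB' : BilinAt B' x) (hS : BilinAt (fun y => B y + B' y) x) :
    lieBilin ξ (fun y => B y + B' y) x = lieBilin ξ B x + lieBilin ξ B' x := by
  refine bilin_ext fun i j => ?_
  have hi := VecAt.frame x i (mem_dom x)
  have hj := VecAt.frame x j (mem_dom x)
  rw [add_apply, add_apply, lieBilin_apply hS hi hj, lieBilin_apply hB hi hj,
    lieBilin_apply hB' hi hj]
  have h := lieFun_add ξ (hB.apply hi hj) (hB'.apply hi hj)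
  simp only [add_apply]
  rw [show (fun y => B y (frame x i y) (frame x j y) + B' y (frame x i y) (frame x j y))
    = (fun y => B y (frame x i y) (frame x j y)) + fun y => B' y (frame x i y) (frame x j y)
    from rfl, h]
  ring

theorem BilinAt.add {B B' : BilinField n M} {x : M} (hB : BilinAt B x) (hB' : BilinAt B' x) :
    BilinAt (fun y => B y + B' y) x :=
  BilinAt.of_frame fun i j => (hB.apply (VecAt.frame x i (mem_dom x))
    (VecAt.frame x j (mem_dom x))).add (hB'.apply (VecAt.frame x i (mem_dom x))
      (VecAt.frame x j (mem_dom x)))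

theorem BilinAt.neg {B : BilinField n M} {x : M} (hB : BilinAt B x) :
    BilinAt (fun y => -B y) x :=
  BilinAt.of_frame fun i j => (hB.apply (VecAt.frame x i (mem_dom x))
    (VecAt.frame x j (mem_dom x))).neg

theorem lieBilin_neg (ξ : VField n M) {B : BilinField n M} {x : M} (hB : BilinAt B x) :
    lieBilin ξ (fun y => -B y) x = -lieBilin ξ B x := by
  refine bilin_ext fun i j => ?_
  have hi := VecAt.frame x i (mem_dom x)
  have hj := VecAt.frame x j (mem_dom x)
  have h := lieFun_add ξ (hB.apply hi hj) (hB.apply hi hj).neg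
  rw [show (fun y => B y (frame x i y) (frame x j y)) + (fun y => -B y (frame x i y) (frame x j y))
    = fun _ => (0 : ℝ) from funext fun y => add_neg_cancel _] at h
  have h0 : lieFun ξ (fun _ : M => (0 : ℝ)) x = 0 := by simp [lieFun, mvfderiv_const]
  rw [neg_bilin_apply, lieBilin_apply hB.neg hi hj, lieBilin_apply hB hi hj]
  simp only [neg_bilin_apply]
  linarith

theorem PreservesDirection.lie_apply {l : OneForm n M} {ξ : VField n M} {m : M → ℝ}
    (P : PreservesDirection l ξ m) {X : VField n M} {x : M} (hl : FormAt l x) (hX : VecAt X x) :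
    lieFun ξ (fun y => l y (X y)) x = l x (mlieBracket (𝓡 n) ξ X x) + m x * l x (X x) := by
  have := lieForm_apply (ξ := ξ) hl hX
  rw [P.eq, smul_apply, smul_eq_mul] at this
  linarith

/-- The Lie derivative of a multiple of `ℓ ⊗ ℓ`. -/
theorem lieBilin_smul_sq {l : OneForm n M} (hl : SmoothForm l) {ξ : VField n M} {m f : M → ℝ}
    (P : PreservesDirection l ξ m) {x : M} (hf : FunAt n f x)
    (hB : BilinAt (fun y => f y • sq l y) x) : lieBilin ξ (fun y => f y • sq l y) x
      = (lieFun ξ f x + 2 * m x * f x) • sq l x := by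
  refine bilin_ext fun i j => ?_
  have hi := VecAt.frame x i (mem_dom x)
  have hj := VecAt.frame x j (mem_dom x)
  have hli := FormAt.apply (hl x) hi
  have hlj := FormAt.apply (hl x) hj
  rw [lieBilin_apply hB hi hj]
  simp only [smul_apply, sq_apply, smul_eq_mul]
  rw [show (fun y => f y * (l y (frame x i y) * l y (frame x j y)))
    = f * ((fun y => l y (frame x i y)) * fun y => l y (frame x j y)) from rfl,
    lieFun_mul ξ hf (hli.mul hlj), lieFun_mul ξ hli hlj, P.lie_apply (hl x) hi,
    P.lie_apply (hl x) hj]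
  simp only [Pi.mul_apply]
  ring

section

variable {g : BilinField n M} (hg : IsMetric g) {l : OneForm n M} (hl : IsNull g l) {κ : M → ℝ}
  (hκ : IsGeodesic g l κ) {ξ : VField n M} {h m : M → ℝ}

theorem isKS (K : IsKerrSchildWith g l ξ h m) :
    Algebraic.IsKS (toForm U hg.at) (nullVec U hg hl) (Vec.of ξ fun y _ => K.smooth y)
      (Fun.of h fun y _ => K.smooth_h y) (Fun.of m fun y _ => K.lie_form.smooth y) where
  lie_metric X Y := Fun.ext fun y hy => by
    have hξ : (Vec.of (U := U) ξ fun y _ => K.smooth y).Is ξ := Vec.Is.of _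
    have hX := Vec.Is.rep X
    have hY := Vec.Is.rep Y
    have hL := is_nullVec (U := U) hg hl
    have key := lieBilin_apply (ξ := ξ) (hg.at y) (X.smooth hy) (Y.smooth hy)
    rw [K.lie_metric] at key
    rw [(Fun.Is.toForm hg.at hX hY).lie hξ y hy, Fun.rep_add hy, Fun.rep_add hy, Fun.rep_mul hy,
      Fun.rep_mul hy, Fun.rep_mul hy, rep_toForm_is hg.at (hξ.lie hX) hY hy,
      rep_toForm_is hg.at hX (hξ.lie hY) hy, rep_toForm_is hg.at hL hX hy,
      rep_toForm_is hg.at hL hY hy, hg.apply_sharp, hg.apply_sharp, Fun.rep_of _ hy,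
      Fun.rep_ofNat hy]
    simp only [smul_apply, smul_eq_mul, sq_apply] at key
    linarith
  lie_form X := Fun.ext fun y hy => by
    have hξ : (Vec.of (U := U) ξ fun y _ => K.smooth y).Is ξ := Vec.Is.of _
    have hX := Vec.Is.rep X
    have hL := is_nullVec (U := U) hg hl
    have key := K.lie_form.lie_apply (hl.smooth y) (X.smooth hy)
    rw [(Fun.Is.toForm hg.at hL hX).lie hξ y hy, Fun.rep_add hy, Fun.rep_mul hy,
      rep_toForm_is hg.at hL (hξ.lie hX) hy, rep_toForm_is hg.at hL hX hy, hg.apply_sharp,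
      hg.apply_sharp, Fun.rep_of _ hy]
    simpa only [hg.apply_sharp] using key

include hg hl hκ

theorem IsKerrSchildWith.lieFun_Delta (K : IsKerrSchildWith g l ξ h m) (x : M) :
    lieFun ξ (Delta g l κ) x = 2 * m x * Delta g l κ x := by
  have hU : ∀ z ∈ domO (n := n) x, z ∈ dom (n := n) x := fun z hz => hz
  have hx : x ∈ domO (n := n) x := mem_dom x
  have hξ : (Vec.of (U := domO (n := n) x) ξ fun y _ => K.smooth y).Is ξ := Vec.Is.of _
  have hd : (Algebraic.del (toForm (domO (n := n) x) hg.at) (toConn _ hg) (frm hU) (cofrm hg hU)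
      (nullVec _ hg hl) (kapFun _ hκ)).Is (Delta g l κ) := fun y hy => by
    rw [Delta_eq hg hl hκ hy, is_del hg hU (is_nullVec hg hl) (is_kapFun hκ) y hy]
  have := congrArg (fun f : Fun n (domO (n := n) x) => f.rep x) ((isKS hg hl K).lie_del
    (isLeviCivita hg hU) (isNullGeodesic hg hl hκ) (isFrame hg hU))
  simp only [Fun.rep_mul hx, Fun.rep_ofNat hx, Fun.rep_of _ hx] at this
  rw [hd.lie hξ x hx, hd x hx] at this
  exact this

theorem IsKerrSchildWith.lieBilin_tensorT (hΔ : ∀ x, Delta g l κ x ≠ 0)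
    (K : IsKerrSchildWith g l ξ h m) (x : M) :
    lieBilin ξ (tensorT g l κ) x = (-(2 * h x)) • sq l x := by
  have hU : ∀ z ∈ domO (n := n) x, z ∈ dom (n := n) x := fun z hz => hz
  have hx : x ∈ domO (n := n) x := mem_dom x
  have hξ : (Vec.of (U := domO (n := n) x) ξ fun y _ => K.smooth y).Is ξ := Vec.Is.of _
  have hL := is_nullVec (U := domO (n := n) x) hg hl
  have hT := bilinAt_tensorT hg hl hκ hΔ
  have hd : (Algebraic.del (toForm (domO (n := n) x) hg.at) (toConn _ hg) (frm hU) (cofrm hg hU)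
      (nullVec _ hg hl) (kapFun _ hκ)).Is (Delta g l κ) := fun y hy => by
    rw [Delta_eq hg hl hκ hy, is_del hg hU hL (is_kapFun hκ) y hy]
  -- The relation is used as N = ΔT, so that Leibniz with `lie_num` and `lie_del` gives Δ L_ξ T =
  -- -2hΔ ℓ⊗ℓ without differentiating a quotient.
  have hn (X Y : Vec n (domO (n := n) x)) : Algebraic.num (toForm (domO (n := n) x) hg.at)
      (toConn _ hg) (frm hU) (cofrm hg hU) (nullVec _ hg hl) X Y
      = Algebraic.del (toForm (domO (n := n) x) hg.at) (toConn _ hg) (frm hU) (cofrm hg hU)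
      (nullVec _ hg hl) (kapFun _ hκ) * toForm _ hT X Y := Fun.ext fun y hy => by
    rw [Fun.rep_mul hy, hd y hy, rep_toForm hT _ _ hy, tensorT_eq hg hl (fun z hz => X.smooth hz)
      (fun z hz => Y.smooth hz) hy hy, is_num hg hU hL (Vec.Is.rep X) (Vec.Is.rep Y) y hy,
      mul_inv_cancel_left₀ (hΔ y)]
  refine bilin_ext fun i j => ?_
  set X : Vec n (domO (n := n) x) := frm hU i
  set Y : Vec n (domO (n := n) x) := frm hU j
  have hX : X.Is (frame x i) := Vec.Is.frm hU i
  have hY : Y.Is (frame x j) := Vec.Is.frm hU j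
  have h1 := (isKS hg hl K).lie_num (isLeviCivita hg hU) (isNullGeodesic hg hl hκ)
    (isFrame hg hU) X Y
  have h2 := (isKS hg hl K).lie_del (isLeviCivita hg hU) (isNullGeodesic hg hl hκ)
    (isFrame hg hU)
  rw [hn, hn, hn, LieRinehartRing.leibniz_mul_right, h2] at h1
  have h3 := congrArg (fun f : Fun n (domO (n := n) x) => f.rep x) h1
  simp only [smul_eq_mul, Fun.rep_add hx, Fun.rep_sub hx, Fun.rep_mul hx, Fun.rep_ofNat hx,
    Fun.rep_of _ hx] at h3
  rw [hd x hx, (Fun.Is.toForm hT hX hY).lie hξ x hx, rep_toForm_is hT (hξ.lie hX) hY hx,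
    rep_toForm_is hT hX (hξ.lie hY) hx, rep_toForm_is hT hX hY hx, rep_toForm_is hg.at hL hX hx,
    rep_toForm_is hg.at hL hY hx, hg.apply_sharp, hg.apply_sharp] at h3
  rw [lieBilin_apply (hT x) (VecAt.frame x i hx) (VecAt.frame x j hx), smul_apply, smul_apply,
    smul_eq_mul, sq_apply]
  refine mul_left_cancel₀ (hΔ x) ?_
  linear_combination h3

theorem lieBilin_gammaT (hΔ : ∀ x, Delta g l κ x ≠ 0) (ξ : VField n M) (x : M) :
    lieBilin ξ (gammaT g l κ) x = lieBilin ξ g x + lieBilin ξ (tensorT g l κ) x :=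
  lieBilin_add ξ (hg.at x) (bilinAt_tensorT hg hl hκ hΔ x)
    ((hg.at x).add (bilinAt_tensorT hg hl hκ hΔ x))

theorem IsKerrSchildWith.lieBilin_gammaT (hΔ : ∀ x, Delta g l κ x ≠ 0)
    (K : IsKerrSchildWith g l ξ h m) (x : M) : lieBilin ξ (gammaT g l κ) x = 0 := by
  refine bilin_ext fun i j => ?_
  rw [KerrSchild.lieBilin_gammaT hg hl hκ hΔ, K.lie_metric, K.lieBilin_tensorT hg hl hκ hΔ]
  simp only [add_apply, smul_apply, smul_eq_mul, zero_apply]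
  ring

theorem isKerrSchild_iff (hΔ : ∀ x, Delta g l κ x ≠ 0) (hξ : SmoothField ξ) :
    IsKerrSchild g l ξ ↔ (∀ x, lieBilin ξ (gammaT g l κ) x = 0) ∧
      (∃ m : M → ℝ, PreservesDirection l ξ m) ∧
      (∃ f : M → ℝ, ContMDiff (𝓡 n) 𝓘(ℝ, ℝ) ∞ f ∧
        ∀ x, lieBilin ξ (tensorT g l κ) x = f x • sq l x) := by
  constructor
  · rintro ⟨h, m, K⟩
    exact ⟨K.lieBilin_gammaT hg hl hκ hΔ, ⟨m, K.lie_form⟩, fun x => -(2 * h x),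
      (contMDiff_const.mul K.smooth_h).neg, K.lieBilin_tensorT hg hl hκ hΔ⟩
  · rintro ⟨h0, ⟨m, hm⟩, f, hf, hT⟩
    -- The value of h is forced by 2h ℓ⊗ℓ = L_ξ g = -L_ξ T = -f ℓ⊗ℓ.
    refine ⟨fun x => -(1 / 2) * f x, m, hξ, contMDiff_const.mul hf, fun x => ?_, hm⟩
    have := h0 x
    rw [KerrSchild.lieBilin_gammaT hg hl hκ hΔ, hT] at this
    refine bilin_ext fun i j => ?_
    have h2 := congrArg (fun B => B (frame x i x) (frame x j x)) this
    simp only [add_apply, smul_apply, smul_eq_mul, zero_apply] at h2 ⊢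
    linarith

theorem isMetric_gammaT (hΔ : ∀ x, Delta g l κ x ≠ 0) (hdet : ∀ x, detAt (gammaT g l κ) x ≠ 0) :
    IsMetric (gammaT g l κ) where
  smooth x := (hg.at x).add (bilinAt_tensorT hg hl hκ hΔ x)
  symm x u v := by
    simp only [gammaT, add_apply, hg.symm x u v, tensorT_symm hg hl x u v]
  nondegenerate x u hu := (det_comps_ne_zero_iff (mem_dom x)).1 (hdet x) u fun v => by
    rw [← hu v]
    simp only [gammaT, add_apply, hg.symm x u v, tensorT_symm hg hl x u v]

end

end

end KerrSchild

end

theorem mainTheorem3 {n : ℕ} {M : Type*} [TopologicalSpace M] [T2Space M]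
    [ChartedSpace (EuclideanSpace ℝ (Fin n)) M] [IsManifold (𝓡 n) ∞ M]
    (g : KerrSchild.BilinField n M) (hg : KerrSchild.IsMetric g)
    (l : KerrSchild.OneForm n M) (hl : KerrSchild.IsNull g l)
    (κ : M → ℝ) (hκ : KerrSchild.IsGeodesic g l κ)
    (hΔ : ∀ x, KerrSchild.Delta g l κ x ≠ 0) :
    -- `Δ` is a smooth function and `T` is a smooth symmetric tensor field
    ContMDiff (𝓡 n) 𝓘(ℝ, ℝ) ∞ (KerrSchild.Delta g l κ) ∧
    KerrSchild.SmoothBilin (KerrSchild.tensorT g l κ) ∧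
    (∀ (x : M) (u v : TangentSpace (𝓡 n) x),
      KerrSchild.tensorT g l κ x u v = KerrSchild.tensorT g l κ x v u) ∧
    -- Kerr-Schild fields: `L_ξ Δ = 2 m Δ`, `2 h ℓ ⊗ ℓ = L_ξ (-T)` and `L_ξ γ = 0`
    (∀ (ξ : KerrSchild.VField n M) (h m : M → ℝ), KerrSchild.IsKerrSchildWith g l ξ h m →
      (∀ x, KerrSchild.lieFun ξ (KerrSchild.Delta g l κ) x
        = 2 * m x * KerrSchild.Delta g l κ x) ∧
      (∀ x, (2 * h x) • KerrSchild.sq l x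
        = KerrSchild.lieBilin ξ (fun y => -KerrSchild.tensorT g l κ y) x) ∧
      (∀ x, KerrSchild.lieBilin ξ (KerrSchild.gammaT g l κ) x = 0)) ∧
    -- characterization of the Kerr-Schild fields by the invariance of `γ`
    (∀ ξ : KerrSchild.VField n M, KerrSchild.SmoothField ξ →
      (KerrSchild.IsKerrSchild g l ξ ↔
        (∀ x, KerrSchild.lieBilin ξ (KerrSchild.gammaT g l κ) x = 0) ∧
        (∃ m : M → ℝ, KerrSchild.PreservesDirection l ξ m) ∧
        (∃ f : M → ℝ, ContMDiff (𝓡 n) 𝓘(ℝ, ℝ) ∞ f ∧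
          ∀ x, KerrSchild.lieBilin ξ (KerrSchild.tensorT g l κ) x
            = f x • KerrSchild.sq l x))) ∧
    -- if `T` is a multiple of `ℓ ⊗ ℓ`, the last condition is automatic
    ((∃ f : M → ℝ, ContMDiff (𝓡 n) 𝓘(ℝ, ℝ) ∞ f ∧
        ∀ x, KerrSchild.tensorT g l κ x = f x • KerrSchild.sq l x) →
      ∀ ξ : KerrSchild.VField n M, KerrSchild.SmoothField ξ →
        (KerrSchild.IsKerrSchild g l ξ ↔
          (∀ x, KerrSchild.lieBilin ξ (KerrSchild.gammaT g l κ) x = 0) ∧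
          (∃ m : M → ℝ, KerrSchild.PreservesDirection l ξ m))) ∧
    -- if `det γ ≠ 0`, then `γ` is a metric and the fields leaving it invariant are Killing
    ((∀ x, KerrSchild.detAt (KerrSchild.gammaT g l κ) x ≠ 0) →
      KerrSchild.IsMetric (KerrSchild.gammaT g l κ) ∧
      (∀ ξ : KerrSchild.VField n M, KerrSchild.SmoothField ξ →
        (∀ x, KerrSchild.lieBilin ξ (KerrSchild.gammaT g l κ) x = 0) →
        KerrSchild.IsKilling (KerrSchild.gammaT g l κ) ξ) ∧
      (∀ ξ : KerrSchild.VField n M, KerrSchild.IsKerrSchild g l ξ →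
        KerrSchild.IsKilling (KerrSchild.gammaT g l κ) ξ)) := by
  open KerrSchild in
  have hT := bilinAt_tensorT hg hl hκ hΔ
  refine ⟨funAt_Delta hg hl hκ, hT, tensorT_symm hg hl, fun ξ h m K => ⟨K.lieFun_Delta hg hl hκ,
    fun x => ?_, K.lieBilin_gammaT hg hl hκ hΔ⟩, fun ξ hξ => isKerrSchild_iff hg hl hκ hΔ hξ,
    ?_, fun hdet => ?_⟩
  · refine bilin_ext fun i j => ?_
    rw [lieBilin_neg ξ (hT x), K.lieBilin_tensorT hg hl hκ hΔ]
    simp only [neg_bilin_apply, smul_apply, smul_eq_mul]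
    ring
  · rintro ⟨f, hf, hTf⟩ ξ hξ
    rw [isKerrSchild_iff hg hl hκ hΔ hξ]
    refine ⟨fun H => ⟨H.1, H.2.1⟩, fun H => ⟨H.1, H.2, ?_⟩⟩
    obtain ⟨m, hm⟩ := H.2
    have hTf' : tensorT g l κ = fun y => f y • KerrSchild.sq l y := funext hTf
    -- For T = f ℓ⊗ℓ, each factor ℓ contributes m to the Lie derivative, so L_ξ T is automatically a
    -- multiple of ℓ⊗ℓ.
    refine ⟨fun x => lieFun ξ f x + 2 * m x * f x, fun x => (FunAt.lieFun (hξ x) (hf x)).add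
      ((contMDiffAt_const.mul (hm.smooth x)).mul (hf x)), fun x => ?_⟩
    rw [hTf'] at hT ⊢
    exact lieBilin_smul_sq hl.smooth hm (hf x) (hT x)
  · have hm := isMetric_gammaT hg hl hκ hΔ hdet
    exact ⟨hm, fun ξ hξ h0 => ⟨hm, hξ, h0⟩,
      fun ξ ⟨h, m, K⟩ => ⟨hm, K.smooth, K.lieBilin_gammaT hg hl hκ hΔ⟩⟩
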